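/- Let $\Gamma$ be a countably infinite group with Kazhdan's Property (T), that is: there are a finite generating set $T\subseteq\Gamma$ and $\varepsilon>0$ such that every unitary representation $\pi$ of $\Gamma$ on a complex Hilbert space $\mathcal H$ either has a non-zero invariant vector or satisfies $\bigl\|\frac1{|T|}\sum_{t\in T}\pi(t)h\bigr\|\le(1-\varepsilon)\|h\|$ for all $h\in\mathcal H\setminus\{0\}$. Let $S$ be any finite generating set of $\Gamma$, and let $d$ be the degree of the (simple, undirected, unlabeled) Cayley graph $\mathrm{Cay}(\Gamma,S)$. Let $(G_n)_{n\ge1}$ be a sequence of finite simple graphs of uniformly bounded degree that converges locally to $\mathrm{Cay}(\Gamma,S)$: for every $r$, the proportion of vertices $x\in V(G_n)$ whose rooted $r$-ball is isomorphic, as a rooted graph, to the rooted $r$-ball of $\mathrm{Cay}(\Gamma,S)$ tends to $1$ as $n\to\infty$. Then there are $\gamma>0$ and finite simple graphs $(G'_n)_{n\ge1}$ such that 1. $V(G'_n)=V(G_n)$ for every $n$; 2. $\lim_{n\to\infty}\dfrac{|E(G_n)\,\triangle\,E(G'_n)|}{|V(G_n)|}=0$; 3. for every $n$ for which there is any $d$-regular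 simple graph on the vertex set $V(G_n)$ (in particular whenever $G_n$ itself is $d$-regular), $G'_n$ is $d$-regular and is a vertex-disjoint union of $d$-regular $\gamma$-expanders. Here a finite $d$-regular graph $H$ is a $\gamma$-expander if $|E(A,V(H)\setminus A)|\ge\gamma d|A|$ for every $A\subseteq V(H)$ with $|A|\le|V(H)|/2$. -/

import Mathlib

open Filter Topology

universe u v

section Kazhdan

/-- The average `(1 / |S|) ∑ s ∈ S, π s h` for a unitary representation `π`. -/
noncomputable def repAverage {Γ : Type u} [Group Γ] {H : Type v} [NormedAddCommGroup H]
    [InnerProductSpace ℂ H] (π : Γ →* (H ≃ₗᵢ[ℂ] H)) (S : Finset Γ) (h : H) : H :=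
  (S.card : ℂ)⁻¹ • ∑ s ∈ S, π s h

/-- Kazhdan's Property (T) of a finitely generated group: for some finite generating set `S` and
some `ε > 0`, every unitary representation `π` on a complex Hilbert space either has a nonzero
invariant vector or satisfies `‖(1 / |S|) ∑ s ∈ S, π s h‖ ≤ (1 - ε) ‖h‖` for all `h`.
A group with a finite generating set is countable, so its cyclic representations live on separable
Hilbert spaces; hence Hilbert spaces whose carrier is in `Type` give the same notion as Hilbert
spaces in any larger universe. -/
def HasKazhdanPropertyT (Γ : Type u) [Group Γ] : Prop :=
  ∃ S : Finset Γ, Subgroup.closure (S : Set Γ) = ⊤ ∧ ∃ ε : ℝ, 0 < ε ∧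
    ∀ (H : Type) [NormedAddCommGroup H] [InnerProductSpace ℂ H] [CompleteSpace H]
      (π : Γ →* (H ≃ₗᵢ[ℂ] H)),
      (∃ h : H, h ≠ 0 ∧ ∀ g : Γ, π g h = h) ∨
        ∀ h : H, h ≠ 0 → ‖repAverage π S h‖ ≤ (1 - ε) * ‖h‖

end Kazhdan

namespace SimpleGraph

/-- The vertices at distance at most `r` from `x` (unreachable vertices are at distance `⊤`). -/
def rBall {V : Type u} (G : SimpleGraph V) (x : V) (r : ℕ) : Set V :=
  {y | G.edist x y ≤ (r : ℕ∞)}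

theorem mem_rBall_self {V : Type u} (G : SimpleGraph V) (x : V) (r : ℕ) : x ∈ G.rBall x r := by
  simp [rBall]

/-- The `r`-ball of `G` around `x` and the `r`-ball of `H` around `y` are isomorphic as rooted
graphs. -/
def RootedBallIso {V : Type u} {W : Type v} (G : SimpleGraph V) (x : V) (H : SimpleGraph W) (y : W)
    (r : ℕ) : Prop :=
  ∃ e : G.induce (G.rBall x r) ≃g H.induce (H.rBall y r),
    e ⟨x, G.mem_rBall_self x r⟩ = ⟨y, H.mem_rBall_self y r⟩

/-- The finite graphs `G n` converge locally to the Cayley graph of `Γ` with respect to `S`: for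
every `r`, the proportion of the vertices of `G n` whose rooted `r`-ball is isomorphic to the
rooted `r`-ball of the Cayley graph tends to `1`. -/
def LocallyConvergesToCayley {Γ : Type v} [Group Γ] (S : Set Γ) {V : ℕ → Type u}
    [∀ n, Finite (V n)] (G : ∀ n, SimpleGraph (V n)) : Prop :=
  ∀ r : ℕ, Tendsto
    (fun n => (({x : V n | RootedBallIso (G n) x (mulCayley S) (1 : Γ) r}.ncard : ℕ) : ℝ) /
      (Nat.card (V n) : ℝ)) atTop (𝓝 1)

/-- The (common) degree of the vertices of the Cayley graph of `Γ` with respect to `S`. -/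
noncomputable def cayleyDegree {Γ : Type v} [Group Γ] (S : Set Γ) : ℕ :=
  ((mulCayley S).neighborSet 1).ncard

/-- A finite graph is `d`-regular. -/
def IsRegularGraph {V : Type u} [Finite V] (G : SimpleGraph V) (d : ℕ) : Prop :=
  ∀ x : V, (G.neighborSet x).ncard = d

/-- The number of edges between `S` and its complement. -/
noncomputable def edgeBoundaryCard {V : Type u} [Finite V] (G : SimpleGraph V) (S : Set V) : ℕ :=
  {p : V × V | p.1 ∈ S ∧ p.2 ∉ S ∧ G.Adj p.1 p.2}.ncard

/-- A finite `d`-regular graph is a `γ`-expander if `|E(S, V ∖ S)| ≥ γ d |S|` for every set `S` of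
at most half of the vertices. -/
def IsRegularExpander {V : Type u} [Finite V] (G : SimpleGraph V) (d : ℕ) (γ : ℝ) : Prop :=
  G.IsRegularGraph d ∧
    ∀ S : Set V, 2 * S.ncard ≤ Nat.card V →
      γ * (d : ℝ) * (S.ncard : ℝ) ≤ (G.edgeBoundaryCard S : ℝ)

/-- `G` is a vertex-disjoint union of `d`-regular `γ`-expanders: the vertex set has a partition
(the classes of `P`) such that no edge joins distinct classes and every class induces a
`d`-regular `γ`-expander. -/
def IsDisjointUnionOfExpanders {V : Type u} [Finite V] (G : SimpleGraph V) (d : ℕ) (γ : ℝ) : Prop :=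
  ∃ P : Setoid V, (∀ x y : V, G.Adj x y → P x y) ∧
    ∀ x : V, (G.induce {y : V | P x y}).IsRegularExpander d γ

end SimpleGraph

/-! ### Positive semidefinite kernels and unitary representations -/

section Kernel

open scoped ComplexConjugate InnerProductSpace

/-! Property (T) says that the Laplacian `L` of a symmetric generating set has a spectral gap in
every unitary representation: the energy `∑ ‖π a h - h‖²` is at most a constant times `‖L h‖²`
(`exists_laplacian_gap`). The same inequality holds on the graphs up to an error `η |V|`, for
functions of norm at most 1 with values in Euclidean spaces of any dimension
(`exists_laplacian_inequality`). Otherwise the correlations of violating functions would have an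
ultralimit that is a positive definite function on `Γ`, and its representation would violate the
gap. Since the Cayley graph is unlabeled, charts are determined only up to rooted automorphisms, so
correlations are averaged over the finite orbits of these; invariance of the limit is a mass
transport argument (`exists_radius_pair_correlation`).

The error term rules out a genuine spectral gap of the graphs, but the vector-valued inequality can
be applied to a whole disjoint family of sets at once. Running the heat flow on their indicators and
rounding at a well-chosen threshold moves the family by at most `C` times its total boundary, up to
`η |V|`, and makes the boundary at most `η |V|` (`exists_smoothing`).

To partition a graph, repeatedly split off a smallest set with at most `θ` boundary edges per
vertex. In each piece take a largest subset, of at most half the piece, with at most `1 / (2C)`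
edges per vertex to the rest. Smoothing these subsets shows that their total size is small: a
smoothed set is either too large to be near its original, or, by minimality of the piece, it pays
`θ` edges per vertex (`sum_card_le_of_smoothing`). What remains of most pieces expands
(`exists_expanding_sdiff`).

Finally the pieces are made `d`-regular. Parities are corrected by dropping at most one vertex per
retained piece, the leftover vertices are distributed among the large pieces, and degrees are
completed by edge swaps that lose at most a factor `2 ^ d` in every cut (`exists_regular_rewiring`,
`exists_regular_union`). Small regular pieces receive no vertices; since balls of an infinite group
are large, these pieces consist of atypical vertices. The finitely many remaining indices use the
connected components of any `d`-regular graph, with a crude constant. -/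

/-- A real positive semidefinite kernel is the Gram matrix of a total family of vectors. -/
theorem exists_gram_of_kernel {X : Type} (k : X → X → ℝ) (hsymm : ∀ x y, k x y = k y x)
    (hpos : ∀ (s : Finset X) (c : X → ℝ), 0 ≤ ∑ x ∈ s, ∑ y ∈ s, c x * c y * k x y) :
    ∃ (H : Type) (_ : NormedAddCommGroup H) (_ : InnerProductSpace ℂ H) (_ : CompleteSpace H)
      (δ : X → H), (∀ x y, inner ℂ (δ x) (δ y) = (k x y : ℂ)) ∧
        (Submodule.span ℂ (Set.range δ)).topologicalClosure = ⊤ := by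
  classical
  let K : Matrix X X (ℂ →L[ℂ] ℂ) := .of fun x y => (k x y : ℂ) • 1
  have hK : K.PosSemidef := by
    have htfae := (RKHS.posSemidef_tfae (K := K)).out 0 2
    refine htfae.mpr ⟨?_, fun w => ?_⟩
    · ext x y
      simp only [Matrix.conjTranspose_apply, K, Matrix.of_apply]
      simp [hsymm x y]
    -- As `k` is real, the real part of the complex quadratic form is the real form at the real
    -- parts plus the real form at the imaginary parts.
    · have h1 := hpos w.support fun x => (w x).re
      have h2 := hpos w.support fun x => (w x).im
      have : RCLike.re (w.sum fun x z => w.sum fun x' z' => inner ℂ (K x' x z) z') =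
          (∑ x ∈ w.support, ∑ y ∈ w.support, (w x).re * (w y).re * k x y) +
          ∑ x ∈ w.support, ∑ y ∈ w.support, (w x).im * (w y).im * k x y := by
        simp only [Finsupp.sum, RCLike.re_to_complex, Complex.re_sum, ← Finset.sum_add_distrib]
        refine Finset.sum_congr rfl fun x _ => Finset.sum_congr rfl fun y _ => ?_
        simp [K, hsymm x y]
        ring
      rw [this]; positivity
  have : Fact K.PosSemidef := ⟨hK⟩
  refine ⟨RKHS.OfKernel K, inferInstance, inferInstance, inferInstance,
    fun x => RKHS.kerFun (RKHS.OfKernel K) x 1, fun x y => ?_, ?_⟩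
  · rw [← RKHS.kernel_inner, RKHS.OfKernel.kernel_ofKernel]
    simp [K, hsymm x y]
  · have h := RKHS.kerFun_dense (𝕜 := ℂ) (X := X) (V := ℂ) (RKHS.OfKernel K)
    refine top_le_iff.mp (h.ge.trans (Submodule.topologicalClosure_mono ?_))
    rw [Submodule.span_le]
    rintro _ ⟨y, v, rfl⟩
    have : RKHS.kerFun (RKHS.OfKernel K) y v = v • RKHS.kerFun (RKHS.OfKernel K) y 1 := by
      rw [← map_smul]; simp
    rw [this]
    exact Submodule.smul_mem _ _ (Submodule.subset_span ⟨y, rfl⟩)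

/-- A real positive semidefinite kernel, invariant under a group action, is the Gram matrix of an
orbit-equivariant family of vectors of a unitary representation. -/
theorem exists_unitary_rep_of_kernel {X : Type} {Γ : Type u} [Group Γ] [MulAction Γ X]
    (k : X → X → ℝ) (hsymm : ∀ x y, k x y = k y x)
    (hpos : ∀ (s : Finset X) (c : X → ℝ), 0 ≤ ∑ x ∈ s, ∑ y ∈ s, c x * c y * k x y)
    (hinv : ∀ (g : Γ) x y, k (g • x) (g • y) = k x y) :
    ∃ (H : Type) (_ : NormedAddCommGroup H) (_ : InnerProductSpace ℂ H) (_ : CompleteSpace H)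
      (π : Γ →* (H ≃ₗᵢ[ℂ] H)) (δ : X → H),
      (∀ x y, inner ℂ (δ x) (δ y) = (k x y : ℂ)) ∧ ∀ g x, π g (δ x) = δ (g • x) := by
  obtain ⟨H, _, _, _, δ, hδ, hdense⟩ := exists_gram_of_kernel k hsymm hpos
  let e : (X →₀ ℂ) →ₗ[ℂ] H := Finsupp.linearCombination ℂ δ
  have he : DenseRange e := by
    intro x
    have : x ∈ (Submodule.span ℂ (Set.range δ)).topologicalClosure := hdense ▸ Submodule.mem_top
    rwa [← Finsupp.range_linearCombination, ← SetLike.mem_coe, Submodule.topologicalClosure_coe,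
      LinearMap.coe_range] at this
  have hin : ∀ a b : X →₀ ℂ, inner ℂ (e a) (e b) =
      a.sum fun x z => b.sum fun y w => conj z * (w * (k x y : ℂ)) := by
    intro a b
    simp only [e, Finsupp.linearCombination_apply, Finsupp.sum, sum_inner, inner_sum,
      inner_smul_left, inner_smul_right, hδ, Finset.mul_sum]
    rw [Finset.sum_comm]
    exact Finset.sum_congr rfl fun x _ => Finset.sum_congr rfl fun y _ => by ring
  -- The group permutes coefficients; invariance of `k` makes this isometric for the seminorm `‖e
  -- ·‖`, so it extends from the dense range of `e` to `H`.
  let f : Γ → ((X →₀ ℂ) ≃ₗ[ℂ] (X →₀ ℂ)) := fun g => Finsupp.domLCongr (MulAction.toPerm g)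
  have hf : ∀ g a, ‖e (f g a)‖ = ‖e a‖ := by
    intro g a
    have : inner ℂ (e (f g a)) (e (f g a)) = inner ℂ (e a) (e a) := by
      rw [hin, hin]
      simp only [f, Finsupp.domLCongr_apply, Finsupp.domCongr_apply,
        Finsupp.sum_equivMapDomain, MulAction.toPerm_apply, hinv]
    rw [@norm_eq_sqrt_re_inner ℂ, this, ← @norm_eq_sqrt_re_inner ℂ]
  let π₀ : Γ → (H ≃ₗᵢ[ℂ] H) := fun g => (f g).extendOfIsometry e e he he (hf g)
  have hπ : ∀ g a, π₀ g (e a) = e (f g a) := fun g a => by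
    simp only [π₀]
    exact LinearEquiv.extendOfIsometry_eq ..
  have hff : ∀ g h a, f (g * h) a = f g (f h a) := by
    intro g h a
    ext x
    simp [f, Finsupp.domLCongr_apply, Finsupp.equivMapDomain_apply, mul_smul,
      MulAction.toPerm_symm_apply]
  have hf1 : ∀ a, f 1 a = a := by
    intro a
    ext x
    simp [f, Finsupp.domLCongr_apply, Finsupp.equivMapDomain_apply, MulAction.toPerm_symm_apply]
  have hext : ∀ A B : H ≃ₗᵢ[ℂ] H, (∀ a, A (e a) = B (e a)) → A = B := by
    intro A B hAB
    refine LinearIsometryEquiv.ext fun x => ?_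
    exact congrFun (he.equalizer A.continuous B.continuous (funext hAB)) x
  refine ⟨H, inferInstance, inferInstance, inferInstance,
    { toFun := π₀
      map_one' := hext _ _ fun a => by rw [hπ, hf1]; rfl
      map_mul' := fun g h => hext _ _ fun a => by
        rw [hπ, hff, ← hπ, ← hπ]; rfl }, δ, hδ, fun g x => ?_⟩
  have h1 : δ x = e (Finsupp.single x 1) := by simp [e]
  have h2 : δ (g • x) = e (f g (Finsupp.single x 1)) := by
    simp [e, f, Finsupp.domLCongr_apply]
  rw [h1, h2]
  exact hπ g _

end Kernel

/-! ### The spectral gap given by Property (T) -/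

section SpectralGap

open scoped InnerProductSpace

variable {Γ : Type u} [Group Γ]

/-- The displacement of a vector by a group element is controlled by the displacements by a
generating set, uniformly in the representation. -/
theorem exists_displacement_le (A : Finset Γ) (hA : Subgroup.closure (A : Set Γ) = ⊤) (g : Γ) :
    ∃ C : ℝ, 0 ≤ C ∧ ∀ (H : Type) [NormedAddCommGroup H] [InnerProductSpace ℂ H]
      (π : Γ →* (H ≃ₗᵢ[ℂ] H)) (h : H), ‖π g h - h‖ ≤ C * ∑ a ∈ A, ‖π a h - h‖ := by
  have hg : g ∈ Subgroup.closure (A : Set Γ) := hA ▸ Subgroup.mem_top g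
  induction hg using Subgroup.closure_induction with
  | mem x hx =>
    refine ⟨1, zero_le_one, fun H _ _ π h => ?_⟩
    rw [one_mul]
    exact Finset.single_le_sum (f := fun a => ‖π a h - h‖) (fun _ _ => norm_nonneg _) hx
  | one => exact ⟨0, le_rfl, fun H _ _ π h => by simp⟩
  | mul x y _ _ hx hy =>
    obtain ⟨C, hC, hx⟩ := hx
    obtain ⟨C', hC', hy⟩ := hy
    refine ⟨C + C', by positivity, fun H _ _ π h => ?_⟩
    have h1 : π (x * y) h - h = π x (π y h - h) + (π x h - h) := by
      rw [map_mul, map_sub]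
      change π x (π y h) - h = _
      abel
    calc ‖π (x * y) h - h‖ ≤ ‖π y h - h‖ + ‖π x h - h‖ := by
          rw [h1]; refine (norm_add_le _ _).trans_eq ?_; rw [LinearIsometryEquiv.norm_map]
      _ ≤ _ := by linarith [hx H π h, hy H π h]
  | inv x _ hx =>
    obtain ⟨C, hC, hx⟩ := hx
    refine ⟨C, hC, fun H _ _ π h => ?_⟩
    have h1 : π x (π x⁻¹ h) = h := by
      rw [map_inv]; exact LinearIsometryEquiv.apply_symm_apply (π x) h
    have h2 : ‖π x⁻¹ h - h‖ = ‖π x h - h‖ := by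
      rw [← LinearIsometryEquiv.norm_map (π x), map_sub, h1, norm_sub_rev]
    rw [h2]; exact hx H π h

/-- The invariant vectors of a unitary representation. -/
def invariantSubmodule {H : Type v} [NormedAddCommGroup H] [InnerProductSpace ℂ H]
    (π : Γ →* (H ≃ₗᵢ[ℂ] H)) : Submodule ℂ H where
  carrier := {h | ∀ g, π g h = h}
  add_mem' := fun ha hb g => by rw [map_add, ha g, hb g]
  zero_mem' := fun g => map_zero _
  smul_mem' := fun c h hh g => by rw [map_smul, hh g]

theorem map_mem_orthogonal_invariantSubmodule {H : Type v} [NormedAddCommGroup H]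
    [InnerProductSpace ℂ H] (π : Γ →* (H ≃ₗᵢ[ℂ] H)) (g : Γ) {h : H}
    (hh : h ∈ (invariantSubmodule π)ᗮ) : π g h ∈ (invariantSubmodule π)ᗮ := by
  rw [Submodule.mem_orthogonal] at hh ⊢
  intro w hw
  rw [← hw g, LinearIsometryEquiv.inner_map_map]
  exact hh w hw

/-- The restriction of a unitary representation to the orthogonal complement of its invariant
vectors. -/
noncomputable def restrictOrthogonal {H : Type v} [NormedAddCommGroup H] [InnerProductSpace ℂ H]
    (π : Γ →* (H ≃ₗᵢ[ℂ] H)) : Γ →* ((invariantSubmodule π)ᗮ ≃ₗᵢ[ℂ] (invariantSubmodule π)ᗮ) where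
  toFun g :=
    { toFun := fun h => ⟨π g h, map_mem_orthogonal_invariantSubmodule π g h.2⟩
      invFun := fun h => ⟨π g⁻¹ h, map_mem_orthogonal_invariantSubmodule π g⁻¹ h.2⟩
      map_add' := fun a b => by ext; simp
      map_smul' := fun c a => by ext; simp
      left_inv := fun h => by
        ext; simp only [map_inv]; exact LinearIsometryEquiv.symm_apply_apply (π g) h
      right_inv := fun h => by
        ext; simp only [map_inv]; exact LinearIsometryEquiv.apply_symm_apply (π g) h
      norm_map' := fun h => LinearIsometryEquiv.norm_map (π g) h }
  map_one' := by ext h; simp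
  map_mul' g g' := by ext h; simp

theorem coe_restrictOrthogonal {H : Type v} [NormedAddCommGroup H] [InnerProductSpace ℂ H]
    (π : Γ →* (H ≃ₗᵢ[ℂ] H)) (g : Γ) (h : (invariantSubmodule π)ᗮ) :
    (restrictOrthogonal π g h : H) = π g h := rfl

/-- Property (T) bounds displacements from below on the complement of the invariant vectors. -/
theorem HasKazhdanPropertyT.exists_le_sum_displacement [Infinite Γ] (hT : HasKazhdanPropertyT Γ)
    (A : Finset Γ) (hA : Subgroup.closure (A : Set Γ) = ⊤) :
    ∃ ε : ℝ, 0 < ε ∧ ∀ (H : Type) [NormedAddCommGroup H] [InnerProductSpace ℂ H]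
      [CompleteSpace H] (π : Γ →* (H ≃ₗᵢ[ℂ] H)), ∀ h ∈ (invariantSubmodule π)ᗮ,
      ε * ‖h‖ ≤ ∑ a ∈ A, ‖π a h - h‖ := by
  obtain ⟨T, hTgen, ε, hε, hgap⟩ := hT
  have hTne : T.Nonempty := by
    rw [Finset.nonempty_iff_ne_empty]
    rintro rfl
    rw [Finset.coe_empty, Subgroup.closure_empty] at hTgen
    have : Subsingleton Γ := (Subgroup.subsingleton_iff).mp (subsingleton_of_bot_eq_top hTgen)
    exact not_finite Γ
  choose C hC hdisp using exists_displacement_le A hA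
  set B : ℝ := ∑ t ∈ T, C t with hB
  have hB0 : 0 ≤ B := Finset.sum_nonneg fun t _ => hC t
  refine ⟨ε / (B + 1), by positivity, fun H _ _ _ π h hh => ?_⟩
  have hA0 : 0 ≤ ∑ a ∈ A, ‖π a h - h‖ := Finset.sum_nonneg fun _ _ => norm_nonneg _
  have key : ε * ‖h‖ ≤ (B + 1) * ∑ a ∈ A, ‖π a h - h‖ := by
    by_cases h0 : h = 0
    · rw [h0, norm_zero, mul_zero]; rw [h0] at hA0; exact mul_nonneg (by positivity) hA0
    -- An invariant vector of the restriction is invariant and orthogonal to all invariant vectors,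
    -- hence zero. So the contraction alternative of Property (T) holds on the complement, and there
    -- `ε ‖h‖` is at most the distance from `h` to its average.
    have hnoinv : ¬ ∃ x : (invariantSubmodule π)ᗮ, x ≠ 0 ∧ ∀ g, restrictOrthogonal π g x = x := by
      rintro ⟨x, hx0, hx⟩
      have hx1 : (x : H) ∈ invariantSubmodule π := fun g => by
        rw [← coe_restrictOrthogonal, hx g]
      have := (Submodule.mem_orthogonal _ _).mp x.2 x hx1
      exact hx0 (Subtype.ext (inner_self_eq_zero.mp this))
    have hav := (hgap _ (restrictOrthogonal π)).resolve_left hnoinv ⟨h, hh⟩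
      (fun h' => h0 (congrArg Subtype.val h'))
    have hcoe : ((repAverage (restrictOrthogonal π) T ⟨h, hh⟩ : (invariantSubmodule π)ᗮ) : H) =
        (T.card : ℂ)⁻¹ • ∑ t ∈ T, π t h := by
      simp [repAverage, coe_restrictOrthogonal]
    have hnorm : ‖(T.card : ℂ)⁻¹ • ∑ t ∈ T, π t h‖ ≤ (1 - ε) * ‖h‖ := by
      rw [← hcoe]; exact hav
    have hcard : (T.card : ℂ) ≠ 0 := by exact_mod_cast hTne.card_pos.ne'
    have hdiff : (T.card : ℂ)⁻¹ • ∑ t ∈ T, π t h - h = (T.card : ℂ)⁻¹ • ∑ t ∈ T, (π t h - h) := by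
      rw [Finset.sum_sub_distrib, smul_sub, Finset.sum_const, ← Nat.cast_smul_eq_nsmul ℂ, smul_smul,
        inv_mul_cancel₀ hcard, one_smul]
    have h2 : ‖(T.card : ℂ)⁻¹ • ∑ t ∈ T, (π t h - h)‖ ≤ ∑ t ∈ T, ‖π t h - h‖ := by
      rw [norm_smul, norm_inv, Complex.norm_natCast]
      have h3 : ((T.card : ℝ))⁻¹ ≤ 1 :=
        inv_le_one_of_one_le₀ (by exact_mod_cast hTne.card_pos)
      calc _ ≤ 1 * ‖∑ t ∈ T, (π t h - h)‖ := by gcongr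
        _ ≤ _ := by rw [one_mul]; exact norm_sum_le _ _
    have h4 : ∑ t ∈ T, ‖π t h - h‖ ≤ B * ∑ a ∈ A, ‖π a h - h‖ := by
      rw [hB, Finset.sum_mul]
      exact Finset.sum_le_sum fun t _ => hdisp t H π h
    have h5 : ‖h‖ ≤ ‖(T.card : ℂ)⁻¹ • ∑ t ∈ T, π t h‖ +
        ‖(T.card : ℂ)⁻¹ • ∑ t ∈ T, π t h - h‖ := by
      have := norm_sub_le ((T.card : ℂ)⁻¹ • ∑ t ∈ T, π t h) ((T.card : ℂ)⁻¹ • ∑ t ∈ T, π t h - h)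
      simpa using this
    rw [hdiff] at h5
    linarith
  rw [div_mul_eq_mul_div, div_le_iff₀ (by positivity)]
  linarith

/-- The Laplacian of a symmetric generating set of a group with Property (T) has a spectral gap. -/
theorem HasKazhdanPropertyT.exists_laplacian_gap [Infinite Γ] (hT : HasKazhdanPropertyT Γ)
    (A : Finset Γ) (hA : Subgroup.closure (A : Set Γ) = ⊤) (hinv : ∀ a ∈ A, a⁻¹ ∈ A) :
    ∃ ε : ℝ, 0 < ε ∧ ∀ (H : Type) [NormedAddCommGroup H] [InnerProductSpace ℂ H]
      [CompleteSpace H] (π : Γ →* (H ≃ₗᵢ[ℂ] H)) (h : H),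
      ε * ∑ a ∈ A, ‖π a h - h‖ ^ 2 ≤ ‖∑ a ∈ A, (h - π a h)‖ ^ 2 := by
  obtain ⟨ε, hε, hgap⟩ := hT.exists_le_sum_displacement A hA
  refine ⟨ε ^ 2 / (4 * (A.card + 1)), by positivity, fun H _ _ _ π h => ?_⟩
  have hclosed : IsClosed (invariantSubmodule π : Set H) := by
    have : (invariantSubmodule π : Set H) = ⋂ g, {h | π g h = h} := by
      ext x; simp [invariantSubmodule]
    rw [this]
    exact isClosed_iInter fun g => isClosed_eq (π g).continuous continuous_id
  have : CompleteSpace (invariantSubmodule π) := hclosed.completeSpace_coe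
  obtain ⟨y, hy, z, hz, rfl⟩ := (invariantSubmodule π).exists_add_mem_mem_orthogonal h
  have hdy : ∀ a, π a (y + z) - (y + z) = π a z - z := fun a => by
    rw [map_add, hy a]; abel
  have hdy' : ∀ a, (y + z) - π a (y + z) = z - π a z := fun a => by
    rw [map_add, hy a]; abel
  simp only [hdy, hdy']
  set N : ℝ := ∑ a ∈ A, ‖π a z - z‖ ^ 2 with hN
  set L : H := ∑ a ∈ A, (z - π a z) with hL
  have hN0 : 0 ≤ N := Finset.sum_nonneg fun _ _ => sq_nonneg _
  have hsum : (∑ a ∈ A, ‖π a z - z‖) ^ 2 ≤ A.card * N := by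
    have := sq_sum_le_card_mul_sum_sq (s := A) (f := fun a => ‖π a z - z‖)
    simpa using this
  have hz2 : ε ^ 2 * ‖z‖ ^ 2 ≤ A.card * N := by
    have h1 := hgap H π z hz
    have h2 : (ε * ‖z‖) ^ 2 ≤ (∑ a ∈ A, ‖π a z - z‖) ^ 2 :=
      pow_le_pow_left₀ (by positivity) h1 2
    rw [mul_pow] at h2; linarith
  -- Each displacement splits into a term for `a` and a term for `a⁻¹`; as the generating set is
  -- symmetric, the two sums agree.
  have hNL : N = 2 * RCLike.re (inner ℂ z L) := by
    have h1 : ∀ a, ‖π a z - z‖ ^ 2 =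
        RCLike.re (inner ℂ z (z - π a z)) + RCLike.re (inner ℂ z (z - π a⁻¹ z)) := by
      intro a
      have e1 : inner ℂ z (π a⁻¹ z) = inner ℂ (π a z) z := by
        rw [← LinearIsometryEquiv.inner_map_map (π a)]
        congr 1
        rw [map_inv]; exact LinearIsometryEquiv.apply_symm_apply (π a) z
      rw [@norm_sub_sq ℂ, inner_sub_right, inner_sub_right, map_sub, map_sub, e1,
        LinearIsometryEquiv.norm_map, inner_self_eq_norm_sq, ← inner_conj_symm z (π a z)]
      simp only [RCLike.conj_re]
      ring
    have h2 : ∑ a ∈ A, RCLike.re (inner ℂ z (z - π a⁻¹ z)) =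
        ∑ a ∈ A, RCLike.re (inner ℂ z (z - π a z)) :=
      Finset.sum_nbij' (fun a => a⁻¹) (fun a => a⁻¹) hinv hinv (by simp) (by simp) (by simp)
    rw [hN, Finset.sum_congr rfl fun a _ => h1 a, Finset.sum_add_distrib, h2, hL, inner_sum, map_sum]
    ring
  have hCS : N ≤ 2 * (‖z‖ * ‖L‖) := by
    rw [hNL]
    have := re_inner_le_norm (𝕜 := ℂ) z L
    linarith
  have hN2 : N ^ 2 ≤ 4 * (‖z‖ ^ 2 * ‖L‖ ^ 2) := by
    calc N ^ 2 ≤ (2 * (‖z‖ * ‖L‖)) ^ 2 := pow_le_pow_left₀ hN0 hCS 2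
      _ = _ := by ring
  -- From `N² ≤ 4‖z‖²‖L‖²` and `ε²‖z‖² ≤ |A| N`, one factor `N` cancels.
  have hfin : ε ^ 2 * N ≤ 4 * A.card * ‖L‖ ^ 2 := by
    rcases hN0.eq_or_lt with h0 | h0
    · rw [← h0, mul_zero]; positivity
    · refine le_of_mul_le_mul_right ?_ h0
      calc ε ^ 2 * N * N = ε ^ 2 * N ^ 2 := by ring
        _ ≤ ε ^ 2 * (4 * (‖z‖ ^ 2 * ‖L‖ ^ 2)) := by gcongr
        _ = 4 * ‖L‖ ^ 2 * (ε ^ 2 * ‖z‖ ^ 2) := by ring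
        _ ≤ 4 * ‖L‖ ^ 2 * (A.card * N) := by gcongr
        _ = _ := by ring
  rw [div_mul_eq_mul_div, div_le_iff₀ (by positivity)]
  nlinarith [sq_nonneg ‖L‖]

end SpectralGap

/-! ### Balls in graphs and in Cayley graphs -/

namespace SimpleGraph

section Balls

variable {V : Type u} {G : SimpleGraph V} {x y : V} {r s : ℕ}

theorem mem_rBall_iff_exists_walk : y ∈ G.rBall x r ↔ ∃ p : G.Walk x y, p.length ≤ r := by
  constructor
  · intro h
    have h1 : G.edist x y ≠ ⊤ := fun h' => by
      
      change G.edist x y ≤ (r : ℕ∞) at h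
      rw [h'] at h; exact absurd h (by simp)
    obtain ⟨p, hp⟩ := G.exists_walk_of_edist_ne_top h1
    refine ⟨p, ?_⟩
    change G.edist x y ≤ (r : ℕ∞) at h
    rw [← hp] at h
    exact_mod_cast h
  · rintro ⟨p, hp⟩
    exact (G.edist_le p).trans (by exact_mod_cast hp)

theorem rBall_mono (h : r ≤ s) : G.rBall x r ⊆ G.rBall x s := fun y hy => by
  change G.edist x y ≤ (r : ℕ∞) at hy
  exact hy.trans (by exact_mod_cast h)

theorem rBall_zero : G.rBall x 0 = {x} := by
  ext y
  change G.edist x y ≤ ((0 : ℕ) : ℕ∞) ↔ y = x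
  rw [Nat.cast_zero, nonpos_iff_eq_zero, edist_eq_zero_iff, eq_comm]

theorem mem_rBall_succ :
    y ∈ G.rBall x (r + 1) ↔ y ∈ G.rBall x r ∨ ∃ z ∈ G.rBall x r, G.Adj z y := by
  constructor
  · intro h
    obtain ⟨p, hp⟩ := mem_rBall_iff_exists_walk.mp h
    rcases hp.lt_or_eq with h1 | h1
    · exact Or.inl (mem_rBall_iff_exists_walk.mpr ⟨p, by omega⟩)
    · right
      have hnil : ¬ p.Nil := by
        intro h2; rw [← Walk.length_eq_zero_iff] at h2; omega
      refine ⟨p.penultimate, mem_rBall_iff_exists_walk.mpr ⟨p.dropLast, ?_⟩,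
        p.adj_penultimate hnil⟩
      simp [h1]
  · rintro (h | ⟨z, hz, hzy⟩)
    · exact rBall_mono (Nat.le_succ r) h
    · obtain ⟨p, hp⟩ := mem_rBall_iff_exists_walk.mp hz
      exact mem_rBall_iff_exists_walk.mpr ⟨p.concat hzy, by simpa using hp⟩

theorem Adj.mem_rBall_succ {z : V} (h : G.Adj y z) (hy : y ∈ G.rBall x r) : z ∈ G.rBall x (r + 1) :=
  SimpleGraph.mem_rBall_succ.mpr (Or.inr ⟨y, hy, h⟩)

end Balls

section CayleyBalls

variable {Γ : Type v} [Group Γ] {X : SimpleGraph Γ} {A : Finset Γ} {r s : ℕ}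

theorem inv_mem_of_adj_iff (hX : ∀ u v, X.Adj u v ↔ u⁻¹ * v ∈ A) {a : Γ} (ha : a ∈ A) :
    a⁻¹ ∈ A := by
  have h := (hX 1 a).mpr (by simpa using ha)
  simpa using (hX a 1).mp h.symm

theorem adj_mul_left_iff (hX : ∀ u v, X.Adj u v ↔ u⁻¹ * v ∈ A) (g u v : Γ) :
    X.Adj (g * u) (g * v) ↔ X.Adj u v := by
  rw [hX, hX]; simp [mul_assoc]

theorem mul_mem_rBall (hX : ∀ u v, X.Adj u v ↔ u⁻¹ * v ∈ A) {u z : Γ} (hu : u ∈ X.rBall 1 r)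
    (hz : z ∈ X.rBall 1 s) : u * z ∈ X.rBall 1 (r + s) := by
  induction s generalizing z with
  | zero =>
    rw [rBall_zero, Set.mem_singleton_iff] at hz
    rw [hz, mul_one]; exact hu
  | succ s ih =>
    rcases mem_rBall_succ.mp hz with h | ⟨w, hw, hwz⟩
    · exact rBall_mono (by omega) (ih h)
    · exact ((adj_mul_left_iff hX u w z).mpr hwz).mem_rBall_succ (ih hw)

theorem mem_rBall_one (hX : ∀ u v, X.Adj u v ↔ u⁻¹ * v ∈ A) {a : Γ} (ha : a ∈ A) :
    a ∈ X.rBall 1 1 :=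
  Adj.mem_rBall_succ (r := 0) ((hX 1 a).mpr (by simpa using ha)) (mem_rBall_self _ _ _)

theorem inv_mem_rBall (hX : ∀ u v, X.Adj u v ↔ u⁻¹ * v ∈ A) {u : Γ} (hu : u ∈ X.rBall 1 r) :
    u⁻¹ ∈ X.rBall 1 r := by
  induction r generalizing u with
  | zero =>
    rw [rBall_zero, Set.mem_singleton_iff] at hu ⊢
    rw [hu, inv_one]
  | succ r ih =>
    rcases mem_rBall_succ.mp hu with h | ⟨w, hw, hwu⟩
    · exact rBall_mono (by omega) (ih h)
    · have h1 : u⁻¹ = (u⁻¹ * w) * w⁻¹ := by group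
      have h2 : u⁻¹ * w ∈ A := (hX u w).mp hwu.symm
      rw [h1, add_comm]
      exact mul_mem_rBall hX (mem_rBall_one hX h2) (ih hw)

theorem rBall_one_finite (hX : ∀ u v, X.Adj u v ↔ u⁻¹ * v ∈ A) (r : ℕ) :
    (X.rBall 1 r).Finite := by
  induction r with
  | zero => rw [rBall_zero]; exact Set.finite_singleton _
  | succ r ih =>
    refine (ih.union (ih.mul A.finite_toSet)).subset fun y hy => ?_
    rcases mem_rBall_succ.mp hy with h | ⟨w, hw, hwy⟩
    · exact Or.inl h
    · exact Or.inr ⟨w, hw, w⁻¹ * y, (hX w y).mp hwy, by group⟩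

theorem exists_mem_rBall (hX : ∀ u v, X.Adj u v ↔ u⁻¹ * v ∈ A)
    (hA : Subgroup.closure (A : Set Γ) = ⊤) (g : Γ) : ∃ r, g ∈ X.rBall 1 r := by
  have hg : g ∈ Subgroup.closure (A : Set Γ) := hA ▸ Subgroup.mem_top g
  induction hg using Subgroup.closure_induction with
  | mem x hx => exact ⟨1, mem_rBall_one hX hx⟩
  | one => exact ⟨0, mem_rBall_self _ _ _⟩
  | mul x y _ _ hx hy =>
    obtain ⟨r, hx⟩ := hx
    obtain ⟨s, hy⟩ := hy
    exact ⟨r + s, mul_mem_rBall hX hx hy⟩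
  | inv x _ hx => exact hx.imp fun r hr => inv_mem_rBall hX hr

theorem exists_finset_subset_rBall (hX : ∀ u v, X.Adj u v ↔ u⁻¹ * v ∈ A)
    (hA : Subgroup.closure (A : Set Γ) = ⊤) (D : Finset Γ) : ∃ r, ∀ z ∈ D, z ∈ X.rBall 1 r := by
  choose ρ hρ using exists_mem_rBall hX hA
  exact ⟨D.sup ρ, fun z hz => rBall_mono (Finset.le_sup hz) (hρ z)⟩

/-- Balls of an infinite Cayley graph grow at least linearly. -/
theorem succ_le_ncard_rBall [Infinite Γ] (hX : ∀ u v, X.Adj u v ↔ u⁻¹ * v ∈ A)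
    (hA : Subgroup.closure (A : Set Γ) = ⊤) (r : ℕ) : r + 1 ≤ (X.rBall 1 r).ncard := by
  induction r with
  | zero => rw [rBall_zero, Set.ncard_singleton]
  | succ r ih =>
    -- If two consecutive balls coincide, all larger balls do too, and the infinite group would
    -- equal a finite ball.
    have hss : X.rBall 1 r ⊂ X.rBall 1 (r + 1) := by
      refine (rBall_mono (Nat.le_succ r)).ssubset_of_ne fun heq => ?_
      have hall : ∀ k, X.rBall 1 k ⊆ X.rBall 1 r := by
        intro k
        induction k with
        | zero => exact rBall_mono (Nat.zero_le r)
        | succ k ih =>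
          intro y hy
          rcases mem_rBall_succ.mp hy with h | ⟨w, hw, hwy⟩
          · exact ih h
          · rw [heq]; exact hwy.mem_rBall_succ (ih hw)
      have : (Set.univ : Set Γ) ⊆ X.rBall 1 r := fun g _ => by
        obtain ⟨k, hk⟩ := exists_mem_rBall hX hA g
        exact hall k hk
      exact Set.infinite_univ ((rBall_one_finite hX r).subset this)
    have := Set.ncard_lt_ncard hss (rBall_one_finite hX _)
    omega

/-- A single symmetric generator is its own inverse, so the ball of radius 2 would lie in `{1} ∪ A`
and have at most two elements, whereas linear growth gives at least three. This supplies the bound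
`2 ≤ d` needed for rewiring. -/
theorem two_le_card_of_infinite [Infinite Γ] (hX : ∀ u v, X.Adj u v ↔ u⁻¹ * v ∈ A)
    (hA : Subgroup.closure (A : Set Γ) = ⊤) : 2 ≤ A.card := by
  by_contra hlt
  have hle : A.card ≤ 1 := by omega
  have h2 := succ_le_ncard_rBall hX hA 2
  have hsub : X.rBall 1 2 ⊆ insert 1 (A : Set Γ) := by
    intro y hy
    rcases mem_rBall_succ.mp hy with h | ⟨w, hw, hwy⟩
    · rcases mem_rBall_succ.mp h with h | ⟨w, hw, hwy⟩
      · rw [rBall_zero] at h; exact Or.inl h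
      · rw [rBall_zero, Set.mem_singleton_iff] at hw
        subst hw; right; simpa using (hX 1 y).mp hwy
    · rcases mem_rBall_succ.mp hw with h | ⟨w', hw', hw'w⟩
      · rw [rBall_zero, Set.mem_singleton_iff] at h
        subst h; right; simpa using (hX 1 y).mp hwy
      · rw [rBall_zero, Set.mem_singleton_iff] at hw'
        subst hw'
        left
        have h1 : w ∈ A := by simpa using (hX 1 w).mp hw'w
        have h3 : w⁻¹ * y = w⁻¹ :=
          Finset.card_le_one.mp hle _ ((hX w y).mp hwy) _ (inv_mem_of_adj_iff hX h1)
        simpa using h3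
  have h3 := Set.ncard_le_ncard hsub (A.finite_toSet.insert 1)
  have h4 := Set.ncard_insert_le 1 (A : Set Γ)
  rw [Set.ncard_coe_finset] at h4
  omega

end CayleyBalls

/-! ### Charts and rooted automorphisms -/

section Charts

variable {Γ : Type v} [Group Γ] {V : Type u}

/-- A map from the vertices of `X` to the vertices of `G` restricting to an isomorphism of the
`R`-ball around `1` onto the `R`-ball around its image. -/
structure IsChart (X : SimpleGraph Γ) (G : SimpleGraph V) (R : ℕ) (E : Γ → V) : Prop where
  inj : Set.InjOn E (X.rBall 1 R)
  adj : ∀ z ∈ X.rBall 1 R, ∀ w ∈ X.rBall 1 R, G.Adj (E z) (E w) ↔ X.Adj z w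
  surj : ∀ k, k + 1 ≤ R → ∀ z ∈ X.rBall 1 k, ∀ y, G.Adj (E z) y → ∃ w, X.Adj z w ∧ E w = y

variable {X : SimpleGraph Γ} {G : SimpleGraph V} {A : Finset Γ} {R r : ℕ} {E E' : Γ → V}

/-- The chart is the inverse of the ball isomorphism, with the irrelevant value `x` outside the
ball. It does not increase the distance to the root, so every neighbor of the image of a point in a
`k`-ball, `k < R`, still lies in the `R`-ball and is seen by the isomorphism. -/
theorem RootedBallIso.exists_isChart {x : V} (h : RootedBallIso G x X 1 R) :
    ∃ E : Γ → V, E 1 = x ∧ IsChart X G R E := by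
  classical
  obtain ⟨e, he⟩ := h
  let E : Γ → V := fun z => if hz : z ∈ X.rBall 1 R then e.symm ⟨z, hz⟩ else x
  have hE : ∀ z (hz : z ∈ X.rBall 1 R), E z = e.symm ⟨z, hz⟩ := fun z hz => by simp [E, hz]
  have hE1 : E 1 = x := by rw [hE 1 (mem_rBall_self _ _ _), ← he]; simp
  have hadj : ∀ z ∈ X.rBall 1 R, ∀ w ∈ X.rBall 1 R, G.Adj (E z) (E w) ↔ X.Adj z w := by
    intro z hz w hw
    rw [hE z hz, hE w hw]
    have := e.symm.map_adj_iff (v := ⟨z, hz⟩) (w := ⟨w, hw⟩)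
    simpa using this
  have hmap : ∀ k ≤ R, ∀ z ∈ X.rBall 1 k, E z ∈ G.rBall x k := by
    intro k
    induction k with
    | zero =>
      intro _ z hz
      rw [rBall_zero, Set.mem_singleton_iff] at hz
      rw [hz, hE1]; exact mem_rBall_self _ _ _
    | succ k ih =>
      intro hk z hz
      rcases mem_rBall_succ.mp hz with h | ⟨w, hw, hwz⟩
      · exact rBall_mono (Nat.le_succ k) (ih (by omega) z h)
      · exact ((hadj w (rBall_mono (by omega) hw) z (rBall_mono hk hz)).mpr hwz).mem_rBall_succ
          (ih (by omega) w hw)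
  refine ⟨E, hE1, ?_, hadj, ?_⟩
  · intro z hz w hw hzw
    rw [hE z hz, hE w hw] at hzw
    simpa using e.symm.injective (Subtype.ext hzw)
  · intro k hk z hz y hy
    have hyR : y ∈ G.rBall x R :=
      rBall_mono hk (hy.mem_rBall_succ (hmap k (by omega) z hz))
    have hEw : E (e ⟨y, hyR⟩) = y := by rw [hE _ (e ⟨y, hyR⟩).2]; simp
    refine ⟨e ⟨y, hyR⟩, ?_, hEw⟩
    rw [← hadj z (rBall_mono (by omega) hz) _ (e ⟨y, hyR⟩).2, hEw]
    exact hy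

theorem IsChart.mono (h : IsChart X G R E) (hr : r ≤ R) : IsChart X G r E :=
  ⟨h.inj.mono (rBall_mono hr),
    fun z hz w hw => h.adj z (rBall_mono hr hz) w (rBall_mono hr hw),
    fun k hk z hz y hy => h.surj k (by omega) z hz y hy⟩

/-- Left translation by `u` is an automorphism of `X` and carries the ball of radius `k` about `1`
into the ball of radius `r + k`; a chart can therefore be read from any nearby point at the cost of
`r` in the radius. -/
theorem IsChart.recenter (hX : ∀ u v, X.Adj u v ↔ u⁻¹ * v ∈ A) (h : IsChart X G (r + R) E) {u : Γ}
    (hu : u ∈ X.rBall 1 r) : IsChart X G R fun z => E (u * z) := by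
  have hb : ∀ k, ∀ z ∈ X.rBall 1 k, u * z ∈ X.rBall 1 (r + k) := fun k z hz =>
    mul_mem_rBall hX hu hz
  refine ⟨fun z hz w hw hzw => mul_left_cancel (h.inj (hb R z hz) (hb R w hw) hzw),
    fun z hz w hw => (h.adj _ (hb R z hz) _ (hb R w hw)).trans (adj_mul_left_iff hX u z w),
    fun k hk z hz y hy => ?_⟩
  obtain ⟨w, hw, hwy⟩ := h.surj (r + k) (by omega) _ (hb k z hz) y hy
  refine ⟨u⁻¹ * w, ?_, by simpa using hwy⟩
  rw [← adj_mul_left_iff hX u]; simpa using hw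

/-- A path from `1` is pushed to `G` by one chart and lifted edge by edge through the other. -/
theorem IsChart.exists_mem_rBall_eq (h : IsChart X G R E) (h' : IsChart X G R E')
    (hbase : E 1 = E' 1) {k : ℕ} (hk : k ≤ R) {z : Γ} (hz : z ∈ X.rBall 1 k) :
    ∃ z' ∈ X.rBall 1 k, E' z' = E z := by
  induction k generalizing z with
  | zero =>
    rw [rBall_zero, Set.mem_singleton_iff] at hz
    exact ⟨1, mem_rBall_self _ _ _, by rw [hz, hbase]⟩
  | succ k ih =>
    rcases mem_rBall_succ.mp hz with h1 | ⟨w, hw, hwz⟩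
    · obtain ⟨z', hz', he⟩ := ih (by omega) h1
      exact ⟨z', rBall_mono (Nat.le_succ k) hz', he⟩
    · obtain ⟨w', hw', he⟩ := ih (by omega) hw
      have hadj : G.Adj (E' w') (E z) := by
        rw [he, h.adj w (rBall_mono (by omega) hw) z (rBall_mono hk hz)]; exact hwz
      obtain ⟨z', hz', he'⟩ := h'.surj k hk w' hw' _ hadj
      exact ⟨z', hz'.mem_rBall_succ hw', he'⟩

/-- Two charts with the same base point differ by a chart of the model graph. -/
theorem IsChart.exists_transition (h : IsChart X G R E) (h' : IsChart X G R E')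
    (hbase : E 1 = E' 1) :
    ∃ b : Γ → Γ, b 1 = 1 ∧ IsChart X X R b ∧ (∀ k ≤ R, ∀ z ∈ X.rBall 1 k, b z ∈ X.rBall 1 k) ∧
      ∀ z ∈ X.rBall 1 R, E' (b z) = E z := by
  classical
  have hex : ∀ z, ∃ z', z ∈ X.rBall 1 R → (z' ∈ X.rBall 1 R ∧ E' z' = E z) := fun z => by
    by_cases hz : z ∈ X.rBall 1 R
    · obtain ⟨z', hz'⟩ := h.exists_mem_rBall_eq h' hbase le_rfl hz
      exact ⟨z', fun _ => hz'⟩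
    · exact ⟨1, fun hz' => absurd hz' hz⟩
  choose b hb using hex
  have hbk : ∀ k ≤ R, ∀ z ∈ X.rBall 1 k, b z ∈ X.rBall 1 k := by
    intro k hk z hz
    obtain ⟨z', hz', he⟩ := h.exists_mem_rBall_eq h' hbase hk hz
    have h2 := hb z (rBall_mono hk hz)
    rwa [h'.inj h2.1 (rBall_mono hk hz') (h2.2.trans he.symm)]
  have hadj : ∀ z ∈ X.rBall 1 R, ∀ w ∈ X.rBall 1 R, X.Adj (b z) (b w) ↔ X.Adj z w := by
    intro z hz w hw
    rw [← h'.adj _ (hb z hz).1 _ (hb w hw).1, (hb z hz).2, (hb w hw).2, h.adj z hz w hw]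
  refine ⟨b, ?_, ⟨?_, hadj, ?_⟩, hbk, fun z hz => (hb z hz).2⟩
  · have := hbk 0 (Nat.zero_le R) 1 (mem_rBall_self _ _ _)
    rwa [rBall_zero] at this
  · intro z hz w hw hzw
    exact h.inj hz hw (by rw [← (hb z hz).2, ← (hb w hw).2, hzw])
  · intro k hk z hz y hy
    have hbz := hbk k (by omega) z hz
    have hzR := rBall_mono (by omega : k ≤ R) hz
    have hyR : y ∈ X.rBall 1 R := rBall_mono hk (hy.mem_rBall_succ hbz)
    have hG : G.Adj (E z) (E' y) := by
      rw [← (hb z hzR).2, h'.adj _ (hb z hzR).1 _ hyR]; exact hy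
    obtain ⟨w, hw, hwy⟩ := h.surj k hk z hz _ hG
    have hwR : w ∈ X.rBall 1 R := rBall_mono hk (hw.mem_rBall_succ hz)
    exact ⟨w, hw, h'.inj (hb w hwR).1 hyR ((hb w hwR).2.trans hwy)⟩

/-- The automorphisms of a graph on a group that fix `1`. -/
def rootedAut (X : SimpleGraph Γ) : Subgroup (Equiv.Perm Γ) where
  carrier := {κ | κ 1 = 1 ∧ ∀ z w, X.Adj (κ z) (κ w) ↔ X.Adj z w}
  mul_mem' := by
    rintro a b ⟨ha, ha'⟩ ⟨hb, hb'⟩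
    exact ⟨by simp [ha, hb], fun z w => by simp [ha', hb']⟩
  one_mem' := ⟨rfl, fun _ _ => Iff.rfl⟩
  inv_mem' := by
    rintro a ⟨ha, ha'⟩
    exact ⟨by rw [Equiv.Perm.inv_eq_iff_eq, ha], fun z w => by rw [← ha']; simp⟩

theorem map_mem_rBall_of_mem_rootedAut {κ : Equiv.Perm Γ} (hκ : κ ∈ rootedAut X) {z : Γ}
    (hz : z ∈ X.rBall 1 r) : κ z ∈ X.rBall 1 r := by
  induction r generalizing z with
  | zero =>
    rw [rBall_zero, Set.mem_singleton_iff] at hz ⊢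
    rw [hz, hκ.1]
  | succ r ih =>
    rcases mem_rBall_succ.mp hz with h | ⟨w, hw, hwz⟩
    · exact rBall_mono (by omega) (ih h)
    · exact ((hκ.2 w z).mpr hwz).mem_rBall_succ (ih hw)

/-- Rooted isomorphisms of large balls restrict on small balls to rooted automorphisms. -/
theorem exists_radius_rootedAut (hX : ∀ u v, X.Adj u v ↔ u⁻¹ * v ∈ A)
    (hA : Subgroup.closure (A : Set Γ) = ⊤) (r : ℕ) :
    ∃ R, r ≤ R ∧ ∀ b : Γ → Γ, b 1 = 1 → IsChart X X R b →
      (∀ k ≤ R, ∀ z ∈ X.rBall 1 k, b z ∈ X.rBall 1 k) →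
      ∃ κ ∈ rootedAut X, ∀ z ∈ X.rBall 1 r, κ z = b z := by
  -- Compactness: if every radius has a transition map that no rooted automorphism matches on the
  -- `r`-ball, a pointwise ultralimit of these maps is a rooted automorphism that agrees with some
  -- of them on this finite ball.
  by_contra! hcon
  have hcon' : ∀ R, ∃ b : Γ → Γ, r ≤ R → b 1 = 1 ∧ IsChart X X R b ∧
      (∀ k ≤ R, ∀ z ∈ X.rBall 1 k, b z ∈ X.rBall 1 k) ∧
      ∀ κ ∈ rootedAut X, ∃ z ∈ X.rBall 1 r, κ z ≠ b z := fun R => by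
    by_cases hR : r ≤ R
    · obtain ⟨b, h⟩ := hcon R hR
      exact ⟨b, fun _ => h⟩
    · exact ⟨id, fun h => absurd h hR⟩
  choose b hb using hcon'
  let 𝒰 : Ultrafilter ℕ := hyperfilter ℕ
  have hlarge : ∀ m, ∀ᶠ R in (𝒰 : Filter ℕ), m ≤ R := fun m =>
    Nat.hyperfilter_le_atTop (eventually_ge_atTop m)
  have hconst : ∀ (F : ℕ → Γ) (s : Set Γ), s.Finite → (∀ᶠ R in (𝒰 : Filter ℕ), F R ∈ s) →
      ∃ g, ∀ᶠ R in (𝒰 : Filter ℕ), F R = g := by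
    intro F s hs hF
    have h1 : (⋃ g ∈ s, {R | F R = g}) ∈ 𝒰 := by
      filter_upwards [hF] with R hR
      simpa using hR
    obtain ⟨g, _, hg⟩ := (Ultrafilter.finite_biUnion_mem_iff hs).mp h1
    exact ⟨g, hg⟩
  choose ρ hρ using exists_mem_rBall hX hA
  have hlim : ∀ z, ∃ g, ∀ᶠ R in (𝒰 : Filter ℕ), b R z = g := fun z => by
    refine hconst _ _ (rBall_one_finite hX (ρ z)) ?_
    filter_upwards [hlarge r, hlarge (ρ z)] with R h1 h2
    exact (hb R h1).2.2.1 (ρ z) h2 z (hρ z)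
  choose c hc using hlim
  have hc1 : c 1 = 1 := by
    obtain ⟨R, h1, h2⟩ := ((hc 1).and (hlarge r)).exists
    rw [← h1, (hb R h2).1]
  have hcinj : Function.Injective c := by
    intro z w hzw
    obtain ⟨R, h1, h2, h3, h4, h5⟩ := ((hc z).and ((hc w).and ((hlarge r).and
      ((hlarge (ρ z)).and (hlarge (ρ w)))))).exists
    exact (hb R h3).2.1.inj (rBall_mono h4 (hρ z)) (rBall_mono h5 (hρ w)) (by rw [h1, h2, hzw])
  have hcadj : ∀ z w, X.Adj (c z) (c w) ↔ X.Adj z w := by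
    intro z w
    obtain ⟨R, h1, h2, h3, h4, h5⟩ := ((hc z).and ((hc w).and ((hlarge r).and
      ((hlarge (ρ z)).and (hlarge (ρ w)))))).exists
    rw [← h1, ← h2]
    exact (hb R h3).2.1.adj z (rBall_mono h4 (hρ z)) w (rBall_mono h5 (hρ w))
  -- The preimage of `y` under `b R` depends on `R`, but it is adjacent to `z`, so it ranges over a
  -- finite ball and is constant along the ultrafilter. This yields surjectivity of the limit.
  have hcnbr : ∀ z y, X.Adj (c z) y → ∃ w, c w = y := by
    intro z y hy
    have hex : ∀ R, ∃ w, r ≤ R → ρ z + 1 ≤ R → b R z = c z → X.Adj z w ∧ b R w = y := fun R => by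
      by_cases h : r ≤ R ∧ ρ z + 1 ≤ R ∧ b R z = c z
      · obtain ⟨w, hw⟩ := (hb R h.1).2.1.surj (ρ z) h.2.1 z (hρ z) y (by rw [h.2.2]; exact hy)
        exact ⟨w, fun _ _ _ => hw⟩
      · exact ⟨1, fun h1 h2 h3 => absurd ⟨h1, h2, h3⟩ h⟩
    choose w hw using hex
    obtain ⟨g, hg⟩ := hconst w _ (rBall_one_finite hX (ρ z + 1)) (by
      filter_upwards [hlarge r, hlarge (ρ z + 1), hc z] with R h1 h2 h3
      exact (hw R h1 h2 h3).1.mem_rBall_succ (hρ z))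
    refine ⟨g, ?_⟩
    obtain ⟨R, h1, h2, h3, h4, h5⟩ := ((hc g).and (hg.and ((hlarge r).and
      ((hlarge (ρ z + 1)).and (hc z))))).exists
    rw [← h1, ← h2]
    exact (hw R h3 h4 h5).2
  have hcsurj : Function.Surjective c := by
    have : ∀ k, ∀ y ∈ X.rBall 1 k, ∃ w, c w = y := by
      intro k
      induction k with
      | zero =>
        intro y hy
        rw [rBall_zero, Set.mem_singleton_iff] at hy
        exact ⟨1, by rw [hc1, hy]⟩
      | succ k ih =>
        intro y hy
        rcases mem_rBall_succ.mp hy with h | ⟨w, hw, hwy⟩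
        · exact ih y h
        · obtain ⟨z, rfl⟩ := ih w hw
          exact hcnbr z y hwy
    exact fun y => this _ y (hρ y)
  let κ : Equiv.Perm Γ := Equiv.ofBijective c ⟨hcinj, hcsurj⟩
  have hκ : κ ∈ rootedAut X := ⟨hc1, hcadj⟩
  have hagree : ∀ᶠ R in (𝒰 : Filter ℕ), ∀ z ∈ X.rBall 1 r, b R z = c z :=
    ((rBall_one_finite hX r).eventually_all).mpr fun z _ => hc z
  obtain ⟨R, h1, h2⟩ := (hagree.and (hlarge r)).exists
  obtain ⟨z, hz, hne⟩ := (hb R h2).2.2.2 κ hκ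
  exact hne (h1 z hz).symm

end Charts

end SimpleGraph

/-! ### Averages over finite orbits -/

section OrbitAverage

variable {K : Type*} [Group K] {Y Z : Type*} [MulAction K Y] [MulAction K Z]

open Classical in
/-- The orbit of a point as a finite set (empty if the orbit is infinite). -/
noncomputable def orbitFinset (K : Type*) [Group K] {Y : Type*} [MulAction K Y] (y : Y) :
    Finset Y :=
  if h : (MulAction.orbit K y).Finite then h.toFinset else ∅

theorem mem_orbitFinset {y y' : Y} (h : (MulAction.orbit K y).Finite) :
    y' ∈ orbitFinset K y ↔ y' ∈ MulAction.orbit K y := by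
  simp [orbitFinset, h]

/-- The average of a function over an orbit. -/
noncomputable def orbitAverage (K : Type*) [Group K] {Y : Type*} [MulAction K Y] (y : Y)
    (h : Y → ℝ) : ℝ :=
  (∑ y' ∈ orbitFinset K y, h y') / (orbitFinset K y).card

theorem orbitFinset_card_pos {y : Y} (h : (MulAction.orbit K y).Finite) :
    0 < (orbitFinset K y).card :=
  Finset.card_pos.mpr ⟨y, (mem_orbitFinset h).mpr (MulAction.mem_orbit_self y)⟩

theorem orbitAverage_congr {y : Y} (hfin : (MulAction.orbit K y).Finite) {h h' : Y → ℝ}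
    (hh : ∀ k : K, h (k • y) = h' (k • y)) : orbitAverage K y h = orbitAverage K y h' := by
  unfold orbitAverage
  congr 1
  refine Finset.sum_congr rfl fun y' hy' => ?_
  obtain ⟨k, rfl⟩ := (mem_orbitFinset hfin).mp hy'
  exact hh k

theorem orbitAverage_nonneg {y : Y} {h : Y → ℝ} (hh : ∀ y, 0 ≤ h y) : 0 ≤ orbitAverage K y h :=
  div_nonneg (Finset.sum_nonneg fun y _ => hh y) (Nat.cast_nonneg _)

theorem abs_orbitAverage_le {y : Y} {h : Y → ℝ} {a : ℝ} (ha : 0 ≤ a) (hh : ∀ y, |h y| ≤ a) :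
    |orbitAverage K y h| ≤ a := by
  unfold orbitAverage
  rw [abs_div, Nat.abs_cast]
  refine div_le_of_le_mul₀ (Nat.cast_nonneg _) ha ?_
  calc _ ≤ ∑ y' ∈ orbitFinset K y, |h y'| := Finset.abs_sum_le_sum_abs _ _
    _ ≤ ∑ y' ∈ orbitFinset K y, a := Finset.sum_le_sum fun y _ => hh y
    _ = _ := by rw [Finset.sum_const, nsmul_eq_mul, mul_comm]

theorem orbitAverage_sum {ι : Type*} (s : Finset ι) (y : Y) (h : ι → Y → ℝ) :
    orbitAverage K y (fun y' => ∑ i ∈ s, h i y') = ∑ i ∈ s, orbitAverage K y (h i) := by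
  unfold orbitAverage
  rw [Finset.sum_comm, Finset.sum_div]

theorem orbitAverage_const_mul (y : Y) (a : ℝ) (h : Y → ℝ) :
    orbitAverage K y (fun y' => a * h y') = a * orbitAverage K y h := by
  unfold orbitAverage
  rw [← Finset.mul_sum, mul_div_assoc]

/-- Equivariant maps preserve orbit averages. -/
theorem orbitAverage_map {y : Y} (hfin : (MulAction.orbit K y).Finite) (p : Y → Z)
    (hp : ∀ (k : K) y, p (k • y) = k • p y) (h : Z → ℝ) :
    orbitAverage K (p y) h = orbitAverage K y (fun y' => h (p y')) := by
  classical
  have himg : MulAction.orbit K (p y) = p '' MulAction.orbit K y := by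
    ext z
    constructor
    · rintro ⟨k, rfl⟩
      exact ⟨k • y, ⟨k, rfl⟩, hp k y⟩
    · rintro ⟨_, ⟨k, rfl⟩, rfl⟩
      exact ⟨k, (hp k y).symm⟩
  have hfin' : (MulAction.orbit K (p y)).Finite := himg ▸ hfin.image p
  have hmaps : ∀ y' ∈ orbitFinset K y, p y' ∈ orbitFinset K (p y) := fun y' hy' => by
    rw [mem_orbitFinset hfin', himg]
    exact ⟨y', (mem_orbitFinset hfin).mp hy', rfl⟩
  set c := {y' ∈ orbitFinset K y | p y' = p y}.card with hc
  -- The group permutes the fibers of `p` transitively over the image orbit, so all fibers have the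
  -- same size and uniform averages are preserved.
  have hfib : ∀ z ∈ orbitFinset K (p y), {y' ∈ orbitFinset K y | p y' = z}.card = c := by
    intro z hz
    obtain ⟨k, rfl⟩ := (mem_orbitFinset hfin').mp hz
    refine Finset.card_nbij' (fun y' => k⁻¹ • y') (fun y' => k • y') ?_ ?_ ?_ ?_
    · intro y' hy'
      simp only [Finset.coe_filter, Set.mem_ofPred_eq, mem_orbitFinset hfin] at hy' ⊢
      refine ⟨MulAction.mem_orbit_of_mem_orbit k⁻¹ hy'.1, ?_⟩
      rw [hp, hy'.2]; simp
    · intro y' hy'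
      simp only [Finset.coe_filter, Set.mem_ofPred_eq, mem_orbitFinset hfin] at hy' ⊢
      refine ⟨MulAction.mem_orbit_of_mem_orbit k hy'.1, ?_⟩
      rw [hp, hy'.2]
    · intro y' _; simp
    · intro y' _; simp
  have hcard : (orbitFinset K y).card = (orbitFinset K (p y)).card * c := by
    rw [Finset.card_eq_sum_card_fiberwise hmaps, Finset.sum_congr rfl hfib, Finset.sum_const,
      smul_eq_mul]
  have hsum : ∑ y' ∈ orbitFinset K y, h (p y') = c * ∑ z ∈ orbitFinset K (p y), h z := by
    rw [← Finset.sum_fiberwise_of_maps_to hmaps, Finset.mul_sum]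
    refine Finset.sum_congr rfl fun z hz => ?_
    rw [← hfib z hz, ← nsmul_eq_mul, ← Finset.sum_const]
    refine Finset.sum_congr rfl fun y' hy' => ?_
    rw [(Finset.mem_filter.mp hy').2]
  have hpos := orbitFinset_card_pos hfin
  have hc0 : (c : ℝ) ≠ 0 := by
    rintro h0
    rw [Nat.cast_eq_zero] at h0
    rw [hcard, h0] at hpos; omega
  have hpos' : ((orbitFinset K (p y)).card : ℝ) ≠ 0 := by
    exact_mod_cast (orbitFinset_card_pos hfin').ne'
  unfold orbitAverage
  rw [hsum, hcard]
  push_cast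
  field_simp

end OrbitAverage

/-! ### Mass transport for correlations along charts -/

namespace SimpleGraph

section Kernel

variable {Γ : Type v} [Group Γ] {X : SimpleGraph Γ} {A : Finset Γ}

theorem finite_orbit_rootedAut (hX : ∀ u v, X.Adj u v ↔ u⁻¹ * v ∈ A)
    (hA : Subgroup.closure (A : Set Γ) = ⊤) (z : Γ) :
    (MulAction.orbit (rootedAut X) z).Finite := by
  obtain ⟨r, hr⟩ := exists_mem_rBall hX hA z
  refine (rBall_one_finite hX r).subset ?_
  rintro _ ⟨κ, rfl⟩
  exact map_mem_rBall_of_mem_rootedAut κ.2 hr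

theorem finite_orbit_rootedAut_prod (hX : ∀ u v, X.Adj u v ↔ u⁻¹ * v ∈ A)
    (hA : Subgroup.closure (A : Set Γ) = ⊤) (p : Γ × Γ) :
    (MulAction.orbit (rootedAut X) p).Finite := by
  refine ((finite_orbit_rootedAut hX hA p.1).prod (finite_orbit_rootedAut hX hA p.2)).subset ?_
  rintro _ ⟨κ, rfl⟩
  exact ⟨⟨κ, rfl⟩, ⟨κ, rfl⟩⟩

theorem finite_orbit_rootedAut_pi (hX : ∀ u v, X.Adj u v ↔ u⁻¹ * v ∈ A)
    (hA : Subgroup.closure (A : Set Γ) = ⊤) {ι : Type*} [Finite ι] (p : ι → Γ) :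
    (MulAction.orbit (rootedAut X) p).Finite := by
  refine (Set.Finite.pi fun i => finite_orbit_rootedAut hX hA (p i)).subset ?_
  rintro _ ⟨κ, rfl⟩ i _
  exact ⟨κ, rfl⟩

/-- If `κ` carries `(z, w)` to `(u, u')`, then `q ↦ u⁻¹ κ(z q)` is again an automorphism fixing `1`.
This is the change of base point behind the mass transport: the pair `(1, w)` seen from `z` becomes
`(z⁻¹, z⁻¹ w)`, compatibly with orbits. -/
theorem inv_mem_orbit_prod (hX : ∀ u v, X.Adj u v ↔ u⁻¹ * v ∈ A) {z w u u' : Γ}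
    (h : (u, u') ∈ MulAction.orbit (rootedAut X) (z, w)) :
    (u⁻¹, u⁻¹ * u') ∈ MulAction.orbit (rootedAut X) (z⁻¹, z⁻¹ * w) := by
  obtain ⟨κ, hκ⟩ := h
  have hκ1 : (κ : Equiv.Perm Γ) z = u := congrArg Prod.fst hκ
  have hκ2 : (κ : Equiv.Perm Γ) w = u' := congrArg Prod.snd hκ
  let κ' : Equiv.Perm Γ := (Equiv.mulLeft z).trans ((κ : Equiv.Perm Γ).trans (Equiv.mulLeft u⁻¹))
  have hκ' : ∀ q, κ' q = u⁻¹ * (κ : Equiv.Perm Γ) (z * q) := fun q => rfl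
  have hmem : κ' ∈ rootedAut X := by
    refine ⟨by rw [hκ', mul_one, hκ1, inv_mul_cancel], fun q q' => ?_⟩
    rw [hκ', hκ', adj_mul_left_iff hX, κ.2.2, adj_mul_left_iff hX]
  refine ⟨⟨κ', hmem⟩, Prod.ext ?_ ?_⟩
  · change κ' z⁻¹ = u⁻¹
    rw [hκ', mul_inv_cancel, κ.2.1, mul_one]
  · change κ' (z⁻¹ * w) = u⁻¹ * u'
    rw [hκ', mul_inv_cancel_left, hκ2]

/-- Averaged over the base point, the pair correlations of a function along charts depend only on
the quotient of the pair. -/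
theorem exists_radius_pair_correlation (hX : ∀ u v, X.Adj u v ↔ u⁻¹ * v ∈ A)
    (hA : Subgroup.closure (A : Set Γ) = ⊤) (z w : Γ) :
    ∃ R : ℕ, ∀ {V : Type u} [Fintype V] (G : SimpleGraph V) (E : V → Γ → V), (∀ x, E x 1 = x) →
      (∀ k ≤ R, ∀ x, (∃ E' : Γ → V, E' 1 = x ∧ IsChart X G k E') → IsChart X G k (E x)) →
      ∀ (B : Finset V), (∀ x ∉ B, IsChart X G R (E x)) →
      ∀ {F : Type} [NormedAddCommGroup F] [InnerProductSpace ℝ F] (f : V → F), (∀ x, ‖f x‖ ≤ 1) →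
      |∑ x, orbitAverage (rootedAut X) (z, w) (fun p => inner ℝ (f (E x p.1)) (f (E x p.2))) -
        ∑ x, orbitAverage (rootedAut X) (z⁻¹ * w) (fun q => inner ℝ (f x) (f (E x q)))| ≤
      2 * (B.card : ℝ) := by
  classical
  obtain ⟨r, hr⟩ := exists_finset_subset_rBall hX hA {z, w}
  have hz : z ∈ X.rBall 1 r := hr z (by simp)
  have hw : w ∈ X.rBall 1 r := hr w (by simp)
  -- The automorphism will be evaluated at `u⁻¹` and at `u⁻¹ * u'`, with `u` in the `r`-ball and
  -- `u'` in the `2r`-ball.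
  obtain ⟨R₀, hR₀, hcpt⟩ := exists_radius_rootedAut hX hA (r + (r + r))
  have hzw : z⁻¹ * w ∈ X.rBall 1 (r + r) := mul_mem_rBall hX (inv_mem_rBall hX hz) hw
  refine ⟨r + ((r + r) + R₀), fun {V} _ G E hE1 hmax B hB {F} _ _ f hf => ?_⟩
  let P : V → Prop := fun x => IsChart X G ((r + r) + R₀) (E x)
  have hfin := fun p => finite_orbit_rootedAut_prod hX hA (A := A) p
  have hball : ∀ {a b : Γ} {s t : ℕ}, a ∈ X.rBall 1 s → b ∈ X.rBall 1 t → ∀ {u u' : Γ},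
      (u, u') ∈ MulAction.orbit (rootedAut X) (a, b) → u ∈ X.rBall 1 s ∧ u' ∈ X.rBall 1 t := by
    rintro a b s t ha hb u u' ⟨κ, hκ⟩
    have h1 : (κ : Equiv.Perm Γ) a = u := congrArg Prod.fst hκ
    have h2 : (κ : Equiv.Perm Γ) b = u' := congrArg Prod.snd hκ
    exact ⟨h1 ▸ map_mem_rBall_of_mem_rootedAut κ.2 ha, h2 ▸ map_mem_rBall_of_mem_rootedAut κ.2 hb⟩
  -- Move the base point from `x` to `E x u`. The recentered chart and the chart chosen there differ
  -- near `1` by a rooted automorphism, so the root and the second point acquire new coordinates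
  -- `(t, v)` in the orbit of `(a⁻¹, a⁻¹ * b)`, with `t` pointing back to `x`.
  have hstep : ∀ {a b : Γ}, a ∈ X.rBall 1 r → b ∈ X.rBall 1 (r + r) → ∀ {x : V} {u u' : Γ},
      P x → P (E x u) → (u, u') ∈ MulAction.orbit (rootedAut X) (a, b) →
      ∃ t v, (t, v) ∈ MulAction.orbit (rootedAut X) (a⁻¹, a⁻¹ * b) ∧ E (E x u) t = x ∧
        E (E x u) v = E x u' := by
    intro a b ha hb x u u' hx hy huu
    obtain ⟨hu, hu'⟩ := hball ha hb huu
    have hc1 : IsChart X G R₀ fun q => E x (u * q) :=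
      IsChart.recenter hX hx (rBall_mono (by omega) hu)
    have hc2 : IsChart X G R₀ (E (E x u)) := IsChart.mono hy (by omega)
    obtain ⟨b', hb1, hb2, hb3, hb4⟩ := hc1.exists_transition hc2 (by rw [mul_one, hE1])
    obtain ⟨κ, hκ, hκb⟩ := hcpt b' hb1 hb2 hb3
    have hq : ∀ q ∈ X.rBall 1 (r + (r + r)), E (E x u) (κ q) = E x (u * q) := fun q hq => by
      rw [hκb q hq]; exact hb4 q (rBall_mono hR₀ hq)
    have hui := inv_mem_rBall hX hu
    refine ⟨κ u⁻¹, κ (u⁻¹ * u'), ?_, ?_, ?_⟩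
    · have := inv_mem_orbit_prod hX huu
      exact MulAction.mem_orbit_of_mem_orbit (⟨κ, hκ⟩ : rootedAut X) this
    · rw [hq _ (rBall_mono (by omega) hui), mul_inv_cancel, hE1]
    · rw [hq _ (mul_mem_rBall hX hui hu'), mul_inv_cancel_left]
  have hP : ∀ x ∉ B, P x := fun x hx => (hB x hx).mono (by omega)
  -- Recentering provides some chart at `E x u`; by `hmax` the chosen map there is then a chart of
  -- the same radius.
  have hP' : ∀ x ∉ B, ∀ u ∈ X.rBall 1 r, P (E x u) := fun x hx u hu =>
    hmax _ (by omega) _ ⟨fun q => E x (u * q), by simp, (hB x hx).recenter hX hu⟩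
  set O₁ := orbitFinset (rootedAut X) (z, w) with hO₁
  set O₂ := orbitFinset (rootedAut X) (z⁻¹, z⁻¹ * w) with hO₂
  have hm₁ : ∀ p, p ∈ O₁ ↔ p ∈ MulAction.orbit (rootedAut X) (z, w) := fun p =>
    mem_orbitFinset (hfin _)
  have hm₂ : ∀ p, p ∈ O₂ ↔ p ∈ MulAction.orbit (rootedAut X) (z⁻¹, z⁻¹ * w) := fun p =>
    mem_orbitFinset (hfin _)
  have hback : ∀ {t v : Γ}, (t, v) ∈ O₂ → (t⁻¹, t⁻¹ * v) ∈ O₁ := fun {t v} h => by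
    have := inv_mem_orbit_prod hX ((hm₂ _).mp h)
    rw [hm₁]; simpa using this
  have hcard : O₁.card = O₂.card := by
    refine Finset.card_nbij' (fun p => (p.1⁻¹, p.1⁻¹ * p.2)) (fun p => (p.1⁻¹, p.1⁻¹ * p.2))
      ?_ ?_ ?_ ?_
    · rintro ⟨u, u'⟩ h
      exact (hm₂ _).mpr (inv_mem_orbit_prod hX ((hm₁ _).mp h))
    · rintro ⟨t, v⟩ h
      exact hback h
    · rintro ⟨u, u'⟩ _; simp
    · rintro ⟨u, u'⟩ _; simp
  have hpos : 0 < (O₁.card : ℝ) := by exact_mod_cast orbitFinset_card_pos (hfin _)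
  let I₁ : Finset (V × Γ × Γ) := {q ∈ Finset.univ ×ˢ O₁ | P q.1 ∧ P (E q.1 q.2.1)}
  let I₂ : Finset (V × Γ × Γ) := {q ∈ Finset.univ ×ˢ O₂ | P q.1 ∧ P (E q.1 q.2.1)}
  let g₁ : V × Γ × Γ → ℝ := fun q => inner ℝ (f (E q.1 q.2.1)) (f (E q.1 q.2.2))
  let g₂ : V × Γ × Γ → ℝ := fun q => inner ℝ (f q.1) (f (E q.1 q.2.2))
  -- Changing the base point is a bijection from `I₁` to `I₂`. Its surjectivity uses the same step
  -- for `(z⁻¹, z⁻¹ * w)`, whose second entry is only known to lie in the `2r`-ball.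
  have hI : ∑ q ∈ I₁, g₁ q = ∑ q ∈ I₂, g₂ q := by
    have hex : ∀ q : V × Γ × Γ, ∃ t v, q ∈ I₁ → ((t, v) ∈ O₂ ∧ E (E q.1 q.2.1) t = q.1 ∧
        E (E q.1 q.2.1) v = E q.1 q.2.2) := fun q => by
      by_cases hq : q ∈ I₁
      · obtain ⟨h1, h2, h3⟩ := Finset.mem_filter.mp hq
        obtain ⟨t, v, h4, h5⟩ := hstep hz (rBall_mono (by omega) hw) h2 h3
          ((hm₁ _).mp (Finset.mem_product.mp h1).2)
        exact ⟨t, v, fun _ => ⟨(hm₂ _).mpr h4, h5⟩⟩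
      · exact ⟨1, 1, fun h => absurd h hq⟩
    choose t v htv using hex
    have hb₁ : ∀ q ∈ I₁, q.2.1 ∈ X.rBall 1 r ∧ q.2.2 ∈ X.rBall 1 r := fun q hq =>
      hball hz hw ((hm₁ _).mp (Finset.mem_product.mp (Finset.mem_filter.mp hq).1).2)
    have hb₂ : ∀ {a b}, (a, b) ∈ O₂ → a ∈ X.rBall 1 r ∧ b ∈ X.rBall 1 (r + r) := fun h =>
      hball (inv_mem_rBall hX hz) hzw ((hm₂ _).mp h)
    have hinj : ∀ {x a b}, P x → a ∈ X.rBall 1 (r + r) → b ∈ X.rBall 1 (r + r) →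
        E x a = E x b → a = b := fun hx ha hb h =>
      hx.inj (rBall_mono (by omega) ha) (rBall_mono (by omega) hb) h
    refine Finset.sum_bij (fun q _ => (E q.1 q.2.1, t q, v q)) ?_ ?_ ?_ ?_
    · intro q hq
      obtain ⟨h1, h2, h3⟩ := htv q hq
      obtain ⟨h4, h5, h6⟩ := Finset.mem_filter.mp hq
      refine Finset.mem_filter.mpr ⟨by simpa using h1, h6, ?_⟩
      change P (E (E q.1 q.2.1) (t q))
      rw [h2]; exact h5
    · rintro q hq q' hq' heq
      obtain ⟨h1, h2, h3⟩ := htv q hq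
      obtain ⟨h1', h2', h3'⟩ := htv q' hq'
      have e1 : E q.1 q.2.1 = E q'.1 q'.2.1 := congrArg (fun a => a.1) heq
      have e2 : t q = t q' := congrArg (fun a => a.2.1) heq
      have e3 : v q = v q' := congrArg (fun a => a.2.2) heq
      have e4 : q.1 = q'.1 := by rw [← h2, ← h2', e1, e2]
      have hPq := (Finset.mem_filter.mp hq).2.1
      have e5 : q.2.1 = q'.2.1 := by
        refine hinj hPq (rBall_mono (by omega) (hb₁ q hq).1) (rBall_mono (by omega) (hb₁ q' hq').1) ?_
        rw [e1, e4]
      have e6 : q.2.2 = q'.2.2 := by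
        refine hinj hPq (rBall_mono (by omega) (hb₁ q hq).2) (rBall_mono (by omega) (hb₁ q' hq').2) ?_
        rw [← h3, e1, e3, h3', e4]
      exact Prod.ext e4 (Prod.ext e5 e6)
    · rintro ⟨y, t', v'⟩ hy
      obtain ⟨h1, h2, h3⟩ := Finset.mem_filter.mp hy
      have hmem : (t', v') ∈ O₂ := (Finset.mem_product.mp h1).2
      obtain ⟨u, u', h4, h5, h6⟩ := hstep (inv_mem_rBall hX hz) hzw h2 h3 ((hm₂ _).mp hmem)
      simp only at h5 h6
      have hq : (E y t', u, u') ∈ I₁ := by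
        refine Finset.mem_filter.mpr ⟨?_, h3, ?_⟩
        · refine Finset.mem_product.mpr ⟨Finset.mem_univ _, ?_⟩
          rw [hm₁]; simpa using h4
        · change P (E (E y t') u)
          rw [h5]; exact h2
      refine ⟨_, hq, ?_⟩
      obtain ⟨h7, h8, h9⟩ := htv _ hq
      simp only [h5, h6] at h8 h9
      refine Prod.ext h5 (Prod.ext ?_ ?_)
      · exact hinj h2 (rBall_mono (by omega) (hb₂ h7).1) (rBall_mono (by omega) (hb₂ hmem).1) h8
      · exact hinj h2 (hb₂ h7).2 (hb₂ hmem).2 h9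
    · intro q hq
      obtain ⟨h1, h2, h3⟩ := htv q hq
      simp only [g₁, g₂, h3]
  have hinner : ∀ a b : V, |inner ℝ (f a) (f b)| ≤ 1 := fun a b =>
    (abs_real_inner_le_norm _ _).trans (mul_le_one₀ (hf a) (norm_nonneg _) (hf b))
  -- Triples outside the domain of the bijection start in `B`, so there are at most `|O| |B|` of
  -- them. Dividing by the orbit size leaves one `|B|` for each of the two sums.
  have hrest : ∀ (O : Finset (Γ × Γ)) (g : V × Γ × Γ → ℝ), (∀ q, |g q| ≤ 1) →
      (∀ p ∈ O, p.1 ∈ X.rBall 1 r) →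
      |∑ q ∈ Finset.univ ×ˢ O, g q -
        ∑ q ∈ Finset.univ ×ˢ O with P q.1 ∧ P (E q.1 q.2.1), g q| ≤ O.card * B.card := by
    intro O g hg hO
    rw [← Finset.sum_filter_add_sum_filter_not (Finset.univ ×ˢ O)
      (fun q => P q.1 ∧ P (E q.1 q.2.1)), add_sub_cancel_left]
    have hsub : ({q ∈ Finset.univ ×ˢ O | ¬ (P q.1 ∧ P (E q.1 q.2.1))} : Finset _) ⊆ B ×ˢ O := by
      intro q hq
      obtain ⟨h1, h2⟩ := Finset.mem_filter.mp hq
      refine Finset.mem_product.mpr ⟨?_, (Finset.mem_product.mp h1).2⟩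
      by_contra hb
      exact h2 ⟨hP _ hb, hP' _ hb _ (hO _ (Finset.mem_product.mp h1).2)⟩
    calc _ ≤ ∑ q ∈ Finset.univ ×ˢ O with ¬ (P q.1 ∧ P (E q.1 q.2.1)), |g q| :=
          Finset.abs_sum_le_sum_abs _ _
      _ ≤ ∑ q ∈ Finset.univ ×ˢ O with ¬ (P q.1 ∧ P (E q.1 q.2.1)), (1 : ℝ) :=
          Finset.sum_le_sum fun q _ => hg q
      _ = (Finset.card ({q ∈ Finset.univ ×ˢ O | ¬ (P q.1 ∧ P (E q.1 q.2.1))}) : ℝ) := by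
          rw [Finset.sum_const, nsmul_eq_mul, mul_one]
      _ ≤ ((B ×ˢ O).card : ℝ) := by exact_mod_cast Finset.card_le_card hsub
      _ = _ := by rw [Finset.card_product]; push_cast; ring
  have hl := hrest O₁ g₁ (fun q => hinner _ _) fun p hp => (hball hz hw ((hm₁ p).mp hp)).1
  have hr' := hrest O₂ g₂ (fun q => hinner _ _)
    fun p hp => (hball (inv_mem_rBall hX hz) hzw ((hm₂ p).mp hp)).1
  have hL : ∑ x, orbitAverage (rootedAut X) (z, w)
      (fun p => inner ℝ (f (E x p.1)) (f (E x p.2))) =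
      (∑ q ∈ Finset.univ ×ˢ O₁, g₁ q) / O₁.card := by
    rw [Finset.sum_product, Finset.sum_div]; rfl
  have hR : ∑ x, orbitAverage (rootedAut X) (z⁻¹ * w) (fun q => inner ℝ (f x) (f (E x q))) =
      (∑ q ∈ Finset.univ ×ˢ O₂, g₂ q) / O₁.card := by
    rw [Finset.sum_product, Finset.sum_div, hcard]
    refine Finset.sum_congr rfl fun x _ => ?_
    exact orbitAverage_map (hfin (z⁻¹, z⁻¹ * w)) Prod.snd (fun _ _ => rfl) _
  rw [hL, hR, ← sub_div, abs_div, abs_of_pos hpos, div_le_iff₀ hpos]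
  rw [← hcard] at hr'
  have e : ∑ q ∈ Finset.univ ×ˢ O₁ with P q.1 ∧ P (E q.1 q.2.1), g₁ q =
      ∑ q ∈ Finset.univ ×ˢ O₂ with P q.1 ∧ P (E q.1 q.2.1), g₂ q := hI
  rw [e] at hl
  rw [abs_le] at hl hr' ⊢
  constructor <;> linarith [hl.1, hl.2, hr'.1, hr'.2]

end Kernel

end SimpleGraph

/-! ### Orbit averages summed over invariant sets -/

section OrbitAverage

variable {K : Type*} [Group K] {Y : Type*} [MulAction K Y]

/-- An invariant finite set is a disjoint union of orbits, and averaging over each orbit preserves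
its sum. This removes the averages again in the energy and in the Laplacian, which are sums over
invariant sets of pairs. -/
theorem sum_orbitAverage_of_invariant {O : Finset Y} (hO : ∀ (k : K), ∀ y ∈ O, k • y ∈ O)
    (g : Y → ℝ) : ∑ y ∈ O, orbitAverage K y g = ∑ y ∈ O, g y := by
  classical
  have hsub : ∀ y ∈ O, MulAction.orbit K y ⊆ O := by
    rintro y hy _ ⟨k, rfl⟩; exact hO k y hy
  have hfin : ∀ y ∈ O, (MulAction.orbit K y).Finite := fun y hy => O.finite_toSet.subset (hsub y hy)
  have hcongr : ∀ y ∈ O, ∀ y' ∈ orbitFinset K y, orbitFinset K y' = orbitFinset K y := by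
    intro y hy y' hy'
    have h1 := (mem_orbitFinset (hfin y hy)).mp hy'
    have h2 : MulAction.orbit K y' = MulAction.orbit K y := MulAction.orbit_eq_iff.mpr h1
    ext q
    rw [mem_orbitFinset (hfin y hy), mem_orbitFinset (h2 ▸ hfin y hy), h2]
  have hself : ∀ y ∈ O, y ∈ orbitFinset K y := fun y hy =>
    (mem_orbitFinset (hfin y hy)).mpr (MulAction.mem_orbit_self y)
  simp only [orbitAverage, Finset.sum_div]
  rw [Finset.sum_comm' (t' := O) (s' := fun y => orbitFinset K y)]
  · refine Finset.sum_congr rfl fun y hy => ?_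
    have h1 : ∀ x ∈ orbitFinset K y, g y / ((orbitFinset K x).card : ℝ) =
        g y / ((orbitFinset K y).card : ℝ) := fun x hx => by rw [hcongr y hy x hx]
    have hc : ((orbitFinset K y).card : ℝ) ≠ 0 := by
      exact_mod_cast (orbitFinset_card_pos (hfin y hy)).ne'
    rw [Finset.sum_congr rfl h1, Finset.sum_const, nsmul_eq_mul]
    field_simp
  · intro x y
    constructor
    · rintro ⟨hx, hy⟩
      refine ⟨?_, hsub x hx ((mem_orbitFinset (hfin x hx)).mp hy)⟩
      rw [hcongr x hx y hy]; exact hself x hx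
    · rintro ⟨hx, hy⟩
      have hxO := hsub y hy ((mem_orbitFinset (hfin y hy)).mp hx)
      refine ⟨hxO, ?_⟩
      rw [hcongr y hy x hx]; exact hself y hy

end OrbitAverage

/-! ### Chart systems, and ultralimits of correlations -/

namespace SimpleGraph

open Classical in
/-- The neighbours of a vertex as a finite set. -/
noncomputable def nbrs {V : Type u} [Fintype V] (G : SimpleGraph V) (x : V) : Finset V :=
  Finset.univ.filter (G.Adj x)

theorem mem_nbrs {V : Type u} [Fintype V] {G : SimpleGraph V} {x y : V} :
    y ∈ G.nbrs x ↔ G.Adj x y := by simp [nbrs]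

/-- The combinatorial Laplacian on vector-valued functions. -/
noncomputable def laplacian {V : Type u} [Fintype V] (G : SimpleGraph V) {F : Type*}
    [AddCommGroup F] (f : V → F) (x : V) : F :=
  ∑ y ∈ G.nbrs x, (f x - f y)

open Classical in
/-- The vertices whose `R`-ball is not isomorphic to the `R`-ball of `X` around `1`. -/
noncomputable def badVertices {Γ : Type v} [Group Γ] (X : SimpleGraph Γ) {V : Type u} [Fintype V]
    (G : SimpleGraph V) (R : ℕ) : Finset V :=
  {x | ¬ ∃ E : Γ → V, E 1 = x ∧ IsChart X G R E}

section Charts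

variable {Γ : Type v} [Group Γ] {X : SimpleGraph Γ} {A : Finset Γ}

/-- One map per vertex serves all radii at once: take a chart of the greatest available radius up to
`N`, which is also a chart for all smaller radii. Where none exists, any map based at `x` will do.
-/
theorem exists_chart_system {V : Type u} (X : SimpleGraph Γ) (G : SimpleGraph V)
    (N : ℕ) :
    ∃ E : V → Γ → V, (∀ x, E x 1 = x) ∧
      ∀ k ≤ N, ∀ x, (∃ E' : Γ → V, E' 1 = x ∧ IsChart X G k E') → IsChart X G k (E x) := by
  classical
  have key : ∀ x, ∃ E : Γ → V, E 1 = x ∧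
      ∀ k ≤ N, (∃ E' : Γ → V, E' 1 = x ∧ IsChart X G k E') → IsChart X G k E := by
    intro x
    let p : ℕ → Prop := fun k => ∃ E' : Γ → V, E' 1 = x ∧ IsChart X G k E'
    by_cases h : ∃ k ≤ N, p k
    · obtain ⟨k, hk, hpk⟩ := h
      obtain ⟨E, hE, hE'⟩ : p (Nat.findGreatest p N) := Nat.findGreatest_spec hk hpk
      exact ⟨E, hE, fun j hj hpj => hE'.mono (Nat.le_findGreatest hj hpj)⟩
    · exact ⟨fun _ => x, rfl, fun k hk hpk => absurd ⟨k, hk, hpk⟩ h⟩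
  choose E hE using key
  exact ⟨E, fun x => (hE x).1, fun k hk x => (hE x).2 k hk⟩

variable {V : Type u} [Fintype V] {G : SimpleGraph V}

theorem notMem_badVertices {R : ℕ} {x : V} :
    x ∉ badVertices X G R ↔ ∃ E : Γ → V, E 1 = x ∧ IsChart X G R E := by
  simp [badVertices]

theorem IsChart.sum_nbrs (hX : ∀ u v, X.Adj u v ↔ u⁻¹ * v ∈ A) {R : ℕ} (hR : 1 ≤ R) {E : Γ → V}
    (h : IsChart X G R E) {M : Type*} [AddCommMonoid M] (g : V → M) :
    ∑ y ∈ G.nbrs (E 1), g y = ∑ a ∈ A, g (E a) := by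
  have h1 : (1 : Γ) ∈ X.rBall 1 R := mem_rBall_self _ _ _
  have hA : ∀ a ∈ A, a ∈ X.rBall 1 R := fun a ha => rBall_mono hR (mem_rBall_one hX ha)
  symm
  refine Finset.sum_bij (fun a _ => E a) ?_ ?_ ?_ (fun _ _ => rfl)
  · intro a ha
    rw [mem_nbrs, h.adj 1 h1 a (hA a ha), hX]; simpa using ha
  · intro a ha b hb hab
    exact h.inj (hA a ha) (hA b hb) hab
  · intro y hy
    obtain ⟨w, hw, rfl⟩ := h.surj 0 hR 1 (mem_rBall_self _ _ _) y (mem_nbrs.mp hy)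
    exact ⟨w, by simpa using (hX 1 w).mp hw, rfl⟩

theorem IsChart.card_nbrs (hX : ∀ u v, X.Adj u v ↔ u⁻¹ * v ∈ A) {R : ℕ} (hR : 1 ≤ R) {E : Γ → V}
    (h : IsChart X G R E) : (G.nbrs (E 1)).card = A.card := by
  rw [Finset.card_eq_sum_ones, Finset.card_eq_sum_ones]
  exact h.sum_nbrs hX hR _

end Charts

section Limit

variable {Γ : Type v} [Group Γ] {X : SimpleGraph Γ} {A : Finset Γ} {V : ℕ → Type u}
  [∀ n, Fintype (V n)]

theorem smul_mem_of_mem_rootedAut (hX : ∀ u v, X.Adj u v ↔ u⁻¹ * v ∈ A) (κ : rootedAut X) {a : Γ}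
    (ha : a ∈ A) : κ • a ∈ A := by
  have h1 : X.Adj ((κ : Equiv.Perm Γ) 1) ((κ : Equiv.Perm Γ) a) := by
    rw [κ.2.2, hX]; simpa using ha
  rw [κ.2.1, hX, inv_one, one_mul] at h1
  exact h1

/-- An ultralimit of the correlations of vector-valued functions along charts. -/
theorem exists_limit_correlation (hX : ∀ u v, X.Adj u v ↔ u⁻¹ * v ∈ A)
    (hA : Subgroup.closure (A : Set Γ) = ⊤) (G : ∀ n, SimpleGraph (V n))
    (hbad : ∀ R, Tendsto (fun n => ((badVertices X (G n) R).card : ℝ) / Fintype.card (V n))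
      atTop (𝓝 0))
    (𝒰 : Ultrafilter ℕ) (h𝒰 : (𝒰 : Filter ℕ) ≤ atTop) {F : ℕ → Type}
    [∀ n, NormedAddCommGroup (F n)] [∀ n, InnerProductSpace ℝ (F n)] (f : ∀ n, V n → F n)
    (hf : ∀ n x, ‖f n x‖ ≤ 1) (E : ∀ n, V n → Γ → V n) (hE1 : ∀ n x, E n x 1 = x)
    (hE : ∀ n, ∀ k ≤ n, ∀ x, (∃ E' : Γ → V n, E' 1 = x ∧ IsChart X (G n) k E') →
      IsChart X (G n) k (E n x)) :
    ∃ φ : Γ → ℝ,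
      (∀ z w, Tendsto (fun n => (∑ x, orbitAverage (rootedAut X) (z, w)
        (fun p => inner ℝ (f n (E n x p.1)) (f n (E n x p.2)))) / Fintype.card (V n))
        𝒰 (𝓝 (φ (z⁻¹ * w)))) ∧
      (∀ z w, φ (z⁻¹ * w) = φ (w⁻¹ * z)) ∧
      ∀ (D : Finset Γ) (c : Γ → ℝ), 0 ≤ ∑ z ∈ D, ∑ w ∈ D, c z * c w * φ (z⁻¹ * w) := by
  classical
  have hinner : ∀ n (a b : V n), |inner ℝ (f n a) (f n b)| ≤ 1 := fun n a b =>
    (abs_real_inner_le_norm _ _).trans (mul_le_one₀ (hf n a) (norm_nonneg _) (hf n b))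
  let ψ : Γ → ℕ → ℝ := fun q n => (∑ x, orbitAverage (rootedAut X) q
    (fun q => inner ℝ (f n x) (f n (E n x q)))) / Fintype.card (V n)
  have hψ : ∀ q n, ψ q n ∈ Set.Icc (-1 : ℝ) 1 := fun q n => by
    refine Set.mem_Icc.mpr (abs_le.mp ?_)
    simp only [ψ]
    rw [abs_div, Nat.abs_cast]
    refine div_le_of_le_mul₀ (Nat.cast_nonneg _) zero_le_one ?_
    calc _ ≤ ∑ x, |orbitAverage (rootedAut X) q (fun q => inner ℝ (f n x) (f n (E n x q)))| :=
          Finset.abs_sum_le_sum_abs _ _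
      _ ≤ ∑ x : V n, (1 : ℝ) := Finset.sum_le_sum fun x _ =>
          abs_orbitAverage_le zero_le_one fun q => hinner n _ _
      _ = _ := by simp
  have hlim : ∀ q, ∃ a, Tendsto (ψ q) 𝒰 (𝓝 a) := fun q => by
    obtain ⟨a, _, ha⟩ := isCompact_Icc.ultrafilter_le_nhds (𝒰.map (ψ q))
      (by rw [le_principal_iff]; exact Filter.Eventually.of_forall (f := (𝒰 : Filter ℕ)) (hψ q))
    exact ⟨a, ha⟩
  choose φ hφ using hlim
  have hpair : ∀ z w, Tendsto (fun n => (∑ x, orbitAverage (rootedAut X) (z, w)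
      (fun p => inner ℝ (f n (E n x p.1)) (f n (E n x p.2)))) / Fintype.card (V n))
      𝒰 (𝓝 (φ (z⁻¹ * w))) := by
    intro z w
    obtain ⟨R, hR⟩ := exists_radius_pair_correlation hX hA z w
    have h0 : Tendsto (fun n => (∑ x, orbitAverage (rootedAut X) (z, w)
        (fun p => inner ℝ (f n (E n x p.1)) (f n (E n x p.2)))) / Fintype.card (V n) -
        ψ (z⁻¹ * w) n) 𝒰 (𝓝 0) := by
      have hb := ((hbad R).mono_left h𝒰).const_mul 2
      rw [mul_zero] at hb
      refine squeeze_zero_norm' ?_ hb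
      filter_upwards [h𝒰 (eventually_ge_atTop R)] with n hn
      have := hR (G n) (E n) (hE1 n) (fun k hk => hE n k (hk.trans hn)) (badVertices X (G n) R)
        (fun x hx => hE n R hn x (notMem_badVertices.mp hx)) (f n) (hf n)
      simp only [ψ]
      rw [← sub_div, Real.norm_eq_abs, abs_div, Nat.abs_cast, ← mul_div_assoc]
      gcongr
    have := h0.add (hφ (z⁻¹ * w))
    simpa using this
  have hfin := fun p => finite_orbit_rootedAut_prod hX hA p
  refine ⟨φ, hpair, fun z w => ?_, fun D c => ?_⟩
  · refine tendsto_nhds_unique (hpair z w) ((hpair w z).congr fun n => ?_)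
    congr 1
    refine Finset.sum_congr rfl fun x _ => ?_
    rw [show (w, z) = Prod.swap (z, w) from rfl,
      orbitAverage_map (hfin (z, w)) Prod.swap (fun _ _ => rfl)]
    refine orbitAverage_congr (hfin _) fun κ => ?_
    exact real_inner_comm _ _
  -- Positivity requires averaging all points of `D` simultaneously. The orbit of the tuple `ι` does
  -- so: its image under `σ ↦ (σ z, σ w)` gives the average for the pair, and before the limit the
  -- quadratic form is an average of squared norms.
  · let ι : D → Γ := Subtype.val
    have hlim : Tendsto (fun n => (∑ x, orbitAverage (rootedAut X) ι
        (fun σ => ‖∑ z : D, c z • f n (E n x (σ z))‖ ^ 2)) / Fintype.card (V n)) 𝒰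
        (𝓝 (∑ z ∈ D, ∑ w ∈ D, c z * c w * φ (z⁻¹ * w))) := by
      have h1 : Tendsto (fun n => ∑ z ∈ D, ∑ w ∈ D, c z * c w *
          ((∑ x, orbitAverage (rootedAut X) (z, w)
            (fun p => inner ℝ (f n (E n x p.1)) (f n (E n x p.2)))) / Fintype.card (V n))) 𝒰
          (𝓝 (∑ z ∈ D, ∑ w ∈ D, c z * c w * φ (z⁻¹ * w))) :=
        tendsto_finsetSum _ fun z _ => tendsto_finsetSum _ fun w _ => (hpair z w).const_mul _
      refine h1.congr fun n => ?_
      have h2 : ∀ x, orbitAverage (rootedAut X) ι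
          (fun σ => ‖∑ z : D, c z • f n (E n x (σ z))‖ ^ 2) = ∑ z ∈ D, ∑ w ∈ D, c z * c w *
          orbitAverage (rootedAut X) (z, w)
            (fun p => inner ℝ (f n (E n x p.1)) (f n (E n x p.2))) := by
        intro x
        have h3 : ∀ z w : D, orbitAverage (rootedAut X) ((z : Γ), (w : Γ))
            (fun p => inner ℝ (f n (E n x p.1)) (f n (E n x p.2))) =
            orbitAverage (rootedAut X) ι
              (fun σ => inner ℝ (f n (E n x (σ z))) (f n (E n x (σ w)))) := fun z w =>
          orbitAverage_map (finite_orbit_rootedAut_pi hX hA ι) (fun σ : D → Γ => (σ z, σ w))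
            (fun _ _ => rfl) _
        have h4 : (fun σ : D → Γ => ‖∑ z : D, c z • f n (E n x (σ z))‖ ^ 2) = fun σ =>
            ∑ z : D, ∑ w : D, c z * c w *
              inner ℝ (f n (E n x (σ z))) (f n (E n x (σ w))) := by
          funext σ
          rw [← real_inner_self_eq_norm_sq, sum_inner]
          refine Finset.sum_congr rfl fun z _ => ?_
          rw [inner_sum]
          refine Finset.sum_congr rfl fun w _ => ?_
          rw [real_inner_smul_left, real_inner_smul_right, mul_assoc]
        rw [h4, orbitAverage_sum, ← Finset.sum_coe_sort D]
        refine Finset.sum_congr rfl fun z _ => ?_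
        rw [orbitAverage_sum, ← Finset.sum_coe_sort D]
        refine Finset.sum_congr rfl fun w _ => ?_
        rw [orbitAverage_const_mul, h3]
      simp only [h2]
      symm
      rw [Finset.sum_comm, Finset.sum_div]
      refine Finset.sum_congr rfl fun z _ => ?_
      rw [Finset.sum_comm, Finset.sum_div]
      refine Finset.sum_congr rfl fun w _ => ?_
      rw [← Finset.mul_sum, mul_div_assoc]
    refine ge_of_tendsto' hlim fun n => ?_
    exact div_nonneg (Finset.sum_nonneg fun x _ => orbitAverage_nonneg fun σ => sq_nonneg _)
      (Nat.cast_nonneg _)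

end Limit

end SimpleGraph

/-! ### The approximate Laplacian inequality on the graphs -/

namespace SimpleGraph

section Gap

variable {Γ : Type v} [Group Γ]

/-- The spectral gap of a group with Property (T), for invariant positive semidefinite kernels. -/
theorem exists_kernel_gap [Countable Γ] [Infinite Γ] (hT : HasKazhdanPropertyT Γ)
    (A : Finset Γ) (hA : Subgroup.closure (A : Set Γ) = ⊤) (hinv : ∀ a ∈ A, a⁻¹ ∈ A) :
    ∃ ε : ℝ, 0 < ε ∧ ∀ k : Γ → Γ → ℝ, (∀ z w, k z w = k w z) →
      (∀ (D : Finset Γ) (c : Γ → ℝ), 0 ≤ ∑ z ∈ D, ∑ w ∈ D, c z * c w * k z w) →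
      (∀ g z w, k (g * z) (g * w) = k z w) →
      ε * ∑ a ∈ A, (k a a - 2 * k a 1 + k 1 1) ≤
        ∑ a ∈ A, ∑ b ∈ A, (k 1 1 - k 1 b - k a 1 + k a b) := by
  obtain ⟨ε, hε, hgap⟩ := hT.exists_laplacian_gap A hA hinv
  refine ⟨ε, hε, fun k hsymm hpos hk => ?_⟩
  -- The Hilbert spaces tested by Property (T) live in `Type`; countability allows the index set of
  -- the kernel to be moved there.
  let e := equivShrink.{0} Γ
  let _ : MulAction Γ (Shrink.{0} Γ) := e.symm.mulAction Γ
  have hsmul : ∀ (g : Γ) (x : Shrink.{0} Γ), g • x = e (g * e.symm x) := fun g x => rfl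
  obtain ⟨H, _, _, _, π, δ, hδ, hπ⟩ := exists_unitary_rep_of_kernel (Γ := Γ)
    (fun x y => k (e.symm x) (e.symm y)) (fun x y => hsymm _ _) (fun s c => by
      have := hpos (s.map e.symm.toEmbedding) (fun z => c (e z))
      simpa using this) (fun g x y => by simp [hsmul, hk])
  have hδ' : ∀ z w, (inner ℂ (δ (e z)) (δ (e w)) : ℂ) = (k z w : ℂ) := fun z w => by
    rw [hδ]; simp
  have hπ' : ∀ a, π a (δ (e 1)) = δ (e a) := fun a => by rw [hπ, hsmul]; simp
  have h := hgap H π (δ (e 1))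
  simp only [hπ'] at h
  have h1 : ∀ a, ‖δ (e a) - δ (e 1)‖ ^ 2 = k a a - 2 * k a 1 + k 1 1 := by
    intro a
    rw [@norm_sub_sq ℂ, hδ', ← @inner_self_eq_norm_sq ℂ, ← @inner_self_eq_norm_sq ℂ, hδ', hδ']
    simp
  have h2 : ‖∑ a ∈ A, (δ (e 1) - δ (e a))‖ ^ 2 =
      ∑ a ∈ A, ∑ b ∈ A, (k 1 1 - k 1 b - k a 1 + k a b) := by
    rw [← @inner_self_eq_norm_sq ℂ, sum_inner]
    simp only [inner_sum, inner_sub_left, inner_sub_right, hδ', map_sum, map_sub]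
    refine Finset.sum_congr rfl fun a _ => Finset.sum_congr rfl fun b _ => ?_
    simp
    ring
  simp only [h1, h2] at h
  exact h

end Gap

section Limit

variable {Γ : Type v} [Group Γ] {X : SimpleGraph Γ} {A : Finset Γ} {V : ℕ → Type u}
  [∀ n, Fintype (V n)]

theorem norm_sub_sq_le_four {F : Type*} [NormedAddCommGroup F] {a b : F} (ha : ‖a‖ ≤ 1)
    (hb : ‖b‖ ≤ 1) : ‖a - b‖ ^ 2 ≤ 4 := by
  have h : ‖a - b‖ ≤ 2 := (norm_sub_le a b).trans (by linarith)
  nlinarith [norm_nonneg (a - b)]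

/-- The graph Dirichlet energy differs little from the energy along charts. -/
theorem energy_le_chart_energy {V : Type u} [Fintype V] (hX : ∀ u v, X.Adj u v ↔ u⁻¹ * v ∈ A)
    (G : SimpleGraph V) {D : ℕ} (hD : ∀ x, (G.nbrs x).card ≤ D) {F : Type*}
    [NormedAddCommGroup F] (f : V → F) (hf : ∀ x, ‖f x‖ ≤ 1)
    (E : V → Γ → V) (hE1 : ∀ x, E x 1 = x) (B : Finset V) (hB : ∀ x ∉ B, IsChart X G 1 (E x)) :
    ∑ x, ∑ y ∈ G.nbrs x, ‖f x - f y‖ ^ 2 ≤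
      ∑ x, ∑ a ∈ A, ‖f x - f (E x a)‖ ^ 2 + 4 * D * B.card := by
  classical
  have h : ∀ x, ∑ y ∈ G.nbrs x, ‖f x - f y‖ ^ 2 ≤
      ∑ a ∈ A, ‖f x - f (E x a)‖ ^ 2 + if x ∈ B then (4 * D : ℝ) else 0 := by
    intro x
    split_ifs with hx
    · have h1 : ∑ y ∈ G.nbrs x, ‖f x - f y‖ ^ 2 ≤ ∑ y ∈ G.nbrs x, (4 : ℝ) :=
        Finset.sum_le_sum fun y _ => norm_sub_sq_le_four (hf x) (hf y)
      rw [Finset.sum_const, nsmul_eq_mul] at h1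
      have h2 : ((G.nbrs x).card : ℝ) ≤ D := by exact_mod_cast hD x
      have h3 : 0 ≤ ∑ a ∈ A, ‖f x - f (E x a)‖ ^ 2 := Finset.sum_nonneg fun _ _ => sq_nonneg _
      linarith
    · have := (hB x hx).sum_nbrs hX le_rfl (fun y => ‖f x - f y‖ ^ 2)
      rw [hE1] at this
      rw [this, add_zero]
  refine (Finset.sum_le_sum fun x _ => h x).trans_eq ?_
  rw [Finset.sum_add_distrib, Finset.sum_ite_mem, Finset.univ_inter, Finset.sum_const,
    nsmul_eq_mul]
  ring

/-- The graph Laplacian differs little from the Laplacian along charts. -/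
theorem chart_laplacian_le_laplacian {V : Type u} [Fintype V]
    (hX : ∀ u v, X.Adj u v ↔ u⁻¹ * v ∈ A)
    (G : SimpleGraph V) {F : Type*} [NormedAddCommGroup F] (f : V → F) (hf : ∀ x, ‖f x‖ ≤ 1)
    (E : V → Γ → V) (hE1 : ∀ x, E x 1 = x) (B : Finset V) (hB : ∀ x ∉ B, IsChart X G 1 (E x)) :
    ∑ x, ‖∑ a ∈ A, (f x - f (E x a))‖ ^ 2 ≤
      ∑ x, ‖G.laplacian f x‖ ^ 2 + 4 * (A.card : ℝ) ^ 2 * B.card := by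
  classical
  have h : ∀ x, ‖∑ a ∈ A, (f x - f (E x a))‖ ^ 2 ≤
      ‖G.laplacian f x‖ ^ 2 + if x ∈ B then (4 * (A.card : ℝ) ^ 2) else 0 := by
    intro x
    split_ifs with hx
    · have h1 : ‖∑ a ∈ A, (f x - f (E x a))‖ ≤ ∑ a ∈ A, (2 : ℝ) :=
        norm_sum_le_of_le _ fun a _ => (norm_sub_le _ _).trans (by linarith [hf x, hf (E x a)])
      rw [Finset.sum_const, nsmul_eq_mul] at h1
      have h2 := pow_le_pow_left₀ (norm_nonneg _) h1 2
      nlinarith [sq_nonneg ‖G.laplacian f x‖]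
    · have := (hB x hx).sum_nbrs hX le_rfl (fun y => f x - f y)
      rw [hE1] at this
      rw [laplacian, this, add_zero]
  refine (Finset.sum_le_sum fun x _ => h x).trans_eq ?_
  rw [Finset.sum_add_distrib, Finset.sum_ite_mem, Finset.univ_inter, Finset.sum_const,
    nsmul_eq_mul]
  ring

/-- Graphs converging locally to a Cayley graph of a group with Property (T) satisfy, up to a small
error, the Laplacian inequality equivalent to a spectral gap. -/
theorem exists_laplacian_inequality [Countable Γ] [Infinite Γ] (hT : HasKazhdanPropertyT Γ)
    (hX : ∀ u v, X.Adj u v ↔ u⁻¹ * v ∈ A) (hA : Subgroup.closure (A : Set Γ) = ⊤)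
    (G : ∀ n, SimpleGraph (V n)) {D : ℕ} (hD : ∀ n x, ((G n).nbrs x).card ≤ D)
    (hne : ∀ᶠ n in atTop, 0 < Fintype.card (V n))
    (hbad : ∀ R, Tendsto (fun n => ((badVertices X (G n) R).card : ℝ) / Fintype.card (V n))
      atTop (𝓝 0)) :
    ∃ ε : ℝ, 0 < ε ∧ ∀ η : ℝ, 0 < η → ∀ᶠ n in atTop,
      ∀ (m : ℕ) (f : V n → EuclideanSpace ℝ (Fin m)), (∀ x, ‖f x‖ ≤ 1) →
        ε * ∑ x, ∑ y ∈ (G n).nbrs x, ‖f x - f y‖ ^ 2 ≤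
          ∑ x, ‖(G n).laplacian f x‖ ^ 2 + η * Fintype.card (V n) := by
  classical
  obtain ⟨ε, hε, hgap⟩ := exists_kernel_gap hT A hA fun a ha => inv_mem_of_adj_iff hX ha
  refine ⟨ε, hε, fun η hη => ?_⟩
  by_contra hcon
  rw [Filter.not_eventually] at hcon
  -- Functions are chosen for every `n`, zero where the inequality holds; the ultrafilter below
  -- lives on the indices where it fails.
  have hex : ∀ n, ∃ (m : ℕ) (f : V n → EuclideanSpace ℝ (Fin m)), (∀ x, ‖f x‖ ≤ 1) ∧
      ((¬ ∀ (m : ℕ) (f : V n → EuclideanSpace ℝ (Fin m)), (∀ x, ‖f x‖ ≤ 1) →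
        ε * ∑ x, ∑ y ∈ (G n).nbrs x, ‖f x - f y‖ ^ 2 ≤
          ∑ x, ‖(G n).laplacian f x‖ ^ 2 + η * Fintype.card (V n)) →
        ∑ x, ‖(G n).laplacian f x‖ ^ 2 + η * Fintype.card (V n) <
          ε * ∑ x, ∑ y ∈ (G n).nbrs x, ‖f x - f y‖ ^ 2) := by
    intro n
    by_cases h : ∀ (m : ℕ) (f : V n → EuclideanSpace ℝ (Fin m)), (∀ x, ‖f x‖ ≤ 1) →
        ε * ∑ x, ∑ y ∈ (G n).nbrs x, ‖f x - f y‖ ^ 2 ≤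
          ∑ x, ‖(G n).laplacian f x‖ ^ 2 + η * Fintype.card (V n)
    · exact ⟨0, fun _ => 0, by simp, fun h' => absurd h h'⟩
    · have h' := h
      push Not at h'
      obtain ⟨m, f, hf, hlt⟩ := h'
      exact ⟨m, f, hf, fun _ => hlt⟩
  choose m f hf hlt using hex
  have := hcon
  rw [Filter.frequently_iff_neBot] at this
  obtain ⟨𝒰, hle⟩ := @Ultrafilter.exists_le _ _ this
  have h𝒰 : (𝒰 : Filter ℕ) ≤ atTop := hle.trans inf_le_left
  have hmem : ∀ᶠ n in (𝒰 : Filter ℕ), ∑ x, ‖(G n).laplacian (f n) x‖ ^ 2 +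
      η * Fintype.card (V n) < ε * ∑ x, ∑ y ∈ (G n).nbrs x, ‖f n x - f n y‖ ^ 2 := by
    have h1 : (𝒰 : Filter ℕ) ≤ 𝓟 _ := hle.trans inf_le_right
    filter_upwards [le_principal_iff.mp h1] with n hn
    exact hlt n hn
  choose E hE1 hE using fun n => exists_chart_system X (G n) n
  obtain ⟨φ, hφ, hsymm, hpos⟩ := exists_limit_correlation hX hA G hbad 𝒰 h𝒰 f hf E hE1 hE
  have hfinal := hgap (fun z w => φ (z⁻¹ * w)) hsymm hpos (fun g z w => by simp [mul_assoc])
  let P : Γ → Γ → ℕ → ℝ := fun z w n => (∑ x, orbitAverage (rootedAut X) (z, w)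
    (fun p => inner ℝ (f n (E n x p.1)) (f n (E n x p.2)))) / Fintype.card (V n)
  have hfin := fun p => finite_orbit_rootedAut_prod hX hA p
  -- Rooted automorphisms preserve `1` and `A`, so the pair sets `{(1, 1)}`, `A × {1}`, `A × A` and
  -- the diagonal of `A` are invariant, and on them the averaged correlations sum to the plain ones.
  have horb : ∀ (O : Finset (Γ × Γ)), (∀ (κ : rootedAut X), ∀ p ∈ O, κ • p ∈ O) → ∀ n,
      ∑ p ∈ O, P p.1 p.2 n =
        (∑ x, ∑ p ∈ O, inner ℝ (f n (E n x p.1)) (f n (E n x p.2))) / Fintype.card (V n) := by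
    intro O hO n
    simp only [P]
    rw [← Finset.sum_div, Finset.sum_comm]
    congr 1
    refine Finset.sum_congr rfl fun x _ => ?_
    exact sum_orbitAverage_of_invariant hO (fun p => inner ℝ (f n (E n x p.1)) (f n (E n x p.2)))
  have hκ1 : ∀ κ : rootedAut X, κ • (1 : Γ) = 1 := fun κ => κ.2.1
  have hκA : ∀ (κ : rootedAut X), ∀ a ∈ A, κ • a ∈ A := fun κ a ha =>
    smul_mem_of_mem_rootedAut hX κ ha
  have h11 := fun n => horb {(1, 1)} (fun κ p hp => by
    rw [Finset.mem_singleton] at hp ⊢; subst hp; exact Prod.ext (hκ1 κ) (hκ1 κ)) n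
  have hA1 := fun n => horb (A ×ˢ {1}) (fun κ p hp => by
    rw [Finset.mem_product, Finset.mem_singleton] at hp ⊢
    refine ⟨hκA κ _ hp.1, ?_⟩
    change κ • p.2 = 1
    rw [hp.2]; exact hκ1 κ) n
  have hAA := fun n => horb (A ×ˢ A) (fun κ p hp => by
    rw [Finset.mem_product] at hp ⊢
    exact ⟨hκA κ _ hp.1, hκA κ _ hp.2⟩) n
  have hdiag := fun n => horb (A.image fun a => (a, a)) (fun κ p hp => by
    rw [Finset.mem_image] at hp ⊢
    obtain ⟨a, ha, rfl⟩ := hp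
    exact ⟨κ • a, hκA κ a ha, rfl⟩) n
  simp only [Finset.sum_product, Finset.sum_singleton] at h11 hA1 hAA
  have hdi : Function.Injective fun a : Γ => (a, a) := fun a b h => congrArg Prod.fst h
  simp only [Finset.sum_image hdi.injOn] at hdiag
  simp only [hE1] at h11 hA1
  have hPswap : ∀ b n, P 1 b n = P b 1 n := by
    intro b n
    simp only [P]
    congr 1
    refine Finset.sum_congr rfl fun x _ => ?_
    rw [show (b, (1 : Γ)) = Prod.swap ((1 : Γ), b) from rfl,
      orbitAverage_map (hfin (1, b)) Prod.swap (fun _ _ => rfl)]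
    exact orbitAverage_congr (hfin _) fun κ => real_inner_comm _ _
  have hEn : ∀ n, ∑ a ∈ A, (P a a n - 2 * P a 1 n + P 1 1 n) =
      (∑ x, ∑ a ∈ A, ‖f n x - f n (E n x a)‖ ^ 2) / Fintype.card (V n) := by
    intro n
    have : ∀ x, ∑ a ∈ A, ‖f n x - f n (E n x a)‖ ^ 2 =
        ∑ a ∈ A, inner ℝ (f n (E n x a)) (f n (E n x a)) -
        2 * ∑ a ∈ A, inner ℝ (f n (E n x a)) (f n x) + A.card * inner ℝ (f n x) (f n x) := by
      intro x
      rw [Finset.mul_sum, ← Finset.sum_sub_distrib, ← nsmul_eq_mul, ← Finset.sum_const,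
        ← Finset.sum_add_distrib]
      refine Finset.sum_congr rfl fun a _ => ?_
      rw [norm_sub_sq_real, real_inner_comm, real_inner_self_eq_norm_sq,
        real_inner_self_eq_norm_sq]
      ring
    simp only [this, Finset.sum_add_distrib, Finset.sum_sub_distrib, ← Finset.mul_sum, hdiag, hA1,
      Finset.sum_const, nsmul_eq_mul, h11]
    ring
  have hLap : ∀ n, ∑ a ∈ A, ∑ b ∈ A, (P 1 1 n - P 1 b n - P a 1 n + P a b n) =
      (∑ x, ‖∑ a ∈ A, (f n x - f n (E n x a))‖ ^ 2) / Fintype.card (V n) := by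
    intro n
    have : ∀ x, ‖∑ a ∈ A, (f n x - f n (E n x a))‖ ^ 2 =
        A.card * (A.card * inner ℝ (f n x) (f n x)) -
        2 * A.card * ∑ a ∈ A, inner ℝ (f n (E n x a)) (f n x) +
        ∑ a ∈ A, ∑ b ∈ A, inner ℝ (f n (E n x a)) (f n (E n x b)) := by
      intro x
      rw [← real_inner_self_eq_norm_sq, sum_inner]
      simp_rw [inner_sum, inner_sub_left, inner_sub_right]
      simp only [Finset.sum_sub_distrib, Finset.sum_const, nsmul_eq_mul, ← Finset.mul_sum]
      have : ∑ b ∈ A, inner ℝ (f n x) (f n (E n x b)) =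
          ∑ b ∈ A, inner ℝ (f n (E n x b)) (f n x) :=
        Finset.sum_congr rfl fun b _ => real_inner_comm _ _
      rw [this]
      ring
    rw [Finset.sum_congr rfl fun x _ => this x]
    simp only [Finset.sum_add_distrib, Finset.sum_sub_distrib, ← Finset.mul_sum, hAA, hA1,
      Finset.sum_const, nsmul_eq_mul, h11, hPswap]
    ring
  have hEnlim : Tendsto (fun n => ∑ a ∈ A, (P a a n - 2 * P a 1 n + P 1 1 n)) 𝒰
      (𝓝 (∑ a ∈ A, (φ (a⁻¹ * a) - 2 * φ (a⁻¹ * 1) + φ (1⁻¹ * 1)))) :=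
    tendsto_finsetSum _ fun a _ => ((hφ a a).sub ((hφ a 1).const_mul 2)).add (hφ 1 1)
  have hLaplim : Tendsto (fun n => ∑ a ∈ A, ∑ b ∈ A, (P 1 1 n - P 1 b n - P a 1 n + P a b n)) 𝒰
      (𝓝 (∑ a ∈ A, ∑ b ∈ A,
        (φ (1⁻¹ * 1) - φ (1⁻¹ * b) - φ (a⁻¹ * 1) + φ (a⁻¹ * b)))) :=
    tendsto_finsetSum _ fun a _ => tendsto_finsetSum _ fun b _ =>
      (((hφ 1 1).sub (hφ 1 b)).sub (hφ a 1)).add (hφ a b)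
  have hb1 := (hbad 1).mono_left h𝒰
  -- The errors from atypical vertices vanish in the limit but `η` survives, contradicting `hfinal`.
  have hleft := (hLaplim.sub (hb1.const_mul (4 * (A.card : ℝ) ^ 2))).add_const η
  have hright := (hEnlim.add (hb1.const_mul (4 * (D : ℝ)))).const_mul ε
  have hle : ∀ᶠ n in (𝒰 : Filter ℕ),
      ∑ a ∈ A, ∑ b ∈ A, (P 1 1 n - P 1 b n - P a 1 n + P a b n) -
        4 * (A.card : ℝ) ^ 2 * (((badVertices X (G n) 1).card : ℝ) / Fintype.card (V n)) + η ≤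
      ε * (∑ a ∈ A, (P a a n - 2 * P a 1 n + P 1 1 n) +
        4 * (D : ℝ) * (((badVertices X (G n) 1).card : ℝ) / Fintype.card (V n))) := by
    filter_upwards [hmem, h𝒰 hne, h𝒰 (eventually_ge_atTop 1)] with n h1 h2 h3
    have hV : (0 : ℝ) < Fintype.card (V n) := by exact_mod_cast h2
    have hB : ∀ x ∉ badVertices X (G n) 1, IsChart X (G n) 1 (E n x) := fun x hx =>
      hE n 1 h3 x (notMem_badVertices.mp hx)
    have h4 := energy_le_chart_energy hX (G n) (hD n) (f n) (hf n) (E n) (hE1 n) _ hB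
    have h5 := chart_laplacian_le_laplacian hX (G n) (f n) (hf n) (E n) (hE1 n) _ hB
    rw [hEn, hLap]
    have h6 := mul_le_mul_of_nonneg_left h4 hε.le
    have e1 : (∑ x, ‖∑ a ∈ A, (f n x - f n (E n x a))‖ ^ 2) / Fintype.card (V n) -
        4 * (A.card : ℝ) ^ 2 * (((badVertices X (G n) 1).card : ℝ) / Fintype.card (V n)) + η =
        (∑ x, ‖∑ a ∈ A, (f n x - f n (E n x a))‖ ^ 2 - 4 * (A.card : ℝ) ^ 2 *
          ((badVertices X (G n) 1).card : ℝ) + η * Fintype.card (V n)) / Fintype.card (V n) := by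
      field_simp
    have e2 : ε * ((∑ x, ∑ a ∈ A, ‖f n x - f n (E n x a)‖ ^ 2) / Fintype.card (V n) +
        4 * (D : ℝ) * (((badVertices X (G n) 1).card : ℝ) / Fintype.card (V n))) =
        ε * (∑ x, ∑ a ∈ A, ‖f n x - f n (E n x a)‖ ^ 2 + 4 * (D : ℝ) *
          ((badVertices X (G n) 1).card : ℝ)) / Fintype.card (V n) := by
      field_simp
    rw [e1, e2]
    gcongr
    linarith
  have hlim := le_of_tendsto_of_tendsto hleft hright hle
  simp only [mul_zero, sub_zero, add_zero] at hlim
  linarith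

end Limit

end SimpleGraph

/-! ### Iterating a positive contraction -/

section Iteration

variable {W : Type*} [NormedAddCommGroup W] [InnerProductSpace ℝ W]

/-- If `P` is symmetric with `0 ≤ P ≤ 1`, then `⟪P f, f⟫` decreases along the iterates of `1 - P`. -/
theorem inner_iterate_step {P : W →ₗ[ℝ] W} (hP : P.IsSymmetric)
    (hP1 : ∀ w, ‖P w‖ ^ 2 ≤ inner ℝ (P w) w) (f : W) :
    inner ℝ (P (f - P f)) (f - P f) ≤ inner ℝ (P f) f - ‖P f‖ ^ 2 := by
  have h1 : inner ℝ (P (P f)) f = ‖P f‖ ^ 2 := by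
    rw [hP (P f) f, real_inner_self_eq_norm_sq]
  have h2 : inner ℝ (P (P f)) (P f) ≤ ‖P f‖ ^ 2 := by
    have h3 := hP1 (P f)
    have h4 := real_inner_le_norm (P (P f)) (P f)
    nlinarith [norm_nonneg (P (P f)), norm_nonneg (P f), sq_nonneg (‖P (P f)‖ - ‖P f‖)]
  rw [map_sub, inner_sub_left, inner_sub_right, inner_sub_right, h1, real_inner_self_eq_norm_sq]
  linarith

/-- Iterating `1 - P` under a gap inequality along the orbit stays close to the start and makes the
energy small. -/
theorem iterate_gap {P : W →ₗ[ℝ] W} (hP : P.IsSymmetric)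
    (hP1 : ∀ w, ‖P w‖ ^ 2 ≤ inner ℝ (P w) w) {ε η : ℝ} (hε : 0 < ε) (f : W)
    (hgap : ∀ j : ℕ, ε * inner ℝ (P (((1 - P) ^ j : Module.End ℝ W) f))
      (((1 - P) ^ j : Module.End ℝ W) f) ≤ ‖P (((1 - P) ^ j : Module.End ℝ W) f)‖ ^ 2 + η)
    (l : ℕ) :
    ‖f - ((1 - P) ^ (2 * l) : Module.End ℝ W) f‖ ^ 2 ≤ 2 / ε * (inner ℝ (P f) f + l * η) ∧
    l * inner ℝ (P (((1 - P) ^ (2 * l) : Module.End ℝ W) f))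
      (((1 - P) ^ (2 * l) : Module.End ℝ W) f) ≤ (inner ℝ (P f) f + l * η) / ε := by
  set M : Module.End ℝ W := 1 - P with hM
  set g : ℕ → W := fun j => (M ^ j) f with hg
  set e : ℕ → ℝ := fun j => inner ℝ (P (g j)) (g j) with he
  have hg0 : g 0 = f := by simp [hg]
  have hsucc : ∀ j, g (j + 1) = g j - P (g j) := fun j => by
    simp [hg, pow_succ', hM]
  have he0 : ∀ j, 0 ≤ e j := fun j => (sq_nonneg _).trans (hP1 _)
  have hstep : ∀ j, e (j + 1) ≤ e j - ‖P (g j)‖ ^ 2 := fun j => by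
    simp only [he, hsucc]; exact inner_iterate_step hP hP1 _
  -- The gap bounds the energy by `‖P g‖² + η`, and `‖P g‖²` is at most the energy lost in this
  -- step; the sum over `j` then telescopes.
  have hgap' : ∀ j, ε * e j ≤ e j - e (j + 1) + η := fun j => by
    have := hgap j
    have := hstep j
    simp only [he, hg] at *
    linarith
  have hanti : Antitone e := antitone_nat_of_succ_le fun j => by
    nlinarith [hstep j, sq_nonneg ‖P (g j)‖]
  have hsum : ∀ l : ℕ, ε * ∑ j ∈ Finset.range l, e j ≤ e 0 - e l + l * η := by
    intro l
    induction l with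
    | zero => simp
    | succ l ih =>
      rw [Finset.sum_range_succ]; push_cast; linarith [hgap' l]
  have hnorm : ∀ j, ‖g (j + 1)‖ ^ 2 = ‖g j‖ ^ 2 - 2 * e j + ‖P (g j)‖ ^ 2 := fun j => by
    rw [hsucc, norm_sub_sq_real, real_inner_comm]
  have hnanti : Antitone fun j => ‖g j‖ ^ 2 := antitone_nat_of_succ_le fun j => by
    have := hP1 (g j)
    have := hnorm j
    have := he0 j
    simp only [he] at *
    linarith
  have hnsum : ∀ l : ℕ, ‖f‖ ^ 2 - ‖g l‖ ^ 2 ≤ 2 * ∑ j ∈ Finset.range l, e j := by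
    intro l
    induction l with
    | zero => simp [hg0]
    | succ l ih =>
      rw [Finset.sum_range_succ]
      nlinarith [hnorm l, sq_nonneg ‖P (g l)‖]
  have hMsymm : ∀ j : ℕ, ∀ a b : W, inner ℝ ((M ^ j) a) b = inner ℝ a ((M ^ j) b) := by
    have h1 : ∀ a b : W, inner ℝ (M a) b = inner ℝ a (M b) := fun a b => by
      simp [hM, inner_sub_left, inner_sub_right, hP a b]
    intro j
    induction j with
    | zero => simp
    | succ j ih =>
      intro a b
      rw [pow_succ, Module.End.mul_apply, ih, h1, ← Module.End.mul_apply, ← pow_succ', pow_succ]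
  have hS : ∑ j ∈ Finset.range l, e j ≤ (e 0 + l * η) / ε := by
    rw [le_div_iff₀ hε]; nlinarith [hsum l, he0 l]
  -- The reason for taking `2l` steps: `‖f - g (2l)‖² = ‖f‖² - 2‖g l‖² + ‖g (2l)‖² ≤ ‖f‖² - ‖g l‖²`,
  -- which is linear in the accumulated energy. A triangle inequality along the orbit would not give
  -- this.
  have hfl : inner ℝ f (g (2 * l)) = ‖g l‖ ^ 2 := by
    have : g (2 * l) = (M ^ l) (g l) := by
      simp only [hg]; rw [two_mul, pow_add, Module.End.mul_apply]
    rw [this, ← hMsymm, real_inner_self_eq_norm_sq]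
  have hee : e 0 = inner ℝ (P f) f := by simp only [he, hg0]
  rw [← hee]
  constructor
  · change ‖f - g (2 * l)‖ ^ 2 ≤ _
    rw [norm_sub_sq_real, hfl]
    have h1 := hnanti (show l ≤ 2 * l by omega)
    have h2 := hnsum l
    have : 2 / ε * (e 0 + l * η) = 2 * ((e 0 + l * η) / ε) := by ring
    rw [this]
    simp only at h1
    linarith
  · change l * e (2 * l) ≤ _
    refine le_trans ?_ hS
    calc (l : ℝ) * e (2 * l) = ∑ _j ∈ Finset.range l, e (2 * l) := by simp
      _ ≤ _ := Finset.sum_le_sum fun j hj => hanti (by rw [Finset.mem_range] at hj; omega)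

end Iteration

/-! ### Diffusion of functions on a graph -/

namespace SimpleGraph

section Laplacian

variable {V : Type u} [Fintype V] {E : Type*} [NormedAddCommGroup E] [InnerProductSpace ℝ E]

theorem sum_sum_nbrs_comm (G : SimpleGraph V) {M : Type*} [AddCommMonoid M] (h : V → V → M) :
    ∑ x, ∑ y ∈ G.nbrs x, h x y = ∑ x, ∑ y ∈ G.nbrs x, h y x := by
  classical
  have : ∀ h : V → V → M, ∑ x, ∑ y ∈ G.nbrs x, h x y =
      ∑ x, ∑ y, if G.Adj x y then h x y else 0 := fun h => by
    refine Finset.sum_congr rfl fun x _ => ?_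
    rw [← Finset.sum_filter]
    exact Finset.sum_congr (by ext; simp [mem_nbrs]) fun _ _ => rfl
  rw [this, this, Finset.sum_comm]
  refine Finset.sum_congr rfl fun x _ => Finset.sum_congr rfl fun y _ => ?_
  simp only [G.adj_comm]

theorem two_mul_sum_inner_laplacian (G : SimpleGraph V) (f g : V → E) :
    2 * ∑ x, inner ℝ (G.laplacian f x) (g x) =
      ∑ x, ∑ y ∈ G.nbrs x, inner ℝ (f x - f y) (g x - g y) := by
  have h1 : ∑ x, inner ℝ (G.laplacian f x) (g x) =
      ∑ x, ∑ y ∈ G.nbrs x, inner ℝ (f x - f y) (g x) :=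
    Finset.sum_congr rfl fun x _ => by rw [laplacian, sum_inner]
  have h2 : ∑ x, ∑ y ∈ G.nbrs x, inner ℝ (f x - f y) (g y) =
      - ∑ x, inner ℝ (G.laplacian f x) (g x) := by
    rw [sum_sum_nbrs_comm, h1, ← Finset.sum_neg_distrib]
    refine Finset.sum_congr rfl fun x _ => ?_
    rw [← Finset.sum_neg_distrib]
    refine Finset.sum_congr rfl fun y _ => ?_
    rw [← inner_neg_left, neg_sub]
  simp_rw [inner_sub_right, Finset.sum_sub_distrib]
  rw [h2, ← h1]; ring

theorem sum_inner_laplacian_comm (G : SimpleGraph V) (f g : V → E) :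
    ∑ x, inner ℝ (G.laplacian f x) (g x) = ∑ x, inner ℝ (f x) (G.laplacian g x) := by
  have h1 := two_mul_sum_inner_laplacian G f g
  have h2 := two_mul_sum_inner_laplacian G g f
  have h3 : ∀ x, inner ℝ (f x) (G.laplacian g x) = inner ℝ (G.laplacian g x) (f x) := fun x =>
    real_inner_comm _ _
  simp_rw [h3]
  have h4 : ∑ x, ∑ y ∈ G.nbrs x, inner ℝ (f x - f y) (g x - g y) =
      ∑ x, ∑ y ∈ G.nbrs x, inner ℝ (g x - g y) (f x - f y) :=
    Finset.sum_congr rfl fun x _ => Finset.sum_congr rfl fun y _ => real_inner_comm _ _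
  linarith

/-- Cauchy–Schwarz over at most `D` neighbors, followed by summation by parts. It makes `P = L /
(2D)` satisfy `P² ≤ P`. -/
theorem sum_norm_laplacian_sq_le (G : SimpleGraph V) {D : ℕ} (hD : ∀ x, (G.nbrs x).card ≤ D)
    (f : V → E) :
    ∑ x, ‖G.laplacian f x‖ ^ 2 ≤ 2 * D * ∑ x, inner ℝ (G.laplacian f x) (f x) := by
  have h := two_mul_sum_inner_laplacian G f f
  simp_rw [real_inner_self_eq_norm_sq] at h
  rw [show (2 * D * ∑ x, inner ℝ (G.laplacian f x) (f x) : ℝ) =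
    D * (2 * ∑ x, inner ℝ (G.laplacian f x) (f x)) by ring, h, Finset.mul_sum]
  refine Finset.sum_le_sum fun x _ => ?_
  calc ‖G.laplacian f x‖ ^ 2 ≤ (∑ y ∈ G.nbrs x, ‖f x - f y‖) ^ 2 := by
        gcongr; exact norm_sum_le _ _
    _ ≤ (G.nbrs x).card * ∑ y ∈ G.nbrs x, ‖f x - f y‖ ^ 2 := sq_sum_le_card_mul_sum_sq
    _ ≤ _ := by
        gcongr
        exact_mod_cast hD x

/-- One diffusion step is a convex combination of the values at `x` and at its neighbors. Thus all
iterates stay in the unit ball, where the approximate gap inequality is available. -/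
theorem norm_sub_smul_laplacian_le (G : SimpleGraph V) {D : ℕ} (hD0 : 0 < D)
    (hD : ∀ x, (G.nbrs x).card ≤ D) (f : V → E) (hf : ∀ x, ‖f x‖ ≤ 1) (x : V) :
    ‖f x - (2 * D : ℝ)⁻¹ • G.laplacian f x‖ ≤ 1 := by
  have hk : ((G.nbrs x).card : ℝ) ≤ D := by exact_mod_cast hD x
  have hDr : (0 : ℝ) < D := by exact_mod_cast hD0
  have e : f x - (2 * D : ℝ)⁻¹ • G.laplacian f x =
      (1 - (2 * D : ℝ)⁻¹ * (G.nbrs x).card) • f x + (2 * D : ℝ)⁻¹ • ∑ y ∈ G.nbrs x, f y := by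
    rw [laplacian, Finset.sum_sub_distrib, Finset.sum_const, ← Nat.cast_smul_eq_nsmul ℝ]
    module
  have h0 : 0 ≤ 1 - (2 * D : ℝ)⁻¹ * (G.nbrs x).card := by
    have : (2 * D : ℝ)⁻¹ * (G.nbrs x).card ≤ 1 := by
      rw [inv_mul_le_iff₀ (by positivity)]; linarith
    linarith
  have h1 : ‖∑ y ∈ G.nbrs x, f y‖ ≤ (G.nbrs x).card :=
    (norm_sum_le_of_le _ fun y _ => hf y).trans (by simp)
  rw [e]
  refine (norm_add_le _ _).trans ?_
  rw [norm_smul, norm_smul, Real.norm_of_nonneg h0, Real.norm_of_nonneg (by positivity)]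
  have h2 : (1 - (2 * D : ℝ)⁻¹ * (G.nbrs x).card) * ‖f x‖ ≤
      (1 - (2 * D : ℝ)⁻¹ * (G.nbrs x).card) * 1 := by gcongr; exact hf x
  have h3 : (2 * D : ℝ)⁻¹ * ‖∑ y ∈ G.nbrs x, f y‖ ≤ (2 * D : ℝ)⁻¹ * (G.nbrs x).card := by gcongr
  linarith

/-- Diffusing `f` under an approximate spectral gap inequality. -/
theorem exists_diffusion (G : SimpleGraph V) {D : ℕ} (hD0 : 0 < D)
    (hD : ∀ x, (G.nbrs x).card ≤ D) {ε η : ℝ} (hε : 0 < ε)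
    (hgap : ∀ f : V → E, (∀ x, ‖f x‖ ≤ 1) → ε * ∑ x, ∑ y ∈ G.nbrs x, ‖f x - f y‖ ^ 2 ≤
      ∑ x, ‖G.laplacian f x‖ ^ 2 + η) (f : V → E) (hf : ∀ x, ‖f x‖ ≤ 1) (l : ℕ) :
    ∃ g : V → E, (∀ x, ‖g x‖ ≤ 1) ∧
      ∑ x, ‖f x - g x‖ ^ 2 ≤ 1 / (2 * ε) * (∑ x, ∑ y ∈ G.nbrs x, ‖f x - f y‖ ^ 2 + l * η) ∧
      l * ∑ x, ∑ y ∈ G.nbrs x, ‖g x - g y‖ ^ 2 ≤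
        D / ε * (∑ x, ∑ y ∈ G.nbrs x, ‖f x - f y‖ ^ 2 + l * η) := by
  have hDr : (1 : ℝ) ≤ D := by exact_mod_cast hD0
  have hDp : (0 : ℝ) < D := by linarith
  let P : PiLp 2 (fun _ : V => E) →ₗ[ℝ] PiLp 2 (fun _ : V => E) :=
    { toFun := fun w => WithLp.toLp 2 fun x => (2 * D : ℝ)⁻¹ • G.laplacian w x
      map_add' := fun a b => by
        ext x
        simp only [laplacian, PiLp.add_apply, ← smul_add, ← Finset.sum_add_distrib]
        congr 1
        exact Finset.sum_congr rfl fun y _ => by abel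
      map_smul' := fun c a => by
        ext x
        simp only [laplacian, PiLp.smul_apply, RingHom.id_apply, ← smul_sub, ← Finset.smul_sum]
        rw [smul_comm] }
  have hPa : ∀ w x, P w x = (2 * D : ℝ)⁻¹ • G.laplacian w x := fun w x => rfl
  have hPin : ∀ a b, inner ℝ (P a) b =
      (2 * D : ℝ)⁻¹ * ∑ x, inner ℝ (G.laplacian a x) (b x) := fun a b => by
    rw [PiLp.inner_apply, Finset.mul_sum]
    exact Finset.sum_congr rfl fun x _ => by rw [hPa, inner_smul_left]; simp
  have hPnorm : ∀ w, ‖P w‖ ^ 2 = (2 * D : ℝ)⁻¹ ^ 2 * ∑ x, ‖G.laplacian w x‖ ^ 2 := fun w => by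
    rw [PiLp.norm_sq_eq_of_L2, Finset.mul_sum]
    refine Finset.sum_congr rfl fun x _ => ?_
    rw [hPa, norm_smul, mul_pow, Real.norm_of_nonneg (by positivity)]
  have hP : P.IsSymmetric := fun a b => by
    rw [real_inner_comm (P b) a, hPin, hPin, sum_inner_laplacian_comm]
    congr 1
    exact Finset.sum_congr rfl fun x _ => real_inner_comm _ _
  have hP1 : ∀ w, ‖P w‖ ^ 2 ≤ inner ℝ (P w) w := fun w => by
    rw [hPin, hPnorm]
    have := sum_norm_laplacian_sq_le G hD w
    calc (2 * D : ℝ)⁻¹ ^ 2 * ∑ x, ‖G.laplacian w x‖ ^ 2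
        ≤ (2 * D : ℝ)⁻¹ ^ 2 * (2 * D * ∑ x, inner ℝ (G.laplacian w x) (w x)) := by gcongr
      _ = _ := by field_simp
  have hEne : ∀ w : PiLp 2 (fun _ : V => E), inner ℝ (P w) w =
      (4 * D : ℝ)⁻¹ * ∑ x, ∑ y ∈ G.nbrs x, ‖w x - w y‖ ^ 2 := fun w => by
    have h := two_mul_sum_inner_laplacian G w w
    simp_rw [real_inner_self_eq_norm_sq] at h
    rw [hPin, ← h]
    field_simp
    ring
  set w : PiLp 2 (fun _ : V => E) := WithLp.toLp 2 f with hw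
  have hwf : ∀ x, w x = f x := fun x => rfl
  have hball : ∀ j : ℕ, ∀ x, ‖(((1 - P) ^ j : Module.End ℝ _) w) x‖ ≤ 1 := by
    intro j
    induction j with
    | zero => simpa using hf
    | succ j ih =>
      intro x
      rw [pow_succ', Module.End.mul_apply, LinearMap.sub_apply, Module.End.one_apply,
        PiLp.sub_apply, hPa]
      exact norm_sub_smul_laplacian_le G hD0 hD _ ih x
  -- With `P = L / (2D)`, `⟪P w, w⟫` is the energy over `4D` and `‖P w‖²` is `‖L w‖²` over `4D²`;
  -- this determines the rescaled gap and error.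
  obtain ⟨h1, h2⟩ := iterate_gap hP hP1 (ε := ε / D) (η := η / (4 * D ^ 2)) (by positivity) w
    (fun j => by
      have := hgap _ (hball j)
      rw [hEne, hPnorm]
      have h3 := mul_le_mul_of_nonneg_left this (show (0 : ℝ) ≤ (2 * D : ℝ)⁻¹ ^ 2 by positivity)
      refine le_trans (le_of_eq ?_) (h3.trans (le_of_eq ?_))
      · field_simp; ring
      · field_simp; ring) l
  rw [hEne, hEne] at h2
  rw [hEne, PiLp.norm_sq_eq_of_L2] at h1
  -- Nonnegativity of `η` comes from the gap inequality at the zero function.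
  have hη : 0 ≤ (l : ℝ) * η := by
    have h := hgap 0 (by simp)
    have : (0 : ℝ) ≤ η := by simpa [laplacian] using h
    positivity
  have hηD : l * η / D ≤ l * η := div_le_self hη hDr
  refine ⟨fun x => (((1 - P) ^ (2 * l) : Module.End ℝ _) w) x, hball _, ?_, ?_⟩
  · refine h1.trans ?_
    calc 2 / (ε / D) * ((4 * D : ℝ)⁻¹ * ∑ x, ∑ y ∈ G.nbrs x, ‖w x - w y‖ ^ 2 +
          l * (η / (4 * D ^ 2)))
        = 1 / (2 * ε) * (∑ x, ∑ y ∈ G.nbrs x, ‖f x - f y‖ ^ 2 + l * η / D) := by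
          simp only [hwf]; field_simp; ring
      _ ≤ _ := by gcongr
  · have h3 := mul_le_mul_of_nonneg_left h2 (show (0 : ℝ) ≤ 4 * D by positivity)
    calc _ = 4 * D * (l * ((4 * D : ℝ)⁻¹ * ∑ x, ∑ y ∈ G.nbrs x,
            ‖(((1 - P) ^ (2 * l) : Module.End ℝ _) w) x -
              (((1 - P) ^ (2 * l) : Module.End ℝ _) w) y‖ ^ 2)) := by field_simp
      _ ≤ _ := h3
      _ = D / ε * (∑ x, ∑ y ∈ G.nbrs x, ‖f x - f y‖ ^ 2 + l * η / D) := by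
          simp only [hwf]; field_simp
      _ ≤ _ := by gcongr

end Laplacian

/-! ### Edge cuts, and rounding of functions to sets -/

section Cut

variable {V : Type u}

/-- The number of edges from `A` to `B`. -/
noncomputable def cut (G : SimpleGraph V) (A B : Finset V) : ℕ :=
  open Classical in ((A ×ˢ B).filter fun p => G.Adj p.1 p.2).card

theorem cut_eq_sum (G : SimpleGraph V) (A B : Finset V) :
    G.cut A B = ∑ x ∈ A, open Classical in (B.filter fun y => G.Adj x y).card := by
  classical
  rw [cut, Finset.card_eq_sum_card_fiberwise (f := Prod.fst) (t := A)]
  · refine Finset.sum_congr rfl fun x hx => ?_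
    refine Finset.card_bij (fun p _ => p.2) ?_ ?_ ?_
    · rintro ⟨a, b⟩ h
      simp only [Finset.mem_filter, Finset.mem_product] at h ⊢
      obtain ⟨⟨⟨_, hb⟩, hab⟩, rfl⟩ := h
      exact ⟨hb, hab⟩
    · rintro ⟨a, b⟩ h ⟨a', b'⟩ h' e
      simp only [Finset.mem_filter, Finset.mem_product] at h h' e
      rw [h.2, h'.2, e]
    · intro b hb
      simp only [Finset.mem_filter] at hb
      exact ⟨(x, b), by simp [hx, hb.1, hb.2], rfl⟩
  · intro p hp
    simp only [Finset.coe_filter, Finset.mem_product, Set.mem_ofPred_eq] at hp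
    exact hp.1.1

theorem cut_mono {G H : SimpleGraph V} {A B A' B' : Finset V} (h : ∀ x ∈ A, ∀ y ∈ B, G.Adj x y →
    H.Adj x y) (hA : A ⊆ A') (hB : B ⊆ B') : G.cut A B ≤ H.cut A' B' := by
  refine Finset.card_le_card fun p hp => ?_
  simp only [Finset.mem_filter, Finset.mem_product] at hp ⊢
  exact ⟨⟨hA hp.1.1, hB hp.1.2⟩, h _ hp.1.1 _ hp.1.2 hp.2⟩

theorem cut_mono_right (G : SimpleGraph V) (A : Finset V) {B B' : Finset V} (hB : B ⊆ B') :
    G.cut A B ≤ G.cut A B' := cut_mono (fun _ _ _ _ h => h) subset_rfl hB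

theorem cut_mono_left (G : SimpleGraph V) (B : Finset V) {A A' : Finset V} (hA : A ⊆ A') :
    G.cut A B ≤ G.cut A' B := cut_mono (fun _ _ _ _ h => h) hA subset_rfl

theorem cut_comm (G : SimpleGraph V) (A B : Finset V) : G.cut A B = G.cut B A := by
  refine Finset.card_bij (fun p _ => p.swap) ?_ ?_ ?_
  · rintro ⟨a, b⟩ h
    simp only [Finset.mem_filter, Finset.mem_product, Prod.swap] at h ⊢
    exact ⟨h.1.symm, h.2.symm⟩
  · intro p _ q _ h
    exact Prod.swap_injective h
  · rintro ⟨a, b⟩ h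
    simp only [Finset.mem_filter, Finset.mem_product] at h
    exact ⟨(b, a), by simp [h.1.1, h.1.2, h.2.symm], rfl⟩

theorem cut_le_mul [Fintype V] (G : SimpleGraph V) {D : ℕ} (A B : Finset V)
    (hD : ∀ x ∈ A, (G.nbrs x).card ≤ D) : G.cut A B ≤ A.card * D := by
  classical
  rw [cut_eq_sum, ← smul_eq_mul]
  refine Finset.sum_le_card_nsmul _ _ _ fun x hx => le_trans (Finset.card_le_card ?_) (hD x hx)
  intro y hy
  rw [Finset.mem_filter] at hy
  exact mem_nbrs.mpr hy.2

theorem cut_union_right_le [DecidableEq V] (G : SimpleGraph V) (A B B' : Finset V) :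
    G.cut A (B ∪ B') ≤ G.cut A B + G.cut A B' := by
  unfold cut
  refine le_trans (Finset.card_le_card ?_) (Finset.card_union_le _ _)
  intro p hp
  simp only [Finset.mem_filter, Finset.mem_product, Finset.mem_union] at hp ⊢
  tauto

theorem cut_union_left_le [DecidableEq V] (G : SimpleGraph V) (A A' B : Finset V) :
    G.cut (A ∪ A') B ≤ G.cut A B + G.cut A' B := by
  rw [cut_comm, cut_comm G A, cut_comm G A']
  exact cut_union_right_le G _ _ _

variable [Fintype V]

/-- Rounding a vector valued function with small energy to disjoint sets with small boundary. -/
theorem exists_rounding [DecidableEq V] (G : SimpleGraph V) {D : ℕ}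
    (hD : ∀ x, (G.nbrs x).card ≤ D) {m : ℕ}
    (F : Fin m → Finset V) (f g : V → EuclideanSpace ℝ (Fin m))
    (hf : ∀ x i, f x i = if x ∈ F i then 1 else 0) (hg : ∀ x, ‖g x‖ ≤ 1) {K : ℕ} (hK : 0 < K) :
    ∃ F' : Fin m → Finset V,
      (∑ i, ((symmDiff (F i) (F' i)).card : ℝ)) ≤ 64 * ∑ x, ‖f x - g x‖ ^ 2 ∧
      (∑ i, (G.cut (F' i) (F' i)ᶜ : ℝ)) ≤
        (16 * K) ^ 2 * ∑ x, ∑ y ∈ G.nbrs x, ‖g x - g y‖ ^ 2 + D * Fintype.card V / K := by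
  classical
  have hKr : (0 : ℝ) < K := by exact_mod_cast hK
  set δ : ℝ := 1 / (16 * K) with hδ
  have hδ0 : 0 < δ := by positivity
  have hδK : δ * K = 1 / 16 := by rw [hδ]; field_simp
  -- Two coordinates above `3/4` would give squared norm at least `9/8`.
  have huniq : ∀ x i j, 3 / 4 < g x i → 3 / 4 < g x j → i = j := by
    intro x i j hi hj
    by_contra hij
    have h1 : ‖g x‖ ^ 2 ≤ 1 := pow_le_one₀ (norm_nonneg _) (hg x)
    rw [EuclideanSpace.norm_sq_eq] at h1
    have h2 : ∑ k ∈ ({i, j} : Finset (Fin m)), ‖g x k‖ ^ 2 ≤ ∑ k, ‖g x k‖ ^ 2 :=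
      Finset.sum_le_sum_of_subset_of_nonneg (Finset.subset_univ _) fun _ _ _ => by positivity
    rw [Finset.sum_pair hij] at h2
    simp only [Real.norm_eq_abs, sq_abs] at h1 h2
    nlinarith
  set t : ℕ → ℝ := fun j => 3 / 4 + j * δ with ht
  have htle : ∀ j < K, t j + δ ≤ 7 / 8 := by
    intro j hj
    have : ((j : ℝ) + 1) ≤ K := by exact_mod_cast hj
    simp only [ht]
    nlinarith
  let band : ℕ → Finset (V × Fin m) := fun j =>
    Finset.univ.filter fun p => t j < g p.1 p.2 ∧ g p.1 p.2 ≤ t j + δ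
  -- The `K` bands of width `δ` above `3/4` are disjoint, and by `huniq` each vertex lies in at most
  -- one of them, with one coordinate; some band has at most the average size.
  have hband : ∃ j < K, ((band j).card : ℝ) ≤ Fintype.card V / K := by
    have hdisj : ∀ j ∈ Finset.range K, ∀ k ∈ Finset.range K, j ≠ k →
        Disjoint (band j) (band k) := by
      intro j _ k _ hjk
      rw [Finset.disjoint_left]
      intro p hp hp'
      simp only [band, Finset.mem_filter, Finset.mem_univ, true_and, ht] at hp hp'
      rcases lt_or_gt_of_ne hjk with h | h
      · have : ((j : ℝ) + 1) ≤ k := by exact_mod_cast h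
        nlinarith
      · have : ((k : ℝ) + 1) ≤ j := by exact_mod_cast h
        nlinarith
    have hcard : ∑ j ∈ Finset.range K, (band j).card ≤ Fintype.card V := by
      rw [← Finset.card_biUnion hdisj, ← Finset.card_univ]
      refine Finset.card_le_card_of_injOn Prod.fst (fun _ _ => Finset.mem_univ _) ?_
      have hbd : ∀ p ∈ (Finset.range K).biUnion band, 3 / 4 < g p.1 p.2 := by
        intro p hp
        rw [Finset.mem_biUnion] at hp
        obtain ⟨j, -, hp⟩ := hp
        simp only [band, Finset.mem_filter, Finset.mem_univ, true_and, ht] at hp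
        have : (0 : ℝ) ≤ j * δ := by positivity
        linarith
      rintro ⟨x, i⟩ hp ⟨y, j⟩ hq h
      simp only at h
      subst h
      rw [huniq x i j (hbd _ hp) (hbd _ hq)]
    obtain ⟨j, hj, hle⟩ := Finset.exists_le_of_sum_le (s := Finset.range K)
      (f := fun j => ((band j).card : ℝ)) (g := fun _ => (Fintype.card V : ℝ) / K) ⟨0, by simpa⟩ (by
        rw [Finset.sum_const, Finset.card_range, nsmul_eq_mul, mul_div_cancel₀ _ hKr.ne']
        exact_mod_cast hcard)
    exact ⟨j, Finset.mem_range.mp hj, hle⟩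
  obtain ⟨j, hj, hjle⟩ := hband
  have hj1 : 3 / 4 ≤ t j := by simp only [ht]; have : (0 : ℝ) ≤ j * δ := by positivity
                               linarith
  have hj2 := htle j hj
  have hnorm : ∀ a b : EuclideanSpace ℝ (Fin m), ‖a - b‖ ^ 2 = ∑ i, (a i - b i) ^ 2 := fun a b => by
    rw [EuclideanSpace.norm_sq_eq]
    simp
  refine ⟨fun i => Finset.univ.filter fun x => t j < g x i, ?_, ?_⟩
  · simp_rw [hnorm]
    rw [Finset.sum_comm, Finset.mul_sum]
    refine Finset.sum_le_sum fun i _ => ?_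
    rw [Finset.card_eq_sum_ones, Nat.cast_sum, Finset.mul_sum]
    refine (Finset.sum_le_sum fun x hx => ?_).trans (Finset.sum_le_sum_of_subset_of_nonneg
      (Finset.subset_univ _) fun x _ _ => by positivity)
    simp only [Finset.mem_symmDiff, Finset.mem_filter, Finset.mem_univ, true_and] at hx
    rw [hf]
    -- The threshold lies in `[3/4, 7/8)`, so a misplaced vertex changes the coordinate by at least
    -- `1/8`; hence the factor `64`.
    rcases hx with ⟨h1, h2⟩ | ⟨h1, h2⟩
    · rw [if_pos h1]; push_cast; nlinarith
    · rw [if_neg h2]; push_cast; nlinarith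
  -- An edge leaving the level set either starts in the band, with at most `D` edges per vertex
  -- there, or drops by at least `δ = 1 / (16K)` and is paid for by its energy.
  · have hcut : ∀ i, (G.cut (Finset.univ.filter fun x => t j < g x i)
        (Finset.univ.filter fun x => t j < g x i)ᶜ : ℝ) ≤
        (16 * K) ^ 2 * ∑ x, ∑ y ∈ G.nbrs x, (g x i - g y i) ^ 2 +
          D * ((band j).filter fun p => p.2 = i).card := by
      intro i
      rw [cut_eq_sum, Nat.cast_sum, Finset.sum_filter, Finset.mul_sum]
      have hbc : (((band j).filter fun p => p.2 = i).card : ℝ) =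
          ∑ x, if t j < g x i ∧ g x i ≤ t j + δ then 1 else 0 := by
        rw [Finset.sum_boole]
        congr 1
        refine Finset.card_bij (fun p _ => p.1) ?_ ?_ ?_
        · rintro ⟨x, k⟩ h
          simp only [band, Finset.mem_filter, Finset.mem_univ, true_and] at h ⊢
          obtain ⟨h, rfl⟩ := h
          exact h
        · rintro ⟨x, k⟩ h ⟨x', k'⟩ h' e
          simp only [Finset.mem_filter] at h h' e
          rw [e, h.2, h'.2]
        · intro x h
          simp only [Finset.mem_filter, Finset.mem_univ, true_and] at h
          exact ⟨(x, i), by simpa [band] using h, rfl⟩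
      rw [hbc, Finset.mul_sum, ← Finset.sum_add_distrib]
      refine Finset.sum_le_sum fun x _ => ?_
      have hnn : (0 : ℝ) ≤ (16 * K) ^ 2 * ∑ y ∈ G.nbrs x, (g x i - g y i) ^ 2 :=
        mul_nonneg (by positivity) (Finset.sum_nonneg fun _ _ => sq_nonneg _)
      by_cases h1 : t j < g x i
      · rw [if_pos h1]
        by_cases h2 : g x i ≤ t j + δ
        · rw [if_pos ⟨h1, h2⟩]
          have : (((Finset.univ.filter fun x => t j < g x i)ᶜ.filter fun y => G.Adj x y).card : ℝ) ≤
              D := by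
            refine (Nat.cast_le.mpr (Finset.card_le_card ?_)).trans (Nat.cast_le.mpr (hD x))
            intro y hy
            rw [Finset.mem_filter] at hy
            exact mem_nbrs.mpr hy.2
          linarith
        · have h3 : (((Finset.univ.filter fun x => t j < g x i)ᶜ.filter
              fun y => G.Adj x y).card : ℝ) ≤
              (16 * K) ^ 2 * ∑ y ∈ G.nbrs x, (g x i - g y i) ^ 2 := by
            rw [Finset.card_eq_sum_ones, Nat.cast_sum, Finset.mul_sum]
            refine (Finset.sum_le_sum fun y hy => ?_).trans
              (Finset.sum_le_sum_of_subset_of_nonneg (s := (Finset.univ.filter fun x =>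
                t j < g x i)ᶜ.filter fun y => G.Adj x y) ?_ fun y _ _ => by positivity)
            · simp only [Finset.mem_filter, Finset.mem_compl, Finset.mem_univ, true_and,
                not_lt] at hy
              have h4 : δ ≤ g x i - g y i := by linarith [not_le.mp h2]
              have h5 : 1 = 16 * K * δ := by rw [hδ]; field_simp
              have h6 : 1 ≤ 16 * K * (g x i - g y i) := by
                rw [h5]; gcongr
              push_cast
              nlinarith
            · intro y hy
              rw [Finset.mem_filter] at hy
              exact mem_nbrs.mpr hy.2
          have : (0 : ℝ) ≤ D * if t j < g x i ∧ g x i ≤ t j + δ then 1 else 0 := by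
            split_ifs <;> simp
          linarith
      · rw [if_neg h1]
        have : (0 : ℝ) ≤ D * if t j < g x i ∧ g x i ≤ t j + δ then 1 else 0 := by
          split_ifs <;> simp
        push_cast
        linarith
    refine (Finset.sum_le_sum fun i _ => hcut i).trans ?_
    rw [Finset.sum_add_distrib, ← Finset.mul_sum, ← Finset.mul_sum]
    have e1 : ∑ i, ∑ x, ∑ y ∈ G.nbrs x, (g x i - g y i) ^ 2 =
        ∑ x, ∑ y ∈ G.nbrs x, ‖g x - g y‖ ^ 2 := by
      rw [Finset.sum_comm]
      refine Finset.sum_congr rfl fun x _ => ?_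
      rw [Finset.sum_comm]
      exact Finset.sum_congr rfl fun y _ => (hnorm _ _).symm
    have e2 : ∑ i, (((band j).filter fun p => p.2 = i).card : ℝ) = (band j).card := by
      rw [Finset.card_eq_sum_card_fiberwise (f := Prod.snd) (t := Finset.univ)
        fun _ _ => Finset.mem_coe.mpr (Finset.mem_univ _)]
      push_cast
      rfl
    rw [e1, e2, mul_div_assoc]
    gcongr

/-- The factor 2 arises because the energy runs over ordered pairs and sees a boundary edge from
both ends. -/
theorem sum_sum_nbrs_indicator [DecidableEq V] (G : SimpleGraph V) {m : ℕ}
    (F : Fin m → Finset V) (f : V → EuclideanSpace ℝ (Fin m))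
    (hf : ∀ x i, f x i = if x ∈ F i then 1 else 0) :
    ∑ x, ∑ y ∈ G.nbrs x, ‖f x - f y‖ ^ 2 = 2 * ∑ i, (G.cut (F i) (F i)ᶜ : ℝ) := by
  classical
  have hnorm : ∀ a b : EuclideanSpace ℝ (Fin m), ‖a - b‖ ^ 2 = ∑ i, (a i - b i) ^ 2 := fun a b => by
    rw [EuclideanSpace.norm_sq_eq]
    simp
  have hcut : ∀ i, (G.cut (F i) (F i)ᶜ : ℝ) =
      ∑ x, ∑ y ∈ G.nbrs x, if x ∈ F i ∧ y ∉ F i then 1 else 0 := by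
    intro i
    rw [cut_eq_sum, Nat.cast_sum, ← Finset.sum_filter_add_sum_filter_not Finset.univ (· ∈ F i)]
    rw [Finset.sum_eq_zero (s := Finset.univ.filter (· ∉ F i)), add_zero]
    · refine Finset.sum_congr (by ext; simp) fun x hx => ?_
      rw [Finset.sum_boole]
      congr 2
      ext y
      simp only [Finset.mem_filter, Finset.mem_compl, mem_nbrs]
      rw [Finset.mem_filter] at hx
      tauto
    · intro x hx
      rw [Finset.mem_filter] at hx
      exact Finset.sum_eq_zero fun y _ => by simp [hx.2]
  have hcut' : ∀ i, (G.cut (F i) (F i)ᶜ : ℝ) =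
      ∑ x, ∑ y ∈ G.nbrs x, if y ∈ F i ∧ x ∉ F i then 1 else 0 := fun i => by
    rw [hcut, sum_sum_nbrs_comm]
  rw [two_mul, ← Finset.sum_add_distrib]
  simp_rw [hnorm]
  calc ∑ x, ∑ y ∈ G.nbrs x, ∑ i, (f x i - f y i) ^ 2
      = ∑ i, ∑ x, ∑ y ∈ G.nbrs x, (f x i - f y i) ^ 2 := by
        rw [Finset.sum_comm]
        exact Finset.sum_congr rfl fun x _ => Finset.sum_comm
    _ = _ := by
        refine Finset.sum_congr rfl fun i _ => ?_
        nth_rewrite 1 [hcut]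
        rw [hcut', ← Finset.sum_add_distrib]
        refine Finset.sum_congr rfl fun x _ => ?_
        rw [← Finset.sum_add_distrib]
        refine Finset.sum_congr rfl fun y _ => ?_
        rw [hf, hf]
        by_cases h1 : x ∈ F i <;> by_cases h2 : y ∈ F i <;> simp [h1, h2]

end Cut

/-! ### Smoothing disjoint families of sets -/

section Smoothing

variable {Γ : Type v} [Group Γ] {X : SimpleGraph Γ} {A : Finset Γ} {V : ℕ → Type u}
  [∀ n, Fintype (V n)]

/-- In graphs converging locally to a Cayley graph of a group with Property (T), every disjoint
family of sets is close to a family of sets with few boundary edges, the distance being controlled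
by the number of boundary edges. -/
theorem exists_smoothing [Countable Γ] [Infinite Γ] (hT : HasKazhdanPropertyT Γ)
    (hX : ∀ u v, X.Adj u v ↔ u⁻¹ * v ∈ A) (hA : Subgroup.closure (A : Set Γ) = ⊤)
    (G : ∀ n, SimpleGraph (V n)) {D : ℕ} (hD0 : 0 < D) (hD : ∀ n x, ((G n).nbrs x).card ≤ D)
    (hne : ∀ᶠ n in atTop, 0 < Fintype.card (V n))
    (hbad : ∀ R, Tendsto (fun n => ((badVertices X (G n) R).card : ℝ) / Fintype.card (V n))
      atTop (𝓝 0)) [∀ n, DecidableEq (V n)] :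
    ∃ C : ℝ, 1 ≤ C ∧ ∀ η : ℝ, 0 < η → ∀ᶠ n in atTop, ∀ (m : ℕ) (F : Fin m → Finset (V n)),
      (∀ i j, i ≠ j → Disjoint (F i) (F j)) → ∃ F' : Fin m → Finset (V n),
        (∑ i, ((symmDiff (F i) (F' i)).card : ℝ)) ≤
          C * ∑ i, ((G n).cut (F i) (F i)ᶜ : ℝ) + η * Fintype.card (V n) ∧
        (∑ i, ((G n).cut (F' i) (F' i)ᶜ : ℝ)) ≤ η * Fintype.card (V n) := by
  obtain ⟨ε, hε, hgap⟩ := exists_laplacian_inequality hT hX hA G hD hne hbad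
  have hDr : (0 : ℝ) < D := by exact_mod_cast hD0
  refine ⟨max 1 (64 / ε), le_max_left _ _, fun η hη => ?_⟩
  -- Order of choices: `K` makes the band contribution at most half of `η`, then `l` makes the
  -- diffused energy small against `(16K)²`, and lastly the error `η'` in the gap is small against
  -- `1 / l`. The constant `64 / ε` is rounding (`64`) times diffusion (`1 / (2ε)`) times the factor
  -- 2 of the indicator energy; it depends on none of these choices.
  obtain ⟨K, hK⟩ := exists_nat_gt (2 * D / η)
  have hK0 : (0 : ℝ) < K := lt_trans (by positivity) hK
  have hKD : D / K ≤ η / 2 := by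
    rw [div_lt_iff₀ hη] at hK
    rw [div_le_div_iff₀ hK0 two_pos]; linarith
  set c : ℝ := (16 * K) ^ 2 * (D / ε) with hc
  have hc0 : 0 < c := by positivity
  obtain ⟨l, hl⟩ := exists_nat_gt (c * (2 * D + 1) / (η / 2))
  have hl0 : (0 : ℝ) < l := lt_of_le_of_lt (by positivity) hl
  rw [div_lt_iff₀ (by positivity)] at hl
  filter_upwards [hgap (min (1 / l) (min (ε * η / 32 / l) 1)) (by positivity)] with n hn
  intro m F hF
  set N : ℝ := (Fintype.card (V n) : ℝ) with hN
  have hN0 : 0 ≤ N := by positivity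
  set η' : ℝ := min (1 / l) (min (ε * η / 32 / l) 1) with hη'
  have hη1 : l * η' ≤ 1 := by
    have : η' ≤ 1 / l := min_le_left _ _
    rw [le_div_iff₀ hl0] at this; linarith
  have hη2 : l * η' ≤ ε * η / 32 := by
    have : η' ≤ ε * η / 32 / l := (min_le_right _ _).trans (min_le_left _ _)
    rw [le_div_iff₀ hl0] at this; linarith
  let f : V n → EuclideanSpace ℝ (Fin m) := fun x =>
    WithLp.toLp 2 fun i => if x ∈ F i then 1 else 0
  have hf : ∀ x i, f x i = if x ∈ F i then 1 else 0 := fun x i => rfl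
  have hf1 : ∀ x, ‖f x‖ ≤ 1 := by
    intro x
    have h : ‖f x‖ ^ 2 ≤ 1 := by
      rw [EuclideanSpace.norm_sq_eq]
      simp only [hf]
      have : ∀ i, ‖(if x ∈ F i then 1 else 0 : ℝ)‖ ^ 2 = if x ∈ F i then 1 else 0 := fun i => by
        split_ifs <;> simp
      simp only [this]
      rw [Finset.sum_boole]
      have : (Finset.univ.filter fun i => x ∈ F i).card ≤ 1 := by
        rw [Finset.card_le_one]
        intro i hi j hj
        rw [Finset.mem_filter] at hi hj
        by_contra hij
        exact Finset.disjoint_left.mp (hF i j hij) hi.2 hj.2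
      exact_mod_cast this
    exact (sq_le_one_iff₀ (norm_nonneg _)).mp h
  obtain ⟨g, hg1, hg2, hg3⟩ := exists_diffusion (G n) hD0 (hD n) hε (hn m) f hf1 l
  obtain ⟨F', h1, h2⟩ := exists_rounding (G n) (hD n) F f g hf hg1 (K := K) (by exact_mod_cast hK0)
  have hene := sum_sum_nbrs_indicator (G n) F f hf
  have hsum : ∑ i, ((G n).cut (F i) (F i)ᶜ : ℝ) ≤ D * N := by
    have h3 : ∀ i, ((G n).cut (F i) (F i)ᶜ : ℝ) ≤ (F i).card * D := fun i => by
      exact_mod_cast cut_le_mul (G n) _ _ fun x _ => hD n x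
    have h4 : ∑ i, ((F i).card : ℝ) ≤ N := by
      rw [← Nat.cast_sum, ← Finset.card_biUnion fun i _ j _ h => hF i j h]
      exact Nat.cast_le.mpr (Finset.card_le_univ _)
    calc _ ≤ ∑ i, ((F i).card : ℝ) * D := Finset.sum_le_sum fun i _ => h3 i
      _ = (∑ i, ((F i).card : ℝ)) * D := by rw [Finset.sum_mul]
      _ ≤ N * D := by gcongr
      _ = D * N := mul_comm _ _
  have hsum0 : 0 ≤ ∑ i, ((G n).cut (F i) (F i)ᶜ : ℝ) := Finset.sum_nonneg fun _ _ => by positivity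
  rw [hene] at hg2 hg3
  refine ⟨F', h1.trans ?_, h2.trans ?_⟩
  · calc 64 * ∑ x, ‖f x - g x‖ ^ 2
        ≤ 64 * (1 / (2 * ε) * (2 * ∑ i, ((G n).cut (F i) (F i)ᶜ : ℝ) + l * (η' * N))) := by gcongr
      _ = 64 / ε * ∑ i, ((G n).cut (F i) (F i)ᶜ : ℝ) + 32 / ε * (l * η') * N := by
          field_simp; ring
      _ ≤ max 1 (64 / ε) * ∑ i, ((G n).cut (F i) (F i)ᶜ : ℝ) + 32 / ε * (ε * η / 32) * N := by
          gcongr; exact le_max_right _ _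
      _ = _ := by field_simp
  · have h5 : l * ∑ x, ∑ y ∈ (G n).nbrs x, ‖g x - g y‖ ^ 2 ≤ D / ε * ((2 * D + 1) * N) := by
      refine hg3.trans ?_
      gcongr
      nlinarith
    have h6 : (16 * K) ^ 2 * ∑ x, ∑ y ∈ (G n).nbrs x, ‖g x - g y‖ ^ 2 ≤ η / 2 * N := by
      rw [← mul_le_mul_iff_right₀ hl0]
      calc l * ((16 * K) ^ 2 * ∑ x, ∑ y ∈ (G n).nbrs x, ‖g x - g y‖ ^ 2)
          = (16 * K) ^ 2 * (l * ∑ x, ∑ y ∈ (G n).nbrs x, ‖g x - g y‖ ^ 2) := by ring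
        _ ≤ (16 * K) ^ 2 * (D / ε * ((2 * D + 1) * N)) := by gcongr
        _ = c * (2 * D + 1) * N := by rw [hc]; ring
        _ ≤ (l * (η / 2)) * N := by gcongr
        _ = _ := by ring
    have h7 : D * N / K ≤ η / 2 * N := by
      calc D * N / K = D / K * N := by ring
        _ ≤ _ := by gcongr
    linarith

end Smoothing

end SimpleGraph

/-! ### Greedy partition into pieces and removal of sparse subsets -/

namespace SimpleGraph

section Partition

variable {V : Type u}

@[simp] theorem cut_empty_left (G : SimpleGraph V) (B : Finset V) : G.cut ∅ B = 0 := by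
  simp [cut]

@[simp] theorem cut_empty_right (G : SimpleGraph V) (B : Finset V) : G.cut B ∅ = 0 := by
  simp [cut]

variable [DecidableEq V]

/-- Successively removing smallest sets with at most `θ` boundary edges per vertex. -/
theorem exists_greedy_coloring (G : SimpleGraph V) {θ : ℝ} (hθ : 0 ≤ θ) (U : Finset V) :
    ∃ c : V → ℕ, ∀ i,
      (G.cut (U.filter fun x => c x = i) (U.filter fun x => i < c x) : ℝ) ≤
        θ * (U.filter fun x => c x = i).card ∧
      ∀ B ⊆ U.filter fun x => i ≤ c x, B.Nonempty → B.card < (U.filter fun x => c x = i).card →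
        θ * B.card < G.cut B ((U.filter fun x => i ≤ c x) \ B) := by
  classical
  induction U using Finset.strongInduction with
  | H U ih =>
    rcases U.eq_empty_or_nonempty with rfl | hU
    · exact ⟨0, fun i => ⟨by simp, fun B hB h => by
        simp only [Finset.filter_empty, Finset.subset_empty] at hB
        simp [hB] at h⟩⟩
    -- The candidates include `U` itself, whose cut to the empty rest vanishes. Minimality of
    -- cardinality is the second claim for color 0; the recursion colors the rest.
    obtain ⟨A, hA, hmin⟩ := Finset.exists_min_image
      (U.powerset.filter fun A => A.Nonempty ∧ (G.cut A (U \ A) : ℝ) ≤ θ * A.card) Finset.card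
      ⟨U, by simp [hU]; positivity⟩
    simp only [Finset.mem_filter, Finset.mem_powerset] at hA hmin
    obtain ⟨hAU, hAne, hAcut⟩ := hA
    obtain ⟨c', hc'⟩ := ih (U \ A) (Finset.sdiff_ssubset hAU hAne)
    refine ⟨fun x => if x ∈ A then 0 else c' x + 1, fun i => ?_⟩
    cases i with
    | zero =>
      have e1 : (U.filter fun x => (if x ∈ A then 0 else c' x + 1) = 0) = A := by
        ext x
        by_cases h : x ∈ A
        · simp [h, hAU h]
        · simp [h]
      have e2 : (U.filter fun x => 0 < (if x ∈ A then 0 else c' x + 1)) = U \ A := by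
        ext x
        by_cases h : x ∈ A <;> simp [h]
      have e3 : (U.filter fun x => 0 ≤ (if x ∈ A then 0 else c' x + 1)) = U := by simp
      rw [e1, e2, e3]
      refine ⟨hAcut, fun B hB hBne hlt => ?_⟩
      by_contra hcon
      exact absurd (hmin B ⟨hB, hBne, not_lt.mp hcon⟩) (not_le.mpr hlt)
    | succ i =>
      have e1 : (U.filter fun x => (if x ∈ A then 0 else c' x + 1) = i + 1) =
          (U \ A).filter fun x => c' x = i := by
        ext x
        by_cases h : x ∈ A <;> simp [h]
      have e2 : (U.filter fun x => i + 1 < (if x ∈ A then 0 else c' x + 1)) =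
          (U \ A).filter fun x => i < c' x := by
        ext x
        by_cases h : x ∈ A <;> simp [h]
      have e3 : (U.filter fun x => i + 1 ≤ (if x ∈ A then 0 else c' x + 1)) =
          (U \ A).filter fun x => i ≤ c' x := by
        ext x
        by_cases h : x ∈ A <;> simp [h]
      rw [e1, e2, e3]
      exact hc' i

/-- Removing a largest sparsely connected subset of at most half the size leaves an expander,
provided that this subset is small. -/
theorem exists_expanding_sdiff (G : SimpleGraph V) {γ : ℝ} (hγ : 0 ≤ γ) (A : Finset V) :
    ∃ B ⊆ A, 2 * B.card ≤ A.card ∧ (G.cut B (A \ B) : ℝ) ≤ γ * B.card ∧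
      (10 * B.card ≤ A.card → ∀ F ⊆ A \ B, 2 * F.card ≤ (A \ B).card →
        γ / 2 * F.card ≤ G.cut F ((A \ B) \ F)) := by
  classical
  obtain ⟨B, hB, hmax⟩ := Finset.exists_max_image
    (A.powerset.filter fun B => 2 * B.card ≤ A.card ∧ (G.cut B (A \ B) : ℝ) ≤ γ * B.card)
    Finset.card ⟨∅, by simp⟩
  simp only [Finset.mem_filter, Finset.mem_powerset] at hB hmax
  obtain ⟨hBA, hB2, hBcut⟩ := hB
  refine ⟨B, hBA, hB2, hBcut, fun h10 F hF hF2 => ?_⟩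
  by_contra hlt
  rw [not_le] at hlt
  have hFne : 0 < F.card := by
    rw [Finset.card_pos, Finset.nonempty_iff_ne_empty]
    rintro rfl
    simp at hlt
  have hFA : F ⊆ A := hF.trans Finset.sdiff_subset
  have hdisj : Disjoint B F := Finset.disjoint_left.mpr fun x hx hx' =>
    (Finset.mem_sdiff.mp (hF hx')).2 hx
  have hQ : (A \ B).card + B.card = A.card := Finset.card_sdiff_add_card_eq_card hBA
  have hU : (B ∪ F).card = B.card + F.card := Finset.card_union_of_disjoint hdisj
  have hR : ((A \ B) \ F).card + F.card = (A \ B).card := Finset.card_sdiff_add_card_eq_card hF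
  have hFcut : (G.cut F ((A \ B) \ F) : ℝ) < γ / 2 * F.card := hlt
  -- A set `F` violating expansion can be added to `B` without spoiling its sparseness, so by
  -- maximality the union must exceed half of `A`.
  have h1 : A.card < 2 * (B ∪ F).card := by
    by_contra hcon
    have := hmax (B ∪ F) ⟨Finset.union_subset hBA hFA, not_lt.mp hcon, by
      have h2 := G.cut_union_left_le B F (A \ (B ∪ F))
      have h3 := G.cut_mono_right B (Finset.sdiff_subset_sdiff (subset_refl A)
        (Finset.subset_union_left (s₁ := B) (s₂ := F)))
      have h4 : A \ (B ∪ F) = (A \ B) \ F := by rw [sdiff_sdiff_left]; rfl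
      rw [h4] at h2 h3 ⊢
      have h2' : (G.cut (B ∪ F) ((A \ B) \ F) : ℝ) ≤ G.cut B ((A \ B) \ F) +
        G.cut F ((A \ B) \ F) := by exact_mod_cast h2
      have h3' : (G.cut B ((A \ B) \ F) : ℝ) ≤ G.cut B (A \ B) := by exact_mod_cast h3
      rw [hU]; push_cast
      nlinarith [mul_nonneg hγ (Nat.cast_nonneg (α := ℝ) F.card)]⟩
    omega
  have hsub : (A \ B) \ F ⊆ A := Finset.sdiff_subset.trans Finset.sdiff_subset
  have hcompl : A \ ((A \ B) \ F) = B ∪ F := by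
    ext x
    have := @hBA x
    have := @hFA x
    simp only [Finset.mem_sdiff, Finset.mem_union]
    tauto
  -- Then the complement of the union is a candidate: it has less than half the vertices, and as `B`
  -- is at most a tenth of `A` it is large enough for its cut to be sparse. It is also larger than
  -- `B`, a contradiction.
  have h5 := hmax ((A \ B) \ F) ⟨hsub, by omega, by
    rw [hcompl]
    have h6 := G.cut_union_right_le ((A \ B) \ F) B F
    have h7 := G.cut_mono_left B (Finset.sdiff_subset (s := A \ B) (t := F))
    rw [G.cut_comm _ B, G.cut_comm _ F] at h6
    rw [G.cut_comm _ B, G.cut_comm _ B] at h7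
    have h6' : (G.cut ((A \ B) \ F) (B ∪ F) : ℝ) ≤ G.cut B ((A \ B) \ F) +
      G.cut F ((A \ B) \ F) := by exact_mod_cast h6
    have h7' : (G.cut B ((A \ B) \ F) : ℝ) ≤ G.cut B (A \ B) := by exact_mod_cast h7
    have h8 : (B.card : ℝ) + F.card / 2 ≤ ((A \ B) \ F).card := by
      have : 2 * B.card + F.card ≤ 2 * ((A \ B) \ F).card := by omega
      have : (2 * B.card + F.card : ℝ) ≤ 2 * ((A \ B) \ F).card := by exact_mod_cast this
      linarith
    nlinarith [mul_le_mul_of_nonneg_left h8 hγ]⟩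
  omega

variable [Fintype V]

theorem sum_cut_le_sum_card_nbrs (G : SimpleGraph V) {m : ℕ} (F B : Fin m → Finset V)
    (hF : ∀ i j, i ≠ j → Disjoint (F i) (F j)) :
    ∑ i, G.cut (F i) (B i) ≤ ∑ x, (G.nbrs x).card := by
  classical
  calc ∑ i, G.cut (F i) (B i) ≤ ∑ i, ∑ x ∈ F i, (G.nbrs x).card := by
        refine Finset.sum_le_sum fun i _ => ?_
        rw [cut_eq_sum]
        refine Finset.sum_le_sum fun x _ => Finset.card_le_card fun y hy => ?_
        exact mem_nbrs.mpr (Finset.mem_filter.mp hy).2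
    _ = ∑ x ∈ Finset.univ.biUnion F, (G.nbrs x).card :=
        (Finset.sum_biUnion fun i _ j _ h => hF i j h).symm
    _ ≤ _ := Finset.sum_le_sum_of_subset (Finset.subset_univ _)

/-- The number of edges between different classes of a greedy coloring. -/
theorem sum_cut_compl_le (G : SimpleGraph V) {θ : ℝ} {m : ℕ} (c : V → Fin m)
    (hc : ∀ i, (G.cut (Finset.univ.filter fun x => c x = i) (Finset.univ.filter fun x => i < c x) : ℝ)
      ≤ θ * (Finset.univ.filter fun x => c x = i).card) :
    (∑ i, (G.cut (Finset.univ.filter fun x => c x = i) (Finset.univ.filter fun x => c x = i)ᶜ : ℝ))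
      ≤ 2 * θ * Fintype.card V := by
  classical
  have hcard : ∑ i, ((Finset.univ.filter fun x => c x = i).card : ℝ) = Fintype.card V := by
    rw [← Finset.card_univ, Finset.card_eq_sum_card_fiberwise (f := c) (t := Finset.univ)
        fun _ _ => Finset.mem_coe.mpr (Finset.mem_univ _)]
    push_cast
    rfl
  have hsplit : ∀ i, G.cut (Finset.univ.filter fun x => c x = i)
      (Finset.univ.filter fun x => c x = i)ᶜ ≤
      G.cut (Finset.univ.filter fun x => c x = i) (Finset.univ.filter fun x => i < c x) +
      G.cut (Finset.univ.filter fun x => c x = i) (Finset.univ.filter fun x => c x < i) := by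
    intro i
    refine le_trans (G.cut_mono_right _ ?_) (G.cut_union_right_le _ _ _)
    intro x hx
    simp only [Finset.mem_compl, Finset.mem_filter, Finset.mem_univ, true_and,
      Finset.mem_union] at hx ⊢
    rcases lt_trichotomy (c x) i with h | h | h
    · exact Or.inr h
    · exact absurd h hx
    · exact Or.inl h
  have hexp : ∀ (R : Fin m → Fin m → Prop) [DecidableRel R],
      ∑ i, G.cut (Finset.univ.filter fun x => c x = i) (Finset.univ.filter fun x => R i (c x)) =
      ((Finset.univ : Finset (V × V)).filter fun p => R (c p.1) (c p.2) ∧ G.Adj p.1 p.2).card := by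
    intro R _
    rw [Finset.card_eq_sum_card_fiberwise (f := fun p : V × V => c p.1) (t := Finset.univ)
        fun _ _ => Finset.mem_coe.mpr (Finset.mem_univ _)]
    refine Finset.sum_congr rfl fun i _ => ?_
    rw [cut]
    congr 1
    ext ⟨x, y⟩
    simp only [Finset.mem_filter, Finset.mem_product, Finset.mem_univ, true_and]
    constructor
    · rintro ⟨⟨rfl, h⟩, h'⟩; exact ⟨⟨h, h'⟩, rfl⟩
    · rintro ⟨⟨h, h'⟩, rfl⟩; exact ⟨⟨rfl, h⟩, h'⟩
  have hsymm : ∑ i, G.cut (Finset.univ.filter fun x => c x = i) (Finset.univ.filter fun x => c x < i)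
      = ∑ i, G.cut (Finset.univ.filter fun x => c x = i) (Finset.univ.filter fun x => i < c x) := by
    rw [hexp (fun i j => j < i), hexp (fun i j => i < j)]
    refine Finset.card_bij (fun p _ => p.swap) ?_ (fun p _ q _ h => Prod.swap_injective h) ?_
    · rintro ⟨a, b⟩ h
      simp only [Finset.mem_filter, Finset.mem_univ, true_and, Prod.swap] at h ⊢
      exact ⟨h.1, h.2.symm⟩
    · rintro ⟨a, b⟩ h
      simp only [Finset.mem_filter, Finset.mem_univ, true_and] at h
      exact ⟨(b, a), by simp [h.1, h.2.symm], rfl⟩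
  have htot : ∑ i, G.cut (Finset.univ.filter fun x => c x = i)
      (Finset.univ.filter fun x => c x = i)ᶜ ≤ 2 * ∑ i, G.cut (Finset.univ.filter fun x => c x = i)
      (Finset.univ.filter fun x => i < c x) := by
    refine (Finset.sum_le_sum fun i _ => hsplit i).trans_eq ?_
    rw [Finset.sum_add_distrib, hsymm, two_mul]
  have htot' : (∑ i, (G.cut (Finset.univ.filter fun x => c x = i)
      (Finset.univ.filter fun x => c x = i)ᶜ : ℝ)) ≤
      2 * ∑ i, (G.cut (Finset.univ.filter fun x => c x = i)
      (Finset.univ.filter fun x => i < c x) : ℝ) := by exact_mod_cast htot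
  refine htot'.trans ?_
  have hle := Finset.sum_le_sum fun (i : Fin m) (_ : i ∈ Finset.univ) => hc i
  rw [← Finset.mul_sum, hcard] at hle
  linarith

/-- A family of sparsely connected subsets of the classes of a greedy coloring is small, provided
that disjoint families of sets can be smoothed. -/
theorem sum_card_le_of_smoothing {G G₀ : SimpleGraph V} (hG₀ : G₀ ≤ G) {m : ℕ} (c : V → Fin m)
    {θ C η : ℝ} (hθ : 0 < θ) (hC : 1 ≤ C)
    (hc : ∀ i, (G₀.cut (Finset.univ.filter fun x => c x = i)
        (Finset.univ.filter fun x => i < c x) : ℝ) ≤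
        θ * (Finset.univ.filter fun x => c x = i).card ∧
      ∀ B ⊆ Finset.univ.filter fun x => i ≤ c x, B.Nonempty →
        B.card < (Finset.univ.filter fun x => c x = i).card →
        θ * B.card < G₀.cut B ((Finset.univ.filter fun x => i ≤ c x) \ B))
    (hsmooth : ∀ F : Fin m → Finset V, (∀ i j, i ≠ j → Disjoint (F i) (F j)) →
      ∃ F' : Fin m → Finset V, (∑ i, ((symmDiff (F i) (F' i)).card : ℝ)) ≤
          C * ∑ i, (G.cut (F i) (F i)ᶜ : ℝ) + η * Fintype.card V ∧
        (∑ i, (G.cut (F' i) (F' i)ᶜ : ℝ)) ≤ η * Fintype.card V)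
    (F : Fin m → Finset V) (hF : ∀ i, F i ⊆ Finset.univ.filter fun x => c x = i)
    (hF2 : ∀ i, 2 * (F i).card ≤ (Finset.univ.filter fun x => c x = i).card)
    (hFcut : ∀ i, (G₀.cut (F i) ((Finset.univ.filter fun x => c x = i) \ F i) : ℝ) ≤
      1 / (2 * C) * (F i).card) :
    (∑ i, ((F i).card : ℝ)) ≤ 2 * (C * (2 * θ * Fintype.card V +
      ∑ x, (((G \ G₀).nbrs x).card : ℝ)) + η * Fintype.card V + η * Fintype.card V / θ) := by
  classical
  set A : Fin m → Finset V := fun i => Finset.univ.filter fun x => c x = i with hA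
  set U : Fin m → Finset V := fun i => Finset.univ.filter fun x => i ≤ c x with hU
  have hAdisj : ∀ i j, i ≠ j → Disjoint (A i) (A j) := fun i j hij =>
    Finset.disjoint_left.mpr fun x hx hx' => hij (by
      simp only [hA, Finset.mem_filter] at hx hx'
      rw [← hx.2, ← hx'.2])
  have hFdisj : ∀ i j, i ≠ j → Disjoint (F i) (F j) := fun i j hij =>
    (hAdisj i j hij).mono (hF i) (hF j)
  obtain ⟨F', h1, h2⟩ := hsmooth F hFdisj
  have hAU : ∀ i, A i ⊆ U i := fun i x hx => by
    simp only [hA, hU, Finset.mem_filter, Finset.mem_univ, true_and] at hx ⊢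
    exact hx.ge
  -- A boundary edge of `F i` stays in its piece, leaves the piece, or is missing from `G₀`.
  have hcut1 : ∀ i, G.cut (F i) (F i)ᶜ ≤ G₀.cut (F i) (A i \ F i) + G₀.cut (A i) (A i)ᶜ +
      (G \ G₀).cut (F i) (F i)ᶜ := by
    intro i
    have e1 : G.cut (F i) (F i)ᶜ ≤ G₀.cut (F i) (F i)ᶜ + (G \ G₀).cut (F i) (F i)ᶜ := by
      unfold cut
      refine le_trans (Finset.card_le_card ?_) (Finset.card_union_le _ _)
      intro p hp
      simp only [Finset.mem_filter, Finset.mem_product, Finset.mem_union, sdiff_adj] at hp ⊢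
      tauto
    have e2 : G₀.cut (F i) (F i)ᶜ ≤ G₀.cut (F i) (A i \ F i) + G₀.cut (F i) (A i)ᶜ := by
      refine le_trans (G₀.cut_mono_right _ ?_) (G₀.cut_union_right_le _ _ _)
      intro x hx
      simp only [Finset.mem_compl, Finset.mem_union, Finset.mem_sdiff] at hx ⊢
      tauto
    have e3 : G₀.cut (F i) (A i)ᶜ ≤ G₀.cut (A i) (A i)ᶜ := G₀.cut_mono_left (A i)ᶜ (hF i)
    omega
  have hcut2 : (∑ i, (G.cut (F i) (F i)ᶜ : ℝ)) ≤ 1 / (2 * C) * ∑ i, ((F i).card : ℝ) +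
      (2 * θ * Fintype.card V + ∑ x, (((G \ G₀).nbrs x).card : ℝ)) := by
    have e1 := sum_cut_compl_le G₀ c fun i => (hc i).1
    have e2 : ∑ i, ((G \ G₀).cut (F i) (F i)ᶜ : ℝ) ≤ ∑ x, (((G \ G₀).nbrs x).card : ℝ) := by
      exact_mod_cast sum_cut_le_sum_card_nbrs (G \ G₀) F (fun i => (F i)ᶜ) hFdisj
    calc (∑ i, (G.cut (F i) (F i)ᶜ : ℝ))
        ≤ ∑ i, ((G₀.cut (F i) (A i \ F i) : ℝ) + G₀.cut (A i) (A i)ᶜ +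
          (G \ G₀).cut (F i) (F i)ᶜ) := Finset.sum_le_sum fun i _ => by exact_mod_cast hcut1 i
      _ = ∑ i, (G₀.cut (F i) (A i \ F i) : ℝ) + ∑ i, (G₀.cut (A i) (A i)ᶜ : ℝ) +
          ∑ i, ((G \ G₀).cut (F i) (F i)ᶜ : ℝ) := by
          rw [Finset.sum_add_distrib, Finset.sum_add_distrib]
      _ ≤ ∑ i, 1 / (2 * C) * ((F i).card : ℝ) + 2 * θ * Fintype.card V +
          ∑ x, (((G \ G₀).nbrs x).card : ℝ) := by
          gcongr with i
          exact hFcut i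
      _ = _ := by rw [← Finset.mul_sum]; ring
  -- If the smoothed set has at least `|A i|` vertices in `U i`, it differs from `F i`, at most half
  -- of `A i`, in at least `|F i|` vertices. If it has fewer, minimality of the piece `A i` forces
  -- `θ` edges per vertex, which are boundary edges of `F' i`.
  have hpt : ∀ i, ((F i).card : ℝ) ≤ (symmDiff (F i) (F' i)).card +
      (G.cut (F' i) (F' i)ᶜ : ℝ) / θ := by
    intro i
    have hpos : (0 : ℝ) ≤ (G.cut (F' i) (F' i)ᶜ : ℝ) / θ := by positivity
    by_cases hbig : (A i).card ≤ (F' i ∩ U i).card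
    · have e1 : (F' i ∩ U i).card ≤ (F i).card + (symmDiff (F i) (F' i)).card := by
        refine le_trans (Finset.card_le_card ?_) (Finset.card_union_le _ _)
        intro x hx
        simp only [Finset.mem_inter, Finset.mem_union, Finset.mem_symmDiff] at hx ⊢
        tauto
      have e2 := hF2 i
      have e3 : (F i).card ≤ (symmDiff (F i) (F' i)).card := by
        change 2 * (F i).card ≤ (A i).card at e2
        omega
      have : ((F i).card : ℝ) ≤ (symmDiff (F i) (F' i)).card := by exact_mod_cast e3
      linarith
    · have e1 : (F i).card ≤ (symmDiff (F i) (F' i)).card + (F' i ∩ U i).card := by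
        refine le_trans (Finset.card_le_card ?_) (Finset.card_union_le _ _)
        intro x hx
        have := hAU i (hF i hx)
        simp only [Finset.mem_inter, Finset.mem_union, Finset.mem_symmDiff] at hx ⊢
        tauto
      have e1' : ((F i).card : ℝ) ≤ (symmDiff (F i) (F' i)).card + (F' i ∩ U i).card := by
        exact_mod_cast e1
      have e2 : ((F' i ∩ U i).card : ℝ) ≤ (G.cut (F' i) (F' i)ᶜ : ℝ) / θ := by
        rcases (F' i ∩ U i).eq_empty_or_nonempty with h | h
        · rw [h]; simpa using hpos
        · have e3 := (hc i).2 (F' i ∩ U i) Finset.inter_subset_right h (not_le.mp hbig)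
          have e4 : G₀.cut (F' i ∩ U i) (U i \ (F' i ∩ U i)) ≤ G.cut (F' i) (F' i)ᶜ := by
            refine cut_mono (fun x _ y _ h => hG₀ h) Finset.inter_subset_left ?_
            intro x hx
            simp only [Finset.mem_sdiff, Finset.mem_inter, Finset.mem_compl] at hx ⊢
            tauto
          have e4' : (G₀.cut (F' i ∩ U i) (U i \ (F' i ∩ U i)) : ℝ) ≤ G.cut (F' i) (F' i)ᶜ := by
            exact_mod_cast e4
          rw [le_div_iff₀ hθ]
          linarith
      linarith
  have hsum : (∑ i, ((F i).card : ℝ)) ≤ ∑ i, ((symmDiff (F i) (F' i)).card : ℝ) +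
      (∑ i, (G.cut (F' i) (F' i)ᶜ : ℝ)) / θ := by
    rw [Finset.sum_div, ← Finset.sum_add_distrib]
    exact Finset.sum_le_sum fun i _ => hpt i
  have h3 : (∑ i, (G.cut (F' i) (F' i)ᶜ : ℝ)) / θ ≤ η * Fintype.card V / θ := by gcongr
  -- The sparseness `1 / (2C)` is chosen so that smoothing returns only half of the total size,
  -- which is absorbed on the left.
  have hCC : C * (1 / (2 * C)) = 1 / 2 := by field_simp
  have h4 : C * ∑ i, (G.cut (F i) (F i)ᶜ : ℝ) ≤ 1 / 2 * ∑ i, ((F i).card : ℝ) +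
      C * (2 * θ * Fintype.card V + ∑ x, (((G \ G₀).nbrs x).card : ℝ)) := by
    calc _ ≤ C * (1 / (2 * C) * ∑ i, ((F i).card : ℝ) +
        (2 * θ * Fintype.card V + ∑ x, (((G \ G₀).nbrs x).card : ℝ))) := by gcongr
      _ = _ := by rw [mul_add, ← mul_assoc, hCC]
  linarith

end Partition

end SimpleGraph

/-! ### Expanding pieces with few missing degrees -/

namespace SimpleGraph

section Partition

variable {V : Type u}

/-- The subgraph of the edges inside one of the sets `Q i`. -/
def insideParts (G : SimpleGraph V) {m : ℕ} (Q : Fin m → Finset V) : SimpleGraph V where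
  Adj x y := G.Adj x y ∧ ∃ i, x ∈ Q i ∧ y ∈ Q i
  symm := ⟨fun _ _ h => ⟨h.1.symm, h.2.imp fun _ h => h.symm⟩⟩
  loopless := ⟨fun _ h => h.1.ne rfl⟩

theorem insideParts_le (G : SimpleGraph V) {m : ℕ} (Q : Fin m → Finset V) : G.insideParts Q ≤ G :=
  fun _ _ h => h.1

variable [Fintype V]

theorem sum_card_nbrs_eq_cut (G : SimpleGraph V) :
    ∑ x, (G.nbrs x).card = G.cut Finset.univ Finset.univ := by
  classical
  rw [cut_eq_sum]
  refine Finset.sum_congr rfl fun x _ => ?_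
  congr 1

theorem card_nbrs_sdiff {G H : SimpleGraph V} (h : H ≤ G) (x : V) :
    ((G \ H).nbrs x).card + (H.nbrs x).card = (G.nbrs x).card := by
  classical
  have e : (G \ H).nbrs x = G.nbrs x \ H.nbrs x := by
    ext y; simp [mem_nbrs, sdiff_adj]
  rw [e]
  exact Finset.card_sdiff_add_card_eq_card fun y hy => mem_nbrs.mpr (h (mem_nbrs.mp hy))

theorem card_nbrs_mono {G H : SimpleGraph V} (h : H ≤ G) (x : V) :
    (H.nbrs x).card ≤ (G.nbrs x).card :=
  Finset.card_le_card fun _ hy => mem_nbrs.mpr (h (mem_nbrs.mp hy))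

/-- The subgraph of the edges both of whose ends have degree `d`. -/
def regularPart (G : SimpleGraph V) (d : ℕ) : SimpleGraph V where
  Adj x y := G.Adj x y ∧ (G.nbrs x).card = d ∧ (G.nbrs y).card = d
  symm := ⟨fun _ _ h => ⟨h.1.symm, h.2.2, h.2.1⟩⟩
  loopless := ⟨fun _ h => h.1.ne rfl⟩

theorem regularPart_le (G : SimpleGraph V) (d : ℕ) : G.regularPart d ≤ G := fun _ _ h => h.1

variable [DecidableEq V]

/-- A lost edge either touches the exceptional set `Z`, accounting for at most `2 |Z| D` ordered
pairs, or is an edge of `G₀` between two classes. -/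
theorem sum_card_nbrs_sdiff_le {G H : SimpleGraph V} {D : ℕ}
    (hD : ∀ x, (G.nbrs x).card ≤ D) (Z : Finset V) {m : ℕ} (c : V → Fin m)
    (h : ∀ x y, G.Adj x y → x ∉ Z → y ∉ Z → c x = c y → H.Adj x y) {G₀ : SimpleGraph V}
    (hG₀ : ∀ x y, G.Adj x y → x ∉ Z → y ∉ Z → G₀.Adj x y) :
    ∑ x, ((G \ H).nbrs x).card ≤ 2 * (Z.card * D) + ∑ i, G₀.cut
      (Finset.univ.filter fun x => c x = i) (Finset.univ.filter fun x => c x = i)ᶜ := by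
  classical
  have hbi : ((Finset.univ : Finset (V × V)).filter fun p => c p.1 ≠ c p.2 ∧ G₀.Adj p.1 p.2).card =
      ∑ i, G₀.cut
      (Finset.univ.filter fun x => c x = i) (Finset.univ.filter fun x => c x = i)ᶜ := by
    rw [Finset.card_eq_sum_card_fiberwise (f := fun p : V × V => c p.1) (t := Finset.univ)
        fun _ _ => Finset.mem_coe.mpr (Finset.mem_univ _)]
    refine Finset.sum_congr rfl fun i _ => ?_
    rw [cut]
    congr 1
    ext ⟨x, y⟩
    simp only [Finset.mem_filter, Finset.mem_product, Finset.mem_univ, true_and,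
      Finset.mem_compl]
    constructor
    · rintro ⟨⟨h, h'⟩, rfl⟩; exact ⟨⟨rfl, fun e => h e.symm⟩, h'⟩
    · rintro ⟨⟨rfl, h⟩, h'⟩; exact ⟨⟨fun e => h e.symm, h'⟩, rfl⟩
  rw [sum_card_nbrs_eq_cut, ← hbi]
  have h1 : G.cut Z Finset.univ ≤ Z.card * D := cut_le_mul G Z _ fun x _ => hD x
  have h2 : G.cut Finset.univ Z ≤ Z.card * D := by rw [cut_comm]; exact h1
  have h3 : (G \ H).cut Finset.univ Finset.univ ≤ G.cut Z Finset.univ + G.cut Finset.univ Z +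
      ((Finset.univ : Finset (V × V)).filter fun p => c p.1 ≠ c p.2 ∧ G₀.Adj p.1 p.2).card := by
    unfold cut
    refine le_trans (Finset.card_le_card ?_) ((Finset.card_union_le _ _).trans
      (Nat.add_le_add_right (Finset.card_union_le _ _) _))
    rintro ⟨x, y⟩ hp
    simp only [Finset.mem_filter, Finset.mem_product, Finset.mem_union, sdiff_adj,
      Finset.mem_univ, true_and, and_true] at hp ⊢
    have := h x y hp.1
    have := hG₀ x y hp.1
    tauto
  omega

end Partition

section Asymptotic

variable {Γ : Type v} [Group Γ] {X : SimpleGraph Γ} {A : Finset Γ} {V : ℕ → Type u}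
  [∀ n, Fintype (V n)]

/-- In graphs converging locally to a Cayley graph of a group with Property (T), deleting few edges
leaves few isolated vertices and a disjoint union of expanders, with few missing degrees. -/
theorem exists_expander_partition [Countable Γ] [Infinite Γ] (hT : HasKazhdanPropertyT Γ)
    (hX : ∀ u v, X.Adj u v ↔ u⁻¹ * v ∈ A) (hA : Subgroup.closure (A : Set Γ) = ⊤)
    (G : ∀ n, SimpleGraph (V n)) {D : ℕ} (hD0 : 0 < D) (hD : ∀ n x, ((G n).nbrs x).card ≤ D)
    (hAD : A.card ≤ D) (hne : ∀ᶠ n in atTop, 0 < Fintype.card (V n))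
    (hbad : ∀ R, Tendsto (fun n => ((badVertices X (G n) R).card : ℝ) / Fintype.card (V n))
      atTop (𝓝 0)) [∀ n, DecidableEq (V n)] :
    ∃ γ : ℝ, 0 < γ ∧ ∀ κ : ℝ, 0 < κ → ∀ᶠ n in atTop,
      ∃ (H : SimpleGraph (V n)) (m : ℕ) (Q : Fin m → Finset (V n)),
        H ≤ G n ∧ (∀ i j, i ≠ j → Disjoint (Q i) (Q j)) ∧
        (∀ x y, H.Adj x y → ∃ i, x ∈ Q i ∧ y ∈ Q i) ∧
        (∀ x, (H.nbrs x).card ≤ A.card) ∧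
        (∀ x, (H.nbrs x).Nonempty → ((G n).nbrs x).card = A.card) ∧
        (∀ i, ∀ F ⊆ Q i, 2 * F.card ≤ (Q i).card → γ * F.card ≤ H.cut F (Q i \ F)) ∧
        ((Finset.univ.biUnion Q)ᶜ.card : ℝ) ≤ κ * Fintype.card (V n) ∧
        (∑ x, (((G n \ H).nbrs x).card : ℝ)) ≤ κ * Fintype.card (V n) ∧
        (∑ x, ((A.card - (H.nbrs x).card : ℕ) : ℝ)) ≤ κ * Fintype.card (V n) := by
  classical
  obtain ⟨C, hC, hsmooth⟩ := exists_smoothing hT hX hA G hD0 hD hne hbad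
  have hC0 : 0 < C := by linarith
  have hDr : (1 : ℝ) ≤ D := by exact_mod_cast hD0
  refine ⟨1 / (2 * C) / 2, by positivity, fun κ hκ => ?_⟩
  -- The scales: `κ'` bounds the uncovered vertices, `θ` the boundary of greedy pieces, `β` the
  -- atypical vertices, and `η` the smoothing error, which must be small even after division by `θ`.
  -- The resulting total for the sparse subsets is at most `κ' / 10`.
  set κ' : ℝ := κ / (16 * D) with hκ'
  have hκ'0 : 0 < κ' := by positivity
  have hκ'D : κ' * D = κ / 16 := by rw [hκ']; field_simp
  set θ : ℝ := κ' / (160 * C) with hθ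
  have hθ0 : 0 < θ := by positivity
  have hθC : C * θ = κ' / 160 := by rw [hθ]; field_simp
  set β : ℝ := κ' / (160 * C * D) with hβ
  have hβ0 : 0 < β := by positivity
  have hβC : C * (D * β) = κ' / 160 := by rw [hβ]; field_simp
  set η : ℝ := κ' * θ / (80 * (1 + θ)) with hη
  have hη0 : 0 < η := by positivity
  have hηθ : η + η / θ = κ' / 80 := by rw [hη]; field_simp; ring
  have hbad1 : ∀ᶠ n in atTop, ((badVertices X (G n) 1).card : ℝ) / Fintype.card (V n) < β :=
    (hbad 1).eventually_lt_const hβ0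
  filter_upwards [hsmooth η hη0, hbad1, hne] with n hn hb hV
  have hVr : (0 : ℝ) < Fintype.card (V n) := by exact_mod_cast hV
  rw [div_lt_iff₀ hVr] at hb
  generalize hN : (Fintype.card (V n) : ℝ) = N at *
  set B₁ := badVertices X (G n) 1 with hB₁
  have hdeg : ∀ x ∉ B₁, ((G n).nbrs x).card = A.card := fun x hx => by
    obtain ⟨E, hE1, hE⟩ := notMem_badVertices.mp hx
    rw [← hE1]
    exact hE.card_nbrs hX le_rfl
  -- Restricting to vertices of degree exactly `|A|` bounds the degrees of the subgraph, and an edge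
  -- is lost only if it touches an atypical vertex.
  set G₀ := (G n).regularPart A.card with hG₀
  have hG₀le : G₀ ≤ G n := regularPart_le _ _
  obtain ⟨c', hc'⟩ := exists_greedy_coloring G₀ hθ0.le Finset.univ
  obtain ⟨m, hm⟩ : ∃ m, ∀ x, c' x < m :=
    ⟨Finset.univ.sup c' + 1, fun x => Nat.lt_succ_of_le (Finset.le_sup (Finset.mem_univ x))⟩
  let c : V n → Fin m := fun x => ⟨c' x, hm x⟩
  have e1 : ∀ i : Fin m, (Finset.univ.filter fun x => c' x = i) =
      Finset.univ.filter fun x => c x = i := fun i => by ext x; simp [c, Fin.ext_iff]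
  have e2 : ∀ i : Fin m, (Finset.univ.filter fun x => i < c' x) =
      Finset.univ.filter fun x => i < c x := fun i => by ext x; simp [c, Fin.lt_def]
  have e3 : ∀ i : Fin m, (Finset.univ.filter fun x => i ≤ c' x) =
      Finset.univ.filter fun x => i ≤ c x := fun i => by ext x; simp [c, Fin.le_def]
  have hc : ∀ i, (G₀.cut (Finset.univ.filter fun x => c x = i)
        (Finset.univ.filter fun x => i < c x) : ℝ) ≤
        θ * (Finset.univ.filter fun x => c x = i).card ∧
      ∀ B ⊆ Finset.univ.filter fun x => i ≤ c x, B.Nonempty →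
        B.card < (Finset.univ.filter fun x => c x = i).card →
        θ * B.card < G₀.cut B ((Finset.univ.filter fun x => i ≤ c x) \ B) := fun i => by
    have := hc' i
    rw [e1, e2, e3] at this
    exact this
  set P : Fin m → Finset (V n) := fun i => Finset.univ.filter fun x => c x = i with hP
  choose B hBA hB2 hBcut hBexp using fun i =>
    exists_expanding_sdiff G₀ (γ := 1 / (2 * C)) (by positivity) (P i)
  have hBsum := sum_card_le_of_smoothing hG₀le c hθ0 hC hc (by rw [hN]; exact hn m) B hBA hB2 hBcut
  rw [hN] at hBsum
  have hmemP : ∀ x i, x ∈ P i ↔ c x = i := fun x i => by simp [hP]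
  have hcutP : (∑ i, (G₀.cut (P i) (P i)ᶜ : ℝ)) ≤ 2 * θ * N := by
    rw [← hN]; exact sum_cut_compl_le G₀ c fun i => (hc i).1
  have hρ : (∑ x, (((G n \ G₀).nbrs x).card : ℝ)) ≤ 2 * (B₁.card * D) := by
    have h := sum_card_nbrs_sdiff_le (H := G₀) (G₀ := G₀) (hD n) B₁ (fun _ => (0 : Fin 1))
      (fun x y h hx hy _ => ⟨h, hdeg x hx, hdeg y hy⟩) (fun x y h hx hy => ⟨h, hdeg x hx, hdeg y hy⟩)
    simp at h
    exact_mod_cast h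
  have hBN : (∑ i, ((B i).card : ℝ)) ≤ κ' / 10 * N := by
    have h1 : C * (2 * θ * N + ∑ x, (((G n \ G₀).nbrs x).card : ℝ)) ≤
        C * (2 * θ * N + 2 * (β * N * D)) := by
      gcongr
      refine hρ.trans ?_
      gcongr
    have h2 : C * (2 * θ * N + 2 * (β * N * D)) = κ' / 40 * N := by
      calc _ = 2 * (C * θ) * N + 2 * (C * (D * β)) * N := by ring
        _ = _ := by rw [hθC, hβC]; ring
    have h3 : η * N + η * N / θ = κ' / 80 * N := by rw [← hηθ]; ring
    have : 0 < κ' * N := by positivity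
    linarith
  -- A piece whose sparse subset exceeds a tenth is discarded; either way at most `10 |B i|`
  -- vertices are lost.
  let Q : Fin m → Finset (V n) := fun i => if 10 * (B i).card ≤ (P i).card then P i \ B i else ∅
  have hQP : ∀ i, Q i ⊆ P i := fun i => by
    simp only [Q]; split_ifs
    · exact Finset.sdiff_subset
    · exact Finset.empty_subset _
  have hQdisj : ∀ i j, i ≠ j → Disjoint (Q i) (Q j) := fun i j hij =>
    Finset.disjoint_left.mpr fun x hx hx' => hij (by
      rw [← (hmemP x i).mp (hQP i hx), ← (hmemP x j).mp (hQP j hx')])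
  set W : Finset (V n) := (Finset.univ.biUnion Q)ᶜ with hW
  have hWmem : ∀ x ∉ W, x ∈ Q (c x) := fun x hx => by
    rw [hW, Finset.mem_compl, not_not, Finset.mem_biUnion] at hx
    obtain ⟨i, -, hi⟩ := hx
    rwa [(hmemP x i).mp (hQP i hi)]
  have hWcard : (W.card : ℝ) ≤ κ' * N := by
    have h1 : W ⊆ Finset.univ.biUnion fun i => P i \ Q i := by
      intro x hx
      rw [Finset.mem_biUnion]
      refine ⟨c x, Finset.mem_univ _, Finset.mem_sdiff.mpr ⟨(hmemP x _).mpr rfl, fun h => ?_⟩⟩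
      rw [hW, Finset.mem_compl] at hx
      exact hx (Finset.mem_biUnion.mpr ⟨c x, Finset.mem_univ _, h⟩)
    have h2 : ∀ i, (P i \ Q i).card ≤ 10 * (B i).card := fun i => by
      simp only [Q]
      split_ifs with h
      · rw [sdiff_sdiff_right_self]
        exact (Finset.card_le_card Finset.inter_subset_right).trans (by omega)
      · rw [Finset.sdiff_empty]; omega
    have h3 : W.card ≤ 10 * ∑ i, (B i).card := by
      rw [Finset.mul_sum]
      exact (Finset.card_le_card h1).trans (Finset.card_biUnion_le.trans
        (Finset.sum_le_sum fun i _ => h2 i))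
    have h3' : (W.card : ℝ) ≤ 10 * ∑ i, ((B i).card : ℝ) := by exact_mod_cast h3
    have : 0 < κ' * N := by positivity
    linarith
  have hHG : G₀.insideParts Q ≤ G n := (insideParts_le _ _).trans hG₀le
  have hsum : (∑ x, (((G n \ G₀.insideParts Q).nbrs x).card : ℝ)) ≤ 2 * (β * N * D + κ' * N * D) +
      2 * θ * N := by
    have h := sum_card_nbrs_sdiff_le (H := G₀.insideParts Q) (G₀ := G₀) (hD n) (B₁ ∪ W) c
      (fun x y h hx hy hxy => by
        rw [Finset.mem_union, not_or] at hx hy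
        refine ⟨⟨h, hdeg x hx.1, hdeg y hy.1⟩, c x, hWmem x hx.2, ?_⟩
        rw [hxy]; exact hWmem y hy.2)
      (fun x y h hx hy => by
        rw [Finset.mem_union, not_or] at hx hy
        exact ⟨h, hdeg x hx.1, hdeg y hy.1⟩)
    have h' : (∑ x, (((G n \ G₀.insideParts Q).nbrs x).card : ℝ)) ≤
        2 * ((B₁ ∪ W).card * D) + ∑ i, (G₀.cut (P i) (P i)ᶜ : ℝ) := by exact_mod_cast h
    have h4 : ((B₁ ∪ W).card : ℝ) ≤ β * N + κ' * N := by
      have : ((B₁ ∪ W).card : ℝ) ≤ B₁.card + W.card := by exact_mod_cast Finset.card_union_le _ _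
      linarith
    have h5 : ((B₁ ∪ W).card : ℝ) * D ≤ (β * N + κ' * N) * D := by gcongr
    linarith
  have hβD : D * β ≤ κ' / 160 := by
    rw [← hβC]; exact le_mul_of_one_le_left (by positivity) hC
  have hθκ : θ ≤ κ' / 160 := by
    rw [← hθC]; exact le_mul_of_one_le_left (by positivity) hC
  have hκκ : κ' ≤ κ / 16 := by
    rw [← hκ'D]; exact le_mul_of_one_le_right (by positivity) hDr
  have hN0 : 0 ≤ N := hVr.le
  have hsum' : 2 * (β * N * D + κ' * N * D) + 2 * θ * N ≤ κ / 2 * N := by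
    calc _ = (2 * (D * β) + 2 * (κ' * D) + 2 * θ) * N := by ring
      _ ≤ _ := by gcongr; linarith
  refine ⟨G₀.insideParts Q, m, Q, hHG, hQdisj, fun x y h => h.2, ?_, ?_, ?_, ?_, ?_, ?_⟩
  · intro x
    rcases ((G₀.insideParts Q).nbrs x).eq_empty_or_nonempty with h | ⟨y, hy⟩
    · simp [h]
    · rw [← (mem_nbrs.mp hy).1.2.1]
      exact card_nbrs_mono hHG x
  · rintro x ⟨y, hy⟩
    exact (mem_nbrs.mp hy).1.2.1
  · intro i F hF hF2
    have hcut : G₀.cut F (Q i \ F) ≤ (G₀.insideParts Q).cut F (Q i \ F) :=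
      cut_mono (fun x hx y hy h => ⟨h, i, hF hx, (Finset.mem_sdiff.mp hy).1⟩) subset_rfl subset_rfl
    refine le_trans ?_ (Nat.cast_le.mpr hcut)
    by_cases h10 : 10 * (B i).card ≤ (P i).card
    · have hQi : Q i = P i \ B i := if_pos h10
      rw [hQi] at hF hF2 ⊢
      exact hBexp i h10 F hF hF2
    · have hQi : Q i = ∅ := if_neg h10
      rw [hQi, Finset.subset_empty] at hF
      simp [hF]
  · refine hWcard.trans ?_
    gcongr
    linarith
  · refine (hsum.trans hsum').trans ?_
    gcongr
    linarith
  -- A typical vertex has degree `|A|` in `G n`, so its missing degree is at most its number of lost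
  -- edges; an atypical one misses at most `|A| ≤ D`.
  · have h1 : ∀ x, ((A.card - ((G₀.insideParts Q).nbrs x).card : ℕ) : ℝ) ≤
        (if x ∈ B₁ then (D : ℝ) else 0) + ((G n \ G₀.insideParts Q).nbrs x).card := by
      intro x
      have h2 := card_nbrs_sdiff hHG x
      split_ifs with h
      · have : A.card - ((G₀.insideParts Q).nbrs x).card ≤
          D + ((G n \ G₀.insideParts Q).nbrs x).card := by omega
        exact_mod_cast this
      · have h3 := hdeg x h
        have : A.card - ((G₀.insideParts Q).nbrs x).card ≤
          ((G n \ G₀.insideParts Q).nbrs x).card := by omega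
        rw [zero_add]
        exact_mod_cast this
    refine (Finset.sum_le_sum fun x _ => h1 x).trans ?_
    rw [Finset.sum_add_distrib, Finset.sum_ite_mem, Finset.univ_inter, Finset.sum_const,
      nsmul_eq_mul]
    have h4 : (B₁.card : ℝ) * D ≤ β * N * D := by gcongr
    have h5 : β * N * D ≤ κ / 2 * N := by
      calc β * N * D = D * β * N := by ring
        _ ≤ _ := by gcongr; linarith
    linarith

end Asymptotic

end SimpleGraph

/-! ### Edge swaps and completion to a regular graph -/

namespace SimpleGraph

section Edit

variable {V : Type u}

theorem cut_sup [DecidableEq V] {G H : SimpleGraph V} (h : ∀ x y, G.Adj x y → ¬ H.Adj x y) (A B : Finset V) :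
    (G ⊔ H).cut A B = G.cut A B + H.cut A B := by
  classical
  unfold cut
  rw [← Finset.card_union_of_disjoint]
  · congr 1
    ext p
    simp only [Finset.mem_filter, Finset.mem_union, sup_adj]
    tauto
  · rw [Finset.disjoint_left]
    intro p hp hp'
    rw [Finset.mem_filter] at hp hp'
    exact h _ _ hp.2 hp'.2

theorem not_edge_adj {H : SimpleGraph V} {a b : V} (h : ¬ H.Adj a b) (x y : V) (hxy : H.Adj x y) :
    ¬ (edge a b).Adj x y := by
  rw [edge_adj]
  rintro ⟨⟨rfl, rfl⟩ | ⟨rfl, rfl⟩, -⟩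
  · exact h hxy
  · exact h hxy.symm

/-- Whether the pair `a`, `b` is separated by `F`. -/
def separates [DecidableEq V] (F : Finset V) (a b : V) : ℕ := if (a ∈ F ↔ b ∈ F) then 0 else 1

theorem separates_comm [DecidableEq V] (F : Finset V) (a b : V) : separates F a b = separates F b a := by
  unfold separates
  simp only [iff_comm]

theorem separates_triangle [DecidableEq V] (F : Finset V) (a b c : V) :
    separates F a c ≤ separates F a b + separates F b c := by
  unfold separates
  split_ifs <;> first | omega | (exfalso; tauto)

variable [Fintype V]

/-- The number of ordered pairs on which two graphs differ. -/
noncomputable def adjDiff (G H : SimpleGraph V) : ℕ :=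
  open Classical in
  ((Finset.univ : Finset (V × V)).filter fun p => ¬(G.Adj p.1 p.2 ↔ H.Adj p.1 p.2)).card

@[simp] theorem adjDiff_self (G : SimpleGraph V) : adjDiff G G = 0 := by
  simp [adjDiff]

theorem adjDiff_triangle (G H K : SimpleGraph V) :
    adjDiff G K ≤ adjDiff G H + adjDiff H K := by
  classical
  unfold adjDiff
  refine le_trans (Finset.card_le_card ?_) (Finset.card_union_le _ _)
  intro p hp
  simp only [Finset.mem_filter, Finset.mem_univ, true_and, Finset.mem_union] at hp ⊢
  tauto

theorem adjDiff_of_le {G H : SimpleGraph V} (h : H ≤ G) :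
    adjDiff G H = ∑ x, ((G \ H).nbrs x).card := by
  classical
  rw [sum_card_nbrs_eq_cut, cut, adjDiff]
  congr 1
  ext p
  have := @h p.1 p.2
  simp only [Finset.mem_filter, Finset.mem_univ, true_and, Finset.mem_product, sdiff_adj]
  tauto

theorem adjDiff_comm (G H : SimpleGraph V) : adjDiff G H = adjDiff H G := by
  unfold adjDiff
  congr 1
  ext p
  simp only [Finset.mem_filter, Finset.mem_univ, true_and]
  tauto

variable [DecidableEq V]

theorem card_nbrs_sup {G H : SimpleGraph V} (h : ∀ x y, G.Adj x y → ¬ H.Adj x y) (x : V) :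
    ((G ⊔ H).nbrs x).card = (G.nbrs x).card + (H.nbrs x).card := by
  rw [← Finset.card_union_of_disjoint]
  · congr 1
    ext y
    simp [mem_nbrs]
  · rw [Finset.disjoint_left]
    intro y hy hy'
    exact h _ _ (mem_nbrs.mp hy) (mem_nbrs.mp hy')

theorem card_nbrs_edge {a b : V} (hab : a ≠ b) (x : V) :
    ((edge a b).nbrs x).card = (if x = a then 1 else 0) + (if x = b then 1 else 0) := by
  by_cases ha : x = a
  · subst ha
    rw [if_pos rfl, if_neg hab, Finset.card_eq_one]
    refine ⟨b, ?_⟩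
    ext y
    rw [mem_nbrs, edge_adj, Finset.mem_singleton]
    constructor
    · rintro ⟨⟨-, h⟩ | ⟨h, -⟩, -⟩
      · exact h
      · exact absurd h hab
    · rintro rfl
      exact ⟨Or.inl ⟨rfl, rfl⟩, hab⟩
  · by_cases hb : x = b
    · subst hb
      rw [if_neg ha, if_pos rfl, Finset.card_eq_one]
      refine ⟨a, ?_⟩
      ext y
      rw [mem_nbrs, edge_adj, Finset.mem_singleton]
      constructor
      · rintro ⟨⟨h, -⟩ | ⟨-, h⟩, -⟩
        · exact absurd h ha
        · exact h
      · rintro rfl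
        exact ⟨Or.inr ⟨rfl, rfl⟩, ha⟩
    · rw [if_neg ha, if_neg hb, Finset.card_eq_zero, Finset.eq_empty_iff_forall_notMem]
      intro y hy
      rw [mem_nbrs, edge_adj] at hy
      rcases hy.1 with ⟨h, -⟩ | ⟨h, -⟩
      · exact ha h
      · exact hb h

theorem cut_edge {a b : V} (hab : a ≠ b) (F : Finset V) :
    (edge a b).cut F Fᶜ = separates F a b := by
  classical
  unfold cut separates
  split_ifs with h
  · rw [Finset.card_eq_zero, Finset.eq_empty_iff_forall_notMem]
    rintro ⟨x, y⟩ hp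
    simp only [Finset.mem_filter, Finset.mem_product, Finset.mem_compl, edge_adj] at hp
    obtain ⟨⟨h1, h2⟩, ⟨rfl, rfl⟩ | ⟨rfl, rfl⟩, -⟩ := hp
    · exact h2 (h.mp h1)
    · exact h2 (h.mpr h1)
  · rw [Finset.card_eq_one]
    by_cases ha : a ∈ F
    · refine ⟨(a, b), ?_⟩
      have hb : b ∉ F := fun hb => h ⟨fun _ => hb, fun _ => ha⟩
      ext ⟨x, y⟩
      simp only [Finset.mem_filter, Finset.mem_product, Finset.mem_compl, edge_adj,
        Finset.mem_singleton, Prod.mk.injEq]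
      constructor
      · rintro ⟨⟨h1, h2⟩, ⟨rfl, rfl⟩ | ⟨rfl, rfl⟩, -⟩
        · exact ⟨rfl, rfl⟩
        · exact absurd h1 hb
      · rintro ⟨rfl, rfl⟩
        exact ⟨⟨ha, hb⟩, Or.inl ⟨rfl, rfl⟩, hab⟩
    · refine ⟨(b, a), ?_⟩
      have hb : b ∈ F := by
        by_contra hb
        exact h ⟨fun h => absurd h ha, fun h => absurd h hb⟩
      ext ⟨x, y⟩
      simp only [Finset.mem_filter, Finset.mem_product, Finset.mem_compl, edge_adj,
        Finset.mem_singleton, Prod.mk.injEq]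
      constructor
      · rintro ⟨⟨h1, h2⟩, ⟨rfl, rfl⟩ | ⟨rfl, rfl⟩, -⟩
        · exact absurd h1 ha
        · exact ⟨rfl, rfl⟩
      · rintro ⟨rfl, rfl⟩
        exact ⟨⟨hb, ha⟩, Or.inr ⟨rfl, rfl⟩, hab.symm⟩

theorem card_nbrs_sup_edge {H : SimpleGraph V} {a b : V} (hab : a ≠ b) (h : ¬ H.Adj a b) (x : V) :
    ((H ⊔ edge a b).nbrs x).card =
      (H.nbrs x).card + ((if x = a then 1 else 0) + (if x = b then 1 else 0)) := by
  rw [card_nbrs_sup (not_edge_adj h), card_nbrs_edge hab]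

theorem cut_sup_edge {H : SimpleGraph V} {a b : V} (hab : a ≠ b) (h : ¬ H.Adj a b) (F : Finset V) :
    (H ⊔ edge a b).cut F Fᶜ = H.cut F Fᶜ + separates F a b := by
  rw [cut_sup (not_edge_adj h), cut_edge hab]

theorem adjDiff_sup_edge (H : SimpleGraph V) {a b : V} : adjDiff H (H ⊔ edge a b) ≤ 2 := by
  classical
  unfold adjDiff
  refine le_trans (Finset.card_le_card (t := {(a, b), (b, a)}) ?_) Finset.card_le_two
  rintro ⟨x, y⟩ hp
  simp only [Finset.mem_filter, Finset.mem_univ, true_and, sup_adj, edge_adj] at hp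
  simp only [Finset.mem_insert, Finset.mem_singleton, Prod.mk.injEq]
  tauto

/-- Replacing the edge `uv` by the edges `xu` and `yv`. -/
theorem exists_edge_swap {H : SimpleGraph V} {x y u v : V} (huv : H.Adj u v)
    (hux : u ≠ x) (huy : u ≠ y) (hvy : v ≠ y) (hxu : ¬ H.Adj x u) (hyv : ¬ H.Adj y v) :
    ∃ H' : SimpleGraph V, (∀ z, (H'.nbrs z).card = (H.nbrs z).card +
        ((if z = x then 1 else 0) + (if z = y then 1 else 0))) ∧
      (∀ F : Finset V, H'.cut F Fᶜ + separates F u v =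
        H.cut F Fᶜ + (separates F x u + separates F y v)) ∧
      adjDiff H H' ≤ 6 ∧ H'.Adj x u ∧
      (∀ a b, H.Adj a b → ¬ (a = u ∧ b = v) → ¬ (a = v ∧ b = u) → H'.Adj a b) ∧
      (∀ a b, H'.Adj a b → H.Adj a b ∨ (a = x ∧ b = u ∨ a = u ∧ b = x) ∨
        (a = y ∧ b = v ∨ a = v ∧ b = y)) := by
  set H₀ : SimpleGraph V := H \ edge u v with hH₀
  have h0 : ¬ H₀.Adj u v := by
    rw [hH₀, sdiff_adj, edge_adj]; exact fun h => h.2 ⟨Or.inl ⟨rfl, rfl⟩, huv.ne⟩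
  have hH : H = H₀ ⊔ edge u v := by
    ext a b
    rw [hH₀, sup_adj, sdiff_adj]
    constructor
    · intro h; by_cases h' : (edge u v).Adj a b
      · exact Or.inr h'
      · exact Or.inl ⟨h, h'⟩
    · rintro (h | h)
      · exact h.1
      · rw [edge_adj] at h
        obtain ⟨⟨rfl, rfl⟩ | ⟨rfl, rfl⟩, -⟩ := h
        · exact huv
        · exact huv.symm
  have h1 : ¬ H₀.Adj x u := fun h => hxu h.1
  have h2 : ¬ (H₀ ⊔ edge x u).Adj y v := by
    rw [sup_adj, edge_adj]
    rintro (h | ⟨⟨rfl, h⟩ | ⟨h, -⟩, -⟩)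
    · exact hyv h.1
    · exact huv.ne h.symm
    · exact huy h.symm
  refine ⟨H₀ ⊔ edge x u ⊔ edge y v, fun z => ?_, fun F => ?_, ?_, ?_, ?_, ?_⟩
  · rw [card_nbrs_sup_edge hvy.symm h2, card_nbrs_sup_edge hux.symm h1]
    conv_rhs => rw [hH, card_nbrs_sup_edge huv.ne h0]
    ring
  · rw [cut_sup_edge hvy.symm h2, cut_sup_edge hux.symm h1]
    conv_rhs => rw [hH, cut_sup_edge huv.ne h0]
    ring
  · have e1 : adjDiff H H₀ ≤ 2 := by
      rw [adjDiff_comm]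
      conv_lhs => rw [hH]
      exact adjDiff_sup_edge H₀
    have e2 := adjDiff_sup_edge H₀ (a := x) (b := u)
    have e3 := adjDiff_sup_edge (H₀ ⊔ edge x u) (a := y) (b := v)
    have e4 := adjDiff_triangle H H₀ (H₀ ⊔ edge x u)
    have e5 := adjDiff_triangle H (H₀ ⊔ edge x u) (H₀ ⊔ edge x u ⊔ edge y v)
    omega
  · rw [sup_adj, sup_adj, edge_adj]
    exact Or.inl (Or.inr ⟨Or.inl ⟨rfl, rfl⟩, hux.symm⟩)
  · intro a b hab h3 h4
    rw [sup_adj, sup_adj, hH₀, sdiff_adj, edge_adj]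
    refine Or.inl (Or.inl ⟨hab, fun h => ?_⟩)
    rcases h.1 with h | h
    · exact h3 h
    · exact h4 h
  · intro a b hab
    rw [sup_adj, sup_adj, edge_adj, edge_adj] at hab
    rcases hab with (h | h) | h
    · exact Or.inl h.1
    · exact Or.inr (Or.inl h.1)
    · exact Or.inr (Or.inr h.1)

/-- Edges touching `Z` contribute at most `2 |Z| d` to the degree sum. -/
theorem exists_adj_avoiding (H : SimpleGraph V) {d : ℕ} (hd : ∀ x, (H.nbrs x).card ≤ d)
    (Z : Finset V) (h : 2 * (Z.card * d) < ∑ x, (H.nbrs x).card) :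
    ∃ u v, H.Adj u v ∧ u ∉ Z ∧ v ∉ Z := by
  classical
  by_contra! hcon
  have h1 : H.cut Z Finset.univ ≤ Z.card * d := cut_le_mul H Z _ fun x _ => hd x
  have h2 : H.cut Finset.univ Z ≤ Z.card * d := by rw [cut_comm]; exact h1
  have h3 : H.cut Finset.univ Finset.univ ≤ H.cut Z Finset.univ + H.cut Finset.univ Z := by
    unfold cut
    refine le_trans (Finset.card_le_card ?_) (Finset.card_union_le _ _)
    rintro ⟨x, y⟩ hp
    simp only [Finset.mem_filter, Finset.mem_product, Finset.mem_union,
      Finset.mem_univ, true_and, and_true] at hp ⊢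
    have := hcon x y hp
    tauto
  rw [sum_card_nbrs_eq_cut] at h
  omega

theorem separates_le_cut {H : SimpleGraph V} {a b : V} (h : H.Adj a b) (F : Finset V) :
    separates F a b ≤ H.cut F Fᶜ := by
  rw [← cut_edge h.ne]
  refine cut_mono (fun x _ y _ hxy => ?_) subset_rfl subset_rfl
  rw [edge_adj] at hxy
  obtain ⟨⟨rfl, rfl⟩ | ⟨rfl, rfl⟩, -⟩ := hxy
  · exact h
  · exact h.symm

/-- A graph of maximal degree at most `d` with few missing degrees can be completed to a `d`-regular
graph on `U`, changing few edges and keeping edge boundaries up to a factor. -/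
theorem exists_regular_rewiring {U W : Finset V} (hWU : W ⊆ U) {d : ℕ} (hd2 : 2 ≤ d) (k : ℕ) :
    ∀ H : SimpleGraph V, (∀ x y, H.Adj x y → x ∈ U) → (∀ x, (H.nbrs x).card ≤ d) →
      ∑ x ∈ U, (d - (H.nbrs x).card) = 2 * k →
      (∀ w ∈ W, H.nbrs w = ∅ ∨ ∃ q ∈ U \ W, H.Adj w q) →
      (0 < k → 2 * k + 2 * d * W.card + 4 * d * (d + 1) < d * U.card) →
      ∃ H' : SimpleGraph V, (∀ x y, H'.Adj x y → x ∈ U) ∧ (∀ x ∈ U, (H'.nbrs x).card = d) ∧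
        (∀ w ∈ W, ∃ q ∈ U \ W, H'.Adj w q) ∧ adjDiff H H' ≤ 6 * k ∧
        ∀ F : Finset V, H.cut F Fᶜ ≤ 2 ^ min (2 * k) d * H'.cut F Fᶜ := by
  classical
  induction k with
  | zero =>
    intro H hU hd hsum hW _
    rw [mul_zero, Finset.sum_eq_zero_iff] at hsum
    have hreg : ∀ x ∈ U, (H.nbrs x).card = d := fun x hx => by
      have := hsum x hx
      have := hd x
      omega
    refine ⟨H, hU, hreg, fun w hw => ?_, by simp, fun F => by simp⟩
    rcases hW w hw with h | h
    · have := hreg w (hWU hw)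
      rw [h, Finset.card_empty] at this
      omega
    · exact h
  | succ k ih =>
    intro H hU hd hsum hW hsize
    specialize hsize (Nat.succ_pos k)
    have hdegsum : d * U.card ≤ ∑ x, (H.nbrs x).card + 2 * (k + 1) := by
      calc d * U.card = ∑ _x ∈ U, d := by rw [Finset.sum_const, smul_eq_mul, mul_comm]
        _ ≤ ∑ x ∈ U, ((H.nbrs x).card + (d - (H.nbrs x).card)) :=
            Finset.sum_le_sum fun x _ => by omega
        _ = ∑ x ∈ U, (H.nbrs x).card + 2 * (k + 1) := by rw [Finset.sum_add_distrib, hsum]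
        _ ≤ _ := by
            gcongr
            exact Finset.subset_univ _
    suffices step : ∃ (H₁ : SimpleGraph V) (x y : V), x ∈ U ∧ y ∈ U ∧
        (∀ a b, H₁.Adj a b → a ∈ U) ∧ (∀ z, (H₁.nbrs z).card ≤ d) ∧
        (∀ z, (H₁.nbrs z).card = (H.nbrs z).card +
          ((if z = x then 1 else 0) + (if z = y then 1 else 0))) ∧
        (∀ w ∈ W, H₁.nbrs w = ∅ ∨ ∃ q ∈ U \ W, H₁.Adj w q) ∧ adjDiff H H₁ ≤ 6 ∧
        ((∀ F : Finset V, H.cut F Fᶜ ≤ H₁.cut F Fᶜ) ∨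
          (2 * k + 2 ≤ d ∧ ∀ F : Finset V, H.cut F Fᶜ ≤ 2 * H₁.cut F Fᶜ)) by
      obtain ⟨H₁, x, y, hx, hy, hU₁, hd₁, hdeg₁, hW₁, hdiff, hcut⟩ := step
      have hsum₁ : ∑ z ∈ U, (d - (H₁.nbrs z).card) = 2 * k := by
        have e : ∑ z ∈ U, (d - (H.nbrs z).card) = ∑ z ∈ U, ((d - (H₁.nbrs z).card) +
            ((if z = x then 1 else 0) + (if z = y then 1 else 0))) := by
          refine Finset.sum_congr rfl fun z _ => ?_
          have h1 := hdeg₁ z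
          have h2 := hd₁ z
          omega
        rw [hsum, Finset.sum_add_distrib, Finset.sum_add_distrib, Finset.sum_ite_eq',
          Finset.sum_ite_eq', if_pos hx, if_pos hy] at e
        omega
      obtain ⟨H', h1, h2, h3, h4, h5⟩ := ih H₁ hU₁ hd₁ hsum₁ hW₁ (fun _ => by omega)
      refine ⟨H', h1, h2, h3, ?_, fun F => ?_⟩
      · have := adjDiff_triangle H H₁ H'
        omega
      · rcases hcut with hcut | ⟨hk, hcut⟩
        · refine (hcut F).trans ((h5 F).trans (Nat.mul_le_mul_right _ ?_))
          exact Nat.pow_le_pow_right two_pos (min_le_min (by omega) le_rfl)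
        · refine (hcut F).trans ((Nat.mul_le_mul_left 2 (h5 F)).trans ?_)
          rw [← mul_assoc, ← pow_succ']
          refine Nat.mul_le_mul_right _ (Nat.pow_le_pow_right two_pos ?_)
          omega
    -- A vertex `x` missing at least two degrees is inserted into an edge `uv` far from it. Any set
    -- separating `u` from `v` separates `x` from one of them, so no cut decreases. As `u` lies
    -- outside `W`, a vertex of `W` treated this way acquires a neighbor in `U \ W`.
    by_cases hA : ∃ x ∈ U, (H.nbrs x).card + 2 ≤ d
    · obtain ⟨x, hx, hdx⟩ := hA
      obtain ⟨u, v, huv, hu, hv⟩ := exists_adj_avoiding H hd (W ∪ insert x (H.nbrs x)) (by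
        have h1 : (W ∪ insert x (H.nbrs x)).card ≤ W.card + (d + 1) :=
          (Finset.card_union_le _ _).trans (Nat.add_le_add_left
            ((Finset.card_insert_le _ _).trans (Nat.add_le_add_right (hd x) 1)) _)
        have h2 := Nat.mul_le_mul_right d h1
        nlinarith)
      simp only [Finset.mem_union, Finset.mem_insert, mem_nbrs, not_or] at hu hv
      obtain ⟨H₁, hdeg, hcut, hdiff, hadj, hkeep, hnew⟩ := exists_edge_swap huv hu.2.1 hu.2.1
        hv.2.1 hu.2.2 hv.2.2
      have huU := hU u v huv
      have hvU := hU v u huv.symm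
      refine ⟨H₁, x, x, hx, hx, fun a b hab => ?_, fun z => ?_, hdeg, fun w hw => ?_, hdiff,
        Or.inl fun F => ?_⟩
      · rcases hnew a b hab with h | (⟨rfl, -⟩ | ⟨rfl, -⟩) | (⟨rfl, -⟩ | ⟨rfl, -⟩)
        · exact hU a b h
        all_goals assumption
      · rw [hdeg]
        have := hd z
        split_ifs with h
        · subst h; omega
        · omega
      · by_cases hwx : w = x
        · subst hwx
          exact Or.inr ⟨u, Finset.mem_sdiff.mpr ⟨huU, hu.1⟩, hadj⟩
        · rcases hW w hw with h | ⟨q, hq, hwq⟩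
          · left
            rw [← Finset.card_eq_zero, hdeg, h]
            simp [hwx]
          · refine Or.inr ⟨q, hq, hkeep w q hwq ?_ ?_⟩
            · rintro ⟨rfl, -⟩; exact hu.1 hw
            · rintro ⟨rfl, -⟩; exact hv.1 hw
      · have h1 := hcut F
        have h2 := separates_triangle F u x v
        rw [separates_comm F u x] at h2
        omega
    push Not at hA
    -- Every vertex now misses at most one degree, and `2 ≤ d`, so no vertex of `W` is isolated any
    -- more.
    have hnb : ∀ w ∈ W, ∃ q ∈ U \ W, H.Adj w q := by
      intro w hw
      rcases hW w hw with h | h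
      · have := hA w (hWU hw)
        rw [h, Finset.card_empty] at this
        omega
      · exact h
    by_cases hB : ∃ x ∈ U, ∃ y ∈ U, (H.nbrs x).card < d ∧ (H.nbrs y).card < d ∧ x ≠ y ∧ ¬ H.Adj x y
    · obtain ⟨x, hx, y, hy, hdx, hdy, hxy, hadj⟩ := hB
      refine ⟨H ⊔ edge x y, x, y, hx, hy, fun a b hab => ?_, fun z => ?_,
        card_nbrs_sup_edge hxy hadj, fun w hw => ?_, (adjDiff_sup_edge H).trans (by omega),
        Or.inl fun F => ?_⟩
      · rw [sup_adj, edge_adj] at hab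
        rcases hab with h | ⟨⟨rfl, -⟩ | ⟨rfl, -⟩, -⟩
        · exact hU a b h
        all_goals assumption
      · rw [card_nbrs_sup_edge hxy hadj]
        have := hd z
        split_ifs with h h' h'
        · exact absurd (h.symm.trans h') hxy
        · subst h; omega
        · subst h'; omega
        · omega
      · obtain ⟨q, hq, hwq⟩ := hnb w hw
        exact Or.inr ⟨q, hq, Or.inl hwq⟩
      · rw [cut_sup_edge hxy hadj]
        exact Nat.le_add_right _ _
    push Not at hB
    -- In the last case the deficient vertices each miss one degree and form a clique, so there are
    -- at most `d` of them. Only then does a swap cost a factor 2 in cuts, which bounds the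
    -- accumulated factor by `2 ^ d`.
    set T : Finset V := U.filter fun z => (H.nbrs z).card < d with hT
    have hTcard : T.card = 2 * (k + 1) := by
      rw [← hsum, hT, Finset.card_filter]
      refine Finset.sum_congr rfl fun z hz => ?_
      have := hA z hz
      have := hd z
      split_ifs <;> omega
    obtain ⟨x, hxT, y, hyT, hxy⟩ := Finset.one_lt_card.mp (show 1 < T.card by omega)
    have hx := Finset.mem_filter.mp hxT
    have hy := Finset.mem_filter.mp hyT
    have hadj : H.Adj x y := hB x hx.1 y hy.1 hx.2 hy.2 hxy
    have hTd : 2 * k + 2 ≤ d := by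
      have h1 : T.erase x ⊆ H.nbrs x := fun z hz => by
        rw [Finset.mem_erase] at hz
        have hz2 := Finset.mem_filter.mp hz.2
        exact mem_nbrs.mpr (hB x hx.1 z hz2.1 hx.2 hz2.2 hz.1.symm)
      have h2 := Finset.card_le_card h1
      rw [Finset.card_erase_of_mem hxT] at h2
      omega
    obtain ⟨u, v, huv, hu, hv⟩ := exists_adj_avoiding H hd
      (W ∪ (insert x (H.nbrs x) ∪ insert y (H.nbrs y))) (by
        have h0 : ∀ z, (insert z (H.nbrs z)).card ≤ d + 1 := fun z =>
          (Finset.card_insert_le _ _).trans (Nat.add_le_add_right (hd z) 1)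
        have h1 : (W ∪ (insert x (H.nbrs x) ∪ insert y (H.nbrs y))).card ≤
            W.card + ((d + 1) + (d + 1)) :=
          (Finset.card_union_le _ _).trans (Nat.add_le_add_left
            ((Finset.card_union_le _ _).trans (Nat.add_le_add (h0 x) (h0 y))) _)
        have h2 := Nat.mul_le_mul_right d h1
        nlinarith)
    simp only [Finset.mem_union, Finset.mem_insert, mem_nbrs, not_or] at hu hv
    obtain ⟨huW, ⟨hux, hxu⟩, ⟨huy, hyu⟩⟩ := hu
    obtain ⟨hvW, ⟨hvx, hxv⟩, ⟨hvy, hyv⟩⟩ := hv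
    obtain ⟨H₁, hdeg, hcut, hdiff, -, hkeep, hnew⟩ := exists_edge_swap huv hux huy hvy hxu hyv
    have huU := hU u v huv
    have hvU := hU v u huv.symm
    refine ⟨H₁, x, y, hx.1, hy.1, fun a b hab => ?_, fun z => ?_, hdeg, fun w hw => ?_, hdiff,
      Or.inr ⟨hTd, fun F => ?_⟩⟩
    · rcases hnew a b hab with h | (⟨rfl, -⟩ | ⟨rfl, -⟩) | (⟨rfl, -⟩ | ⟨rfl, -⟩)
      · exact hU a b h
      · exact hx.1
      · exact huU
      · exact hy.1
      · exact hvU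
    · rw [hdeg]
      have := hd z
      split_ifs with h h' h'
      · exact absurd (h.symm.trans h') hxy
      · subst h; omega
      · subst h'; omega
      · omega
    · obtain ⟨q, hq, hwq⟩ := hnb w hw
      refine Or.inr ⟨q, hq, hkeep w q hwq ?_ ?_⟩
      · rintro ⟨rfl, -⟩; exact huW hw
      · rintro ⟨rfl, -⟩; exact hvW hw
    -- The removed edge `uv` is replaced by the path `u, x, y, v` through the surviving edge `xy`; a
    -- cut can drop by at most the contribution of `xy`, which the new cut still contains.
    · have h1 := hcut F
      have h2 := separates_triangle F u x v
      have h3 := separates_triangle F x y v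
      rw [separates_comm F u x] at h2
      have h4 : H₁.Adj x y := hkeep x y hadj (fun h => hux h.1.symm) (fun h => hvx h.1.symm)
      have h5 := separates_le_cut h4 F
      omega

end Edit

end SimpleGraph

/-! ### Stability of expansion, and parity correction -/

namespace SimpleGraph

section Within

variable {V : Type u}

/-- The subgraph of the edges inside `A`. -/
def within (G : SimpleGraph V) (A : Finset V) : SimpleGraph V where
  Adj x y := G.Adj x y ∧ x ∈ A ∧ y ∈ A
  symm := ⟨fun _ _ h => ⟨h.1.symm, h.2.symm⟩⟩
  loopless := ⟨fun _ h => h.1.ne rfl⟩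

theorem within_le (G : SimpleGraph V) (A : Finset V) : G.within A ≤ G := fun _ _ h => h.1

theorem cut_within {G : SimpleGraph V} {A F B : Finset V} (hF : F ⊆ A) (hB : B ⊆ A) :
    (G.within A).cut F B = G.cut F B :=
  le_antisymm (cut_mono (fun _ _ _ _ h => h.1) subset_rfl subset_rfl)
    (cut_mono (fun _ hx _ hy h => ⟨h, hF hx, hB hy⟩) subset_rfl subset_rfl)

variable [Fintype V]

theorem even_sum_card_nbrs (G : SimpleGraph V) : Even (∑ x, (G.nbrs x).card) := by
  classical
  have h := G.sum_degrees_eq_twice_card_edges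
  have e : ∑ x, (G.nbrs x).card = ∑ x, G.degree x := by
    refine Finset.sum_congr rfl fun x _ => ?_
    rw [← card_neighborFinset_eq_degree]
    congr 1
    ext y
    simp [mem_nbrs]
  rw [e, h]
  exact even_two_mul _

theorem nbrs_within_of_notMem (G : SimpleGraph V) {A : Finset V} {x : V} (hx : x ∉ A) :
    (G.within A).nbrs x = ∅ := by
  rw [Finset.eq_empty_iff_forall_notMem]
  exact fun y hy => hx (mem_nbrs.mp hy).2.1

theorem even_sum_card_nbrs_within (G : SimpleGraph V) (A : Finset V) :
    Even (∑ x ∈ A, ((G.within A).nbrs x).card) := by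
  have h := even_sum_card_nbrs (G.within A)
  rwa [← Finset.sum_subset (Finset.subset_univ A)] at h
  intro x _ hx
  rw [nbrs_within_of_notMem G hx, Finset.card_empty]

end Within

section Core

variable {V : Type u} [Fintype V] [DecidableEq V]

/-- Expansion survives a rewiring which attaches the few vertices of `W`. -/
theorem card_le_mul_cut_of_rewiring {H H' : SimpleGraph V} {U W : Finset V} {d : ℕ}
    {γ K : ℝ} (hγ : 0 < γ) (hK : 0 ≤ K)
    (hexp : ∀ F ⊆ U \ W, 2 * F.card ≤ (U \ W).card → γ * F.card ≤ H.cut F ((U \ W) \ F))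
    (hcut : ∀ F : Finset V, (H.cut F Fᶜ : ℝ) ≤ K * H'.cut F Fᶜ)
    (hd : ∀ x, (H'.nbrs x).card ≤ d) (hW : ∀ w ∈ W, ∃ q ∈ U \ W, H'.Adj w q)
    (hWU : W ⊆ U) (hWcard : 2 * W.card ≤ (U \ W).card) {F : Finset V} (hF : F ⊆ U)
    (hF2 : 2 * F.card ≤ U.card) :
    (F.card : ℝ) ≤ ((d + 3) * (K / γ) + 1) * H'.cut F Fᶜ := by
  classical
  set Q := U \ W with hQ
  set FQ := F \ W with hFQ
  set c : ℝ := (H'.cut F Fᶜ : ℝ) with hc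
  have hc0 : 0 ≤ c := by positivity
  have hFQQ : FQ ⊆ Q := Finset.sdiff_subset_sdiff hF subset_rfl
  have hUcard : Q.card + W.card = U.card := Finset.card_sdiff_add_card_eq_card hWU
  have hFW : F.card = FQ.card + (F ∩ W).card := (Finset.card_sdiff_add_card_inter F W).symm
  have hle : (H.cut FQ (Q \ FQ) : ℝ) ≤ K * c := by
    refine le_trans (Nat.cast_le.mpr ?_) (hcut F)
    refine cut_mono (fun _ _ _ _ h => h) Finset.sdiff_subset fun x hx => ?_
    simp only [hQ, hFQ, Finset.mem_sdiff, Finset.mem_compl] at hx ⊢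
    tauto
  have hKγ : 0 ≤ K / γ := by positivity
  by_cases h : 2 * FQ.card ≤ Q.card
  · have h1 : (FQ.card : ℝ) ≤ K / γ * c := by
      rw [div_mul_eq_mul_div, le_div_iff₀ hγ]
      linarith [hexp FQ hFQQ h]
    choose! q hq hqadj using hW
    -- Each attached vertex in `F` has a neighbor outside `W`: that neighbor lies in `FQ`, which
    -- absorbs at most `d` such vertices per element, or the connecting edge crosses the cut.
    have h2 : (F ∩ W).card ≤ FQ.card * d + H'.cut F Fᶜ := by
      rw [← Finset.card_filter_add_card_filter_not (s := F ∩ W) (fun w => q w ∈ F)]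
      refine Nat.add_le_add ?_ ?_
      · refine le_trans (Finset.card_le_card (t := FQ.biUnion fun z => H'.nbrs z) ?_)
          (Finset.card_biUnion_le_card_mul _ _ _ fun z _ => hd z)
        intro w hw
        rw [Finset.mem_filter, Finset.mem_inter] at hw
        rw [Finset.mem_biUnion]
        exact ⟨q w, Finset.mem_sdiff.mpr ⟨hw.2, (Finset.mem_sdiff.mp (hq w hw.1.2)).2⟩,
          mem_nbrs.mpr (hqadj w hw.1.2).symm⟩
      · refine Finset.card_le_card_of_injOn (fun w => (w, q w)) ?_
          (fun w _ w' _ e => congrArg Prod.fst e)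
        intro w hw
        simp only [Finset.coe_filter, Finset.mem_inter, Set.mem_ofPred_eq] at hw
        simp only [Finset.coe_filter, Finset.mem_product, Finset.mem_compl, Set.mem_ofPred_eq]
        exact ⟨⟨hw.1.1, hw.2⟩, hqadj w hw.1.2⟩
    have h2' : ((F ∩ W).card : ℝ) ≤ FQ.card * d + c := by rw [hc]; exact_mod_cast h2
    have hFW' : (F.card : ℝ) = FQ.card + (F ∩ W).card := by exact_mod_cast hFW
    have h3 : (FQ.card : ℝ) * (d + 1) ≤ K / γ * c * (d + 1) := by gcongr
    have h4 : 0 ≤ K / γ * c := by positivity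
    calc (F.card : ℝ) ≤ FQ.card * (d + 1) + c := by rw [hFW']; linarith
      _ ≤ K / γ * c * (d + 1) + c := by linarith
      _ ≤ _ := by linarith
  · have hR : (Q \ FQ).card + FQ.card = Q.card := Finset.card_sdiff_add_card_eq_card hFQQ
    have h0 := hexp (Q \ FQ) Finset.sdiff_subset (by omega)
    rw [sdiff_sdiff_eq_self hFQQ, cut_comm] at h0
    have h1 : ((Q \ FQ).card : ℝ) ≤ K / γ * c := by
      rw [div_mul_eq_mul_div, le_div_iff₀ hγ]
      linarith
    -- As `W` is at most half of `Q`, `F` has at most three quarters of `|Q|` vertices, leaving at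
    -- least a quarter of `Q` outside.
    have h2 : F.card ≤ 3 * (Q \ FQ).card := by omega
    have h2' : (F.card : ℝ) ≤ 3 * (Q \ FQ).card := by exact_mod_cast h2
    have h4 : 0 ≤ K / γ * c := by positivity
    have h5 : 0 ≤ (d : ℝ) * (K / γ * c) := by positivity
    linarith

/-- Passing from a union of components `A` to a subset `A'` costs at most `d` missing degrees per
removed vertex. -/
theorem sum_deficit_within_le {H : SimpleGraph V} {A A' : Finset V} {d : ℕ} (hA' : A' ⊆ A)
    (hd : ∀ x, (H.nbrs x).card ≤ d) (hclosed : ∀ x ∈ A, ∀ y, H.Adj x y → y ∈ A) :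
    ∑ x ∈ A', (d - ((H.within A').nbrs x).card) ≤
      ∑ x ∈ A, (d - (H.nbrs x).card) + d * (A \ A').card := by
  classical
  have h1 : ∀ x ∈ A', d - ((H.within A').nbrs x).card ≤
      (d - (H.nbrs x).card) + ((A \ A').filter fun y => H.Adj x y).card := by
    intro x hx
    have : (H.nbrs x).card ≤ ((H.within A').nbrs x).card +
        ((A \ A').filter fun y => H.Adj x y).card := by
      refine le_trans (Finset.card_le_card ?_) (Finset.card_union_le _ _)
      intro y hy
      rw [mem_nbrs] at hy
      rw [Finset.mem_union, mem_nbrs, Finset.mem_filter, Finset.mem_sdiff]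
      by_cases h : y ∈ A'
      · exact Or.inl ⟨hy, hx, h⟩
      · exact Or.inr ⟨⟨hclosed x (hA' hx) y hy, h⟩, hy⟩
    omega
  refine (Finset.sum_le_sum h1).trans ?_
  rw [Finset.sum_add_distrib, ← cut_eq_sum]
  refine Nat.add_le_add (Finset.sum_le_sum_of_subset hA') ?_
  rw [cut_comm, mul_comm]
  exact cut_le_mul H _ _ fun x _ => hd x

theorem connected_of_forall_exists_adj {α : Type*} [Nonempty α] (G : SimpleGraph α)
    (h : ∀ F : Set α, F.Nonempty → Fᶜ.Nonempty → ∃ x ∈ F, ∃ y ∉ F, G.Adj x y) : G.Connected := by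
  refine connected_iff_exists_forall_reachable G |>.mpr ⟨Classical.arbitrary α, ?_⟩
  by_contra! hcon
  obtain ⟨z, hz⟩ := hcon
  obtain ⟨x, hx, y, hy, hxy⟩ := h {y | G.Reachable (Classical.arbitrary α) y}
    ⟨_, Reachable.refl _⟩ ⟨z, hz⟩
  exact hy (Reachable.trans hx hxy.reachable)

/-- An expander with at least two vertices contains a vertex whose removal leaves an expander. -/
theorem exists_mem_erase_expanding {H : SimpleGraph V} {A : Finset V} {d : ℕ} (hd1 : 1 ≤ d)
    (hd : ∀ x, (H.nbrs x).card ≤ d) {γ : ℝ} (hγ : 0 < γ)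
    (hexp : ∀ F ⊆ A, 2 * F.card ≤ A.card → γ * F.card ≤ H.cut F (A \ F)) (hA : 1 < A.card) :
    ∃ v ∈ A, ∀ F ⊆ A.erase v, 2 * F.card ≤ (A.erase v).card →
      γ / (2 * d) * F.card ≤ H.cut F ((A.erase v) \ F) := by
  classical
  have hne : Nonempty (A : Set V) := by
    obtain ⟨a, ha, -⟩ := Finset.one_lt_card.mp hA
    exact ⟨⟨a, ha⟩⟩
  have hnt : Nontrivial (A : Set V) := by
    obtain ⟨a, ha, b, hb, hab⟩ := Finset.one_lt_card.mp hA
    exact ⟨⟨a, ha⟩, ⟨b, hb⟩, fun h => hab (congrArg Subtype.val h)⟩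
  have hdr : (1 : ℝ) ≤ d := by exact_mod_cast hd1
  have hpos : ∀ F ⊆ A, F.Nonempty → 2 * F.card ≤ A.card → ∃ x ∈ F, ∃ y ∈ A \ F, H.Adj x y := by
    intro F hF hFne hF2
    by_contra! hcon
    have h0 : H.cut F (A \ F) = 0 := by
      unfold cut
      rw [Finset.card_eq_zero, Finset.filter_eq_empty_iff]
      intro p hp
      rw [Finset.mem_product] at hp
      exact hcon _ hp.1 _ hp.2
    have h1 := hexp F hF hF2
    rw [h0] at h1
    have : (0 : ℝ) < F.card := by exact_mod_cast hFne.card_pos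
    have := mul_pos hγ this
    push_cast at h1
    linarith
  have hconn : (H.induce (A : Set V)).Connected := by
    refine connected_of_forall_exists_adj _ fun F hF hFc => ?_
    set F' : Finset V := A.filter fun x => ∃ h : x ∈ (A : Set V), (⟨x, h⟩ : (A : Set V)) ∈ F with hF'
    have hmem : ∀ x : (A : Set V), (x : V) ∈ F' ↔ x ∈ F := fun x => by
      rw [hF', Finset.mem_filter]
      exact ⟨fun h => h.2.2, fun h => ⟨x.2, x.2, h⟩⟩
    have hF'A : F' ⊆ A := Finset.filter_subset _ _
    by_cases h2 : 2 * F'.card ≤ A.card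
    · obtain ⟨a, ha⟩ := hF
      obtain ⟨x, hx, y, hy, hxy⟩ := hpos F' hF'A ⟨a, (hmem a).mpr ha⟩ h2
      rw [Finset.mem_sdiff] at hy
      exact ⟨⟨x, hF'A hx⟩, (hmem ⟨x, hF'A hx⟩).mp hx, ⟨y, hy.1⟩,
        fun h => hy.2 ((hmem ⟨y, hy.1⟩).mpr h), hxy⟩
    · obtain ⟨a, ha⟩ := hFc
      have hc := Finset.card_sdiff_add_card_eq_card hF'A
      obtain ⟨x, hx, y, hy, hxy⟩ := hpos (A \ F') Finset.sdiff_subset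
        ⟨a, Finset.mem_sdiff.mpr ⟨a.2, fun h => ha ((hmem a).mp h)⟩⟩ (by omega)
      rw [sdiff_sdiff_eq_self hF'A] at hy
      rw [Finset.mem_sdiff] at hx
      exact ⟨⟨y, hF'A hy⟩, (hmem ⟨y, hF'A hy⟩).mp hy, ⟨x, hx.1⟩,
        fun h => hx.2 ((hmem ⟨x, hx.1⟩).mpr h), hxy.symm⟩
  -- An expanding set induces a connected graph, and a finite nontrivial connected graph has a
  -- vertex whose removal keeps it connected. Removing an arbitrary vertex could destroy expansion
  -- of small sets.
  obtain ⟨v, hv⟩ := hconn.exists_connected_induce_compl_singleton_of_finite_nontrivial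
  refine ⟨v, v.2, fun F hF hF2 => ?_⟩
  rcases F.eq_empty_or_nonempty with rfl | hFne
  · simp
  have hcardE : (A.erase v).card + 1 = A.card := Finset.card_erase_add_one v.2
  have hFA : F ⊆ A := hF.trans (Finset.erase_subset _ _)
  have hone : 1 ≤ H.cut F ((A.erase v) \ F) := by
    obtain ⟨a, ha⟩ := hFne
    obtain ⟨b, hb, hbF⟩ : ∃ b ∈ A.erase v, b ∉ F := by
      by_contra! hcon
      have := Finset.card_le_card (show A.erase v ⊆ F from hcon)
      have : 0 < F.card := Finset.card_pos.mpr ⟨a, ha⟩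
      omega
    have haE := Finset.mem_erase.mp (hF ha)
    have hbE := Finset.mem_erase.mp hb
    let a' : ({v}ᶜ : Set (A : Set V)) := ⟨⟨a, haE.2⟩, fun h => haE.1 (congrArg Subtype.val h)⟩
    let b' : ({v}ᶜ : Set (A : Set V)) := ⟨⟨b, hbE.2⟩, fun h => hbE.1 (congrArg Subtype.val h)⟩
    obtain ⟨p⟩ := hv.preconnected a' b'
    obtain ⟨e, -, he1, he2⟩ := p.exists_boundary_dart {z | ((z : (A : Set V)) : V) ∈ F} ha hbF
    unfold cut
    rw [Nat.one_le_iff_ne_zero, Finset.card_ne_zero]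
    refine ⟨(((e.fst : (A : Set V)) : V), ((e.snd : (A : Set V)) : V)), ?_⟩
    rw [Finset.mem_filter, Finset.mem_product, Finset.mem_sdiff, Finset.mem_erase]
    exact ⟨⟨he1, ⟨fun h => e.snd.2 (Subtype.ext h), e.snd.1.2⟩, he2⟩, e.adj⟩
  have hone' : (1 : ℝ) ≤ H.cut F ((A.erase v) \ F) := by exact_mod_cast hone
  have hbig : γ * F.card - d ≤ H.cut F ((A.erase v) \ F) := by
    have h1 := hexp F hFA (by omega)
    have h2 : H.cut F (A \ F) ≤ H.cut F ((A.erase v) \ F) + d := by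
      have h3 : H.cut F {(v : V)} ≤ d := by
        rw [cut_comm]
        exact (cut_le_mul H _ _ fun x _ => hd x).trans (by simp)
      refine (H.cut_mono_right F ?_).trans ((H.cut_union_right_le F ((A.erase v) \ F) {(v : V)}).trans
        (Nat.add_le_add_left h3 _))
      intro x hx
      simp only [Finset.mem_sdiff, Finset.mem_union, Finset.mem_erase, Finset.mem_singleton] at hx ⊢
      tauto
    have h2' : (H.cut F (A \ F) : ℝ) ≤ H.cut F ((A.erase v) \ F) + d := by exact_mod_cast h2
    linarith
  -- The cut is at least 1 by connectedness and at least `γ |F| - d` by expansion; the first bound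
  -- suffices when `γ |F| ≤ 2d`, the second beyond that.
  rw [div_mul_eq_mul_div, div_le_iff₀ (by positivity)]
  nlinarith

/-- An expanding component contains a large expanding set of even total degree `d`, with few missing
degrees unless it is itself a `d`-regular component. -/
theorem exists_even_core {H : SimpleGraph V} {A : Finset V} {d : ℕ} (hd1 : 1 ≤ d)
    (hd : ∀ x, (H.nbrs x).card ≤ d) (hclosed : ∀ x ∈ A, ∀ y, H.Adj x y → y ∈ A) {γ : ℝ} (hγ : 0 < γ)
    (hexp : ∀ F ⊆ A, 2 * F.card ≤ A.card → γ * F.card ≤ H.cut F (A \ F)) (M : ℕ) :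
    ∃ A' ⊆ A, Even (d * A'.card) ∧
      (A \ A').card ≤ (M + 9) * ∑ x ∈ A, (d - (H.nbrs x).card) ∧
      (∀ F ⊆ A', 2 * F.card ≤ A'.card → γ / (2 * d) * F.card ≤ H.cut F (A' \ F)) ∧
      ((∀ x ∈ A', (H.nbrs x).card = d ∧ H.nbrs x ⊆ A') ∨
        (M ≤ A'.card ∧
          8 * ∑ x ∈ A', (d - ((H.within A').nbrs x).card) ≤ A'.card + 1 + 8 * d)) := by
  have hexp' : ∀ F ⊆ A, 2 * F.card ≤ A.card → γ / (2 * d) * F.card ≤ H.cut F (A \ F) :=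
    fun F hF hF2 => le_trans (mul_le_mul_of_nonneg_right (div_le_self hγ.le (by
      have : (1 : ℝ) ≤ d := by exact_mod_cast hd1
      linarith)) (Nat.cast_nonneg _)) (hexp F hF hF2)
  generalize hdef : ∑ x ∈ A, (d - (H.nbrs x).card) = δ
  rcases Nat.eq_zero_or_pos δ with rfl | hδ
  · have hreg : ∀ x ∈ A, (H.nbrs x).card = d := fun x hx => by
      have := Finset.sum_eq_zero_iff.mp hdef x hx
      have := hd x
      omega
    refine ⟨A, subset_rfl, ?_, by simp, hexp', Or.inl fun x hx => ⟨hreg x hx, fun y hy =>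
      hclosed x hx y (mem_nbrs.mp hy)⟩⟩
    have h := even_sum_card_nbrs_within H A
    have e : ∑ x ∈ A, ((H.within A).nbrs x).card = d * A.card := by
      rw [mul_comm, ← smul_eq_mul, ← Finset.sum_const]
      refine Finset.sum_congr rfl fun x hx => ?_
      rw [← hreg x hx]
      congr 1
      ext y
      rw [mem_nbrs, mem_nbrs]
      exact ⟨fun h => h.1, fun h => ⟨h, hx, hclosed x hx y h⟩⟩
    rwa [e] at h
  -- A component that is small, absolutely or compared with its positive deficit `δ`, is discarded
  -- and charged to `δ`. The `+ 2` leaves room for one removed vertex.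
  by_cases hsmall : A.card < M + 2 ∨ A.card < 8 * δ
  · refine ⟨∅, Finset.empty_subset _, by simp, ?_, fun F hF _ => ?_, Or.inl (by simp)⟩
    · rw [Finset.sdiff_empty]
      rcases hsmall with h | h
      · nlinarith
      · nlinarith
    · rw [Finset.subset_empty] at hF
      simp [hF]
  push Not at hsmall
  by_cases heven : Even (d * A.card)
  · refine ⟨A, subset_rfl, heven, by simp, hexp', Or.inr ⟨by omega, ?_⟩⟩
    have := sum_deficit_within_le (subset_refl A) hd hclosed
    rw [hdef, sdiff_self, Finset.bot_eq_empty, Finset.card_empty, mul_zero] at this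
    omega
  -- Here `d` and `|A|` are odd, so removing one vertex corrects the parity; it adds at most `d` to
  -- the deficit.
  · obtain ⟨v, hv, hvexp⟩ := exists_mem_erase_expanding hd1 hd hγ hexp (by omega)
    have hcard : (A.erase v).card + 1 = A.card := Finset.card_erase_add_one hv
    have hsd : (A \ A.erase v).card = 1 := by
      rw [Finset.sdiff_erase_self hv, Finset.card_singleton]
    refine ⟨A.erase v, Finset.erase_subset _ _, ?_, ?_, hvexp, Or.inr ⟨by omega, ?_⟩⟩
    · rw [Nat.not_even_iff_odd, Nat.odd_mul] at heven
      refine Even.mul_left ?_ d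
      have := heven.2
      rw [← hcard, Nat.odd_add_one, Nat.not_odd_iff_even] at this
      exact this
    · rw [hsd]; nlinarith
    · have := sum_deficit_within_le (Finset.erase_subset v A) hd hclosed
      rw [hdef, hsd] at this
      omega

end Core

end SimpleGraph

/-! ### Assembling a regular graph on all vertices -/

namespace SimpleGraph

section Assembly

variable {V : Type u} [DecidableEq V]

/-- Distributing a set in packets of size `s` among boxes of prescribed capacities. -/
theorem exists_distribution {m : ℕ} (cap : Fin m → ℕ) (s : ℕ) (k : ℕ) :
    ∀ W : Finset V, W.card = s * k → k ≤ ∑ i, cap i →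
      ∃ T : Fin m → Finset V, (∀ i j, i ≠ j → Disjoint (T i) (T j)) ∧
        Finset.univ.biUnion T = W ∧ ∀ i, s ∣ (T i).card ∧ (T i).card ≤ s * cap i := by
  induction k with
  | zero =>
    intro W hW _
    rw [mul_zero, Finset.card_eq_zero] at hW
    exact ⟨fun _ => ∅, by simp, by ext; simp [hW], by simp⟩
  | succ k ih =>
    intro W hW hk
    obtain ⟨S, hSW, hS⟩ := Finset.exists_subset_card_eq (s := W) (n := s)
      (by rw [hW]; exact Nat.le_mul_of_pos_right _ (Nat.succ_pos k))
    have hWS : (W \ S).card = s * k := by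
      have := Finset.card_sdiff_add_card_eq_card hSW
      rw [mul_add, mul_one] at hW
      omega
    obtain ⟨T, hTd, hTW, hT⟩ := ih (W \ S) hWS (by omega)
    have hTsum : ∑ i, (T i).card = s * k := by
      rw [← hWS, ← hTW, Finset.card_biUnion fun i _ j _ h => hTd i j h]
    -- Contents are multiples of `s`, so a box without room for another packet is completely full;
    -- not all boxes can be.
    obtain ⟨i, hi⟩ : ∃ i, (T i).card + s ≤ s * cap i := by
      rcases Nat.eq_zero_or_pos s with rfl | hs
      · have : ∑ i, cap i ≠ 0 := by omega
        obtain ⟨i, -, -⟩ := Finset.exists_ne_zero_of_sum_ne_zero this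
        exact ⟨i, by simpa using (hT i).2⟩
      · by_contra! hcon
        have h1 : ∀ i, s * cap i ≤ (T i).card := fun i => by
          obtain ⟨a, ha⟩ := (hT i).1
          have h2 := hcon i
          rw [ha, ← mul_add_one] at h2
          rw [ha]
          exact Nat.mul_le_mul_left _ (Nat.lt_succ_iff.mp (Nat.lt_of_mul_lt_mul_left h2))
        have h2 : s * ∑ i, cap i ≤ s * k := by
          rw [← hTsum, Finset.mul_sum]
          exact Finset.sum_le_sum fun i _ => h1 i
        have := Nat.le_of_mul_le_mul_left h2 hs
        omega
    have hTS : ∀ j, Disjoint (T j) S := fun j => Finset.disjoint_left.mpr fun x hx hxS => by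
      have : x ∈ W \ S := hTW ▸ Finset.mem_biUnion.mpr ⟨j, Finset.mem_univ _, hx⟩
      exact (Finset.mem_sdiff.mp this).2 hxS
    refine ⟨Function.update T i (T i ∪ S), fun a b hab => ?_, ?_, fun j => ?_⟩
    · by_cases ha : a = i
      · subst ha
        rw [Function.update_self, Function.update_of_ne hab.symm, Finset.disjoint_union_left]
        exact ⟨hTd a b hab, (hTS b).symm⟩
      · rw [Function.update_of_ne ha]
        by_cases hb : b = i
        · subst hb
          rw [Function.update_self, Finset.disjoint_union_right]
          exact ⟨hTd a b hab, hTS a⟩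
        · rw [Function.update_of_ne hb]
          exact hTd a b hab
    · ext x
      have hx : x ∈ W \ S ↔ ∃ j, x ∈ T j := by rw [← hTW]; simp
      rw [Finset.mem_sdiff] at hx
      have hxS := @hSW x
      rw [Finset.mem_biUnion]
      constructor
      · rintro ⟨j, -, hj⟩
        by_cases hji : j = i
        · subst hji
          rw [Function.update_self, Finset.mem_union] at hj
          rcases hj with h | h
          · exact (hx.mpr ⟨_, h⟩).1
          · exact hxS h
        · rw [Function.update_of_ne hji] at hj
          exact (hx.mpr ⟨_, hj⟩).1
      · intro hxW
        by_cases h : x ∈ S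
        · exact ⟨i, Finset.mem_univ _, by rw [Function.update_self]; exact Finset.mem_union_right _ h⟩
        · obtain ⟨j, hj⟩ := hx.mp ⟨hxW, h⟩
          refine ⟨j, Finset.mem_univ _, ?_⟩
          by_cases hji : j = i
          · subst hji
            rw [Function.update_self]; exact Finset.mem_union_left _ hj
          · rwa [Function.update_of_ne hji]
    · by_cases hji : j = i
      · subst hji
        rw [Function.update_self, Finset.card_union_of_disjoint (hTS j), hS]
        exact ⟨(hT j).1.add (dvd_refl s), hi⟩
      · rw [Function.update_of_ne hji]
        exact hT j

variable [Fintype V]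

/-- A union of expanders with few missing degrees can be changed into a disjoint union of
`d`-regular expanders covering all vertices. -/
theorem exists_regular_union {H : SimpleGraph V} {d m : ℕ} (hd2 : 2 ≤ d)
    (hdV : Even (d * Fintype.card V)) (Q : Fin m → Finset V)
    (hQ : ∀ i j, i ≠ j → Disjoint (Q i) (Q j)) (hHQ : ∀ x y, H.Adj x y → ∃ i, x ∈ Q i ∧ y ∈ Q i)
    (hd : ∀ x, (H.nbrs x).card ≤ d) {γ : ℝ} (hγ : 0 < γ)
    (hexp : ∀ i, ∀ F ⊆ Q i, 2 * F.card ≤ (Q i).card → γ * F.card ≤ H.cut F (Q i \ F))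
    (B : Finset V) (hB : ∀ A : Finset V, (∀ x ∈ A, (H.nbrs x).card = d ∧ H.nbrs x ⊆ A) →
      A.card < 20 * (d + 1) → A ⊆ B)
    (hV : 33 * (20 * (d + 1) + 10) * ∑ x, (d - (H.nbrs x).card) + B.card ≤ Fintype.card V) :
    ∃ (H' : SimpleGraph V) (U : Fin m → Finset V), (∀ x, (H'.nbrs x).card = d) ∧
      (∀ i j, i ≠ j → Disjoint (U i) (U j)) ∧ (∀ x, ∃ i, x ∈ U i) ∧
      (∀ x y, H'.Adj x y → ∃ i, x ∈ U i ∧ y ∈ U i) ∧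
      (∀ i, ∀ F ⊆ U i, 2 * F.card ≤ (U i).card →
        (F.card : ℝ) ≤ ((d + 3) * (2 ^ d / (γ / (2 * d))) + 1) * H'.cut F Fᶜ) ∧
      adjDiff H H' ≤ 8 * d * (20 * (d + 1) + 10) * ∑ x, (d - (H.nbrs x).card) := by
  classical
  set M := 20 * (d + 1) with hM
  set δ := ∑ x, (d - (H.nbrs x).card) with hδ
  have hclosed : ∀ i, ∀ x ∈ Q i, ∀ y, H.Adj x y → y ∈ Q i := by
    intro i x hx y hxy
    obtain ⟨j, hxj, hyj⟩ := hHQ x y hxy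
    by_cases hij : i = j
    · rwa [hij]
    · exact absurd hxj (Finset.disjoint_left.mp (hQ i j hij) hx)
  choose Q' hQ'Q hQ'even hQ'card hQ'exp hQ'alt using fun i =>
    exists_even_core (by omega) hd (hclosed i) hγ (hexp i) M
  have hQ' : ∀ i j, i ≠ j → Disjoint (Q' i) (Q' j) := fun i j hij =>
    (hQ i j hij).mono (hQ'Q i) (hQ'Q j)
  set W := (Finset.univ.biUnion Q')ᶜ with hW
  have hδsum : ∑ i, ∑ x ∈ Q i, (d - (H.nbrs x).card) ≤ δ := by
    rw [← Finset.sum_biUnion fun i _ j _ h => hQ i j h]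
    exact Finset.sum_le_sum_of_subset (Finset.subset_univ _)
  have hremoved : ∑ i, (Q i \ Q' i).card ≤ (M + 9) * δ := by
    calc _ ≤ ∑ i, (M + 9) * ∑ x ∈ Q i, (d - (H.nbrs x).card) :=
          Finset.sum_le_sum fun i _ => hQ'card i
      _ ≤ _ := by rw [← Finset.mul_sum]; exact Nat.mul_le_mul_left _ hδsum
  have hWcard : W.card ≤ (M + 10) * δ := by
    have h0 : (Finset.univ.biUnion Q)ᶜ.card ≤ δ := by
      rw [Finset.card_eq_sum_ones]
      refine (Finset.sum_le_sum fun x hx => ?_).trans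
        (Finset.sum_le_sum_of_subset (Finset.subset_univ (Finset.univ.biUnion Q)ᶜ))
      have : H.nbrs x = ∅ := by
        rw [Finset.eq_empty_iff_forall_notMem]
        intro y hy
        obtain ⟨i, hi, -⟩ := hHQ x y (mem_nbrs.mp hy)
        exact Finset.mem_compl.mp hx (Finset.mem_biUnion.mpr ⟨i, Finset.mem_univ _, hi⟩)
      rw [this, Finset.card_empty]
      omega
    have h1 : W ⊆ (Finset.univ.biUnion Q)ᶜ ∪ Finset.univ.biUnion fun i => Q i \ Q' i := by
      intro x hx
      rw [hW, Finset.mem_compl, Finset.mem_biUnion] at hx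
      rw [Finset.mem_union, Finset.mem_compl, Finset.mem_biUnion, Finset.mem_biUnion]
      by_cases h : ∃ i ∈ Finset.univ, x ∈ Q i
      · obtain ⟨i, hi, hxi⟩ := h
        exact Or.inr ⟨i, hi, Finset.mem_sdiff.mpr ⟨hxi, fun h => hx ⟨i, hi, h⟩⟩⟩
      · exact Or.inl h
    have h2 := (Finset.card_le_card h1).trans ((Finset.card_union_le _ _).trans
      (Nat.add_le_add h0 (Finset.card_biUnion_le.trans hremoved)))
    linarith
  have hWtot : W.card + ∑ i, (Q' i).card = Fintype.card V := by
    rw [← Finset.card_biUnion fun i _ j _ h => hQ' i j h, hW, Finset.card_compl_add_card]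
  -- Only large cores receive leftover vertices. A core below `M` is a union of regular components,
  -- hence contained in `B`; a large one has at most `32 * cap i` vertices. So `|V| ≤ |W| + 32 ∑ cap
  -- i + |B|`, which explains the factor 33 in `hV`.
  let cap : Fin m → ℕ := fun i => if M ≤ (Q' i).card then (Q' i).card / 16 else 0
  have hcap : W.card ≤ ∑ i, cap i := by
    have h1 : ∑ i, (Q' i).card ≤ ∑ i, 32 * cap i +
        ∑ i, if M ≤ (Q' i).card then 0 else (Q' i).card := by
      rw [← Finset.sum_add_distrib]
      refine Finset.sum_le_sum fun i _ => ?_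
      simp only [cap]
      split_ifs with h
      · omega
      · omega
    have h2 : ∑ i, (if M ≤ (Q' i).card then 0 else (Q' i).card) ≤ B.card := by
      have h3 : ∀ i, ¬ M ≤ (Q' i).card → Q' i ⊆ B := fun i hi => by
        rcases hQ'alt i with h | h
        · exact hB _ h (not_le.mp hi)
        · exact absurd h.1 hi
      calc _ = ∑ i, (if M ≤ (Q' i).card then ∅ else Q' i).card :=
            Finset.sum_congr rfl fun i _ => by split_ifs <;> simp
        _ = (Finset.univ.biUnion fun i => if M ≤ (Q' i).card then ∅ else Q' i).card := by
            rw [Finset.card_biUnion]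
            intro i _ j _ hij
            simp only [Function.onFun]
            split_ifs <;> first | exact hQ' i j hij | simp
        _ ≤ B.card := by
            refine Finset.card_le_card fun x hx => ?_
            rw [Finset.mem_biUnion] at hx
            obtain ⟨i, -, hi⟩ := hx
            split_ifs at hi with h
            · simp at hi
            · exact h3 i h hi
    rw [← Finset.mul_sum] at h1
    have h4 : 33 * (M + 10) * δ = 33 * ((M + 10) * δ) := by ring
    omega
  -- For odd `d`, leftover vertices are handed out in pairs to keep each degree total even; their
  -- number is even because `|V|` and all cores are.
  obtain ⟨s, k, hs1, hs2, hsd, hWs⟩ : ∃ s k : ℕ, 1 ≤ s ∧ s ≤ 2 ∧ Even (d * s) ∧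
      W.card = s * k := by
    by_cases hde : Even d
    · exact ⟨1, W.card, le_rfl, by omega, by simpa using hde, (one_mul _).symm⟩
    · have h1 : ∀ n, Even (d * n) → Even n := fun n hn =>
        (Nat.even_mul.mp hn).resolve_left hde
      have h2 : Even (∑ i, (Q' i).card) := Finset.even_sum _ fun i _ => h1 _ (hQ'even i)
      have h3 : Even (W.card + ∑ i, (Q' i).card) := hWtot ▸ h1 _ hdV
      obtain ⟨k, hk⟩ := (Nat.even_add.mp h3).mpr h2
      exact ⟨2, k, by omega, le_rfl, even_two.mul_left d, by omega⟩
  obtain ⟨T, hTd, hTW, hT⟩ := exists_distribution cap s k W hWs (by nlinarith)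
  have hTQ : ∀ i j, Disjoint (T i) (Q' j) := fun i j => Finset.disjoint_left.mpr fun x hx hx' => by
    have : x ∈ W := hTW ▸ Finset.mem_biUnion.mpr ⟨i, Finset.mem_univ _, hx⟩
    exact (Finset.mem_compl.mp this) (Finset.mem_biUnion.mpr ⟨j, Finset.mem_univ _, hx'⟩)
  have hT8 : ∀ i, 8 * (T i).card ≤ (Q' i).card := fun i => by
    have h1 := (hT i).2
    have h2 : cap i ≤ (Q' i).card / 16 := by simp only [cap]; split_ifs <;> omega
    have h3 : s * cap i ≤ 2 * ((Q' i).card / 16) := Nat.mul_le_mul hs2 h2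
    omega
  set U : Fin m → Finset V := fun i => Q' i ∪ T i with hU
  have hUT : ∀ i, U i \ T i = Q' i := fun i => by
    rw [hU]; exact Finset.union_sdiff_cancel_right (hTQ i i).symm
  have hUdisj : ∀ i j, i ≠ j → Disjoint (U i) (U j) := fun i j hij => by
    simp only [hU, Finset.disjoint_union_left, Finset.disjoint_union_right]
    exact ⟨⟨hQ' i j hij, hTQ i j⟩, (hTQ j i).symm, hTd i j hij⟩
  have hUcover : ∀ x, ∃ i, x ∈ U i := fun x => by
    by_cases hx : x ∈ W
    · rw [← hTW, Finset.mem_biUnion] at hx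
      obtain ⟨i, -, hi⟩ := hx
      exact ⟨i, Finset.mem_union_right _ hi⟩
    · rw [hW, Finset.mem_compl, not_not, Finset.mem_biUnion] at hx
      obtain ⟨i, -, hi⟩ := hx
      exact ⟨i, Finset.mem_union_left _ hi⟩
  have hdef : ∀ i, ∑ x ∈ U i, (d - ((H.within (Q' i)).nbrs x).card) =
      ∑ x ∈ Q' i, (d - ((H.within (Q' i)).nbrs x).card) + d * (T i).card := fun i => by
    rw [hU, Finset.sum_union (hTQ i i).symm]
    congr 1
    rw [mul_comm, ← smul_eq_mul, ← Finset.sum_const]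
    refine Finset.sum_congr rfl fun x hx => ?_
    rw [nbrs_within_of_notMem H (Finset.disjoint_left.mp (hTQ i i) hx), Finset.card_empty,
      Nat.sub_zero]
  have hwd : ∀ i x, ((H.within (Q' i)).nbrs x).card ≤ d := fun i x =>
    (card_nbrs_mono (within_le H _) x).trans (hd x)
  have hdefeven : ∀ i, Even (∑ x ∈ U i, (d - ((H.within (Q' i)).nbrs x).card)) := fun i => by
    rw [hdef]
    refine Even.add ?_ ?_
    · have h1 : ∑ x ∈ Q' i, (d - ((H.within (Q' i)).nbrs x).card) +
          ∑ x ∈ Q' i, ((H.within (Q' i)).nbrs x).card = d * (Q' i).card := by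
        rw [← Finset.sum_add_distrib, mul_comm, ← smul_eq_mul, ← Finset.sum_const]
        refine Finset.sum_congr rfl fun x _ => ?_
        have := hwd i x
        omega
      have h2 := hQ'even i
      rw [← h1] at h2
      exact (Nat.even_add.mp h2).mpr (even_sum_card_nbrs_within H (Q' i))
    · obtain ⟨a, ha⟩ := (hT i).1
      rw [ha, ← mul_assoc]
      exact hsd.mul_right a
  choose k' hk' using fun i => (hdefeven i).exists_two_nsmul
  simp only [smul_eq_mul] at hk'
  -- A core with a deficit to repair is large: a small one is already regular and receives nothing,
  -- so `k' i = 0`. For a large core, `|T i| ≤ |Q' i| / 8` and `|Q' i| ≥ 20 (d + 1)` leave enough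
  -- edges for the swaps.
  have hsize : ∀ i, 0 < k' i → 2 * k' i + 2 * d * (T i).card + 4 * d * (d + 1) <
      d * (U i).card := by
    intro i hi
    have hUc : (U i).card = (Q' i).card + (T i).card := Finset.card_union_of_disjoint (hTQ i i).symm
    have h8 : 8 * ∑ x ∈ Q' i, (d - ((H.within (Q' i)).nbrs x).card) ≤ (Q' i).card + 1 + 8 * d ∧
        M ≤ (Q' i).card := by
      rcases hQ'alt i with h | h
      · have h1 : ∑ x ∈ Q' i, (d - ((H.within (Q' i)).nbrs x).card) = 0 := by
          refine Finset.sum_eq_zero fun x hx => ?_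
          have e : (H.within (Q' i)).nbrs x = H.nbrs x := by
            ext y
            rw [mem_nbrs, mem_nbrs]
            exact ⟨fun h => h.1, fun h' => ⟨h', hx, (h x hx).2 (mem_nbrs.mpr h')⟩⟩
          rw [e, (h x hx).1, Nat.sub_self]
        refine ⟨by omega, ?_⟩
        by_contra hM'
        have h2 : cap i = 0 := if_neg hM'
        have h3 := (hT i).2
        rw [h2, mul_zero] at h3
        have h4 := hk' i
        rw [hdef, h1, Nat.le_zero.mp h3] at h4
        omega
      · exact ⟨h.2, h.1⟩
    have h1 := hk' i
    rw [hdef] at h1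
    rw [← h1, hUc]
    have h2 := Nat.mul_le_mul_left d (hT8 i)
    have h3 := Nat.mul_le_mul_left d h8.2
    have h4 : (Q' i).card ≤ d * (Q' i).card := Nat.le_mul_of_pos_left _ (by omega)
    rw [hM] at h3
    nlinarith [h8.1]
  choose H' hH'U hH'reg hH'W hH'diff hH'cut using fun i =>
    exists_regular_rewiring (W := T i) (U := U i) Finset.subset_union_right hd2 (k' i)
      (H.within (Q' i)) (fun x y h => Finset.mem_union_left _ h.2.1) (hwd i) (hk' i)
      (fun w hw => Or.inl (nbrs_within_of_notMem H (Finset.disjoint_left.mp (hTQ i i) hw)))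
      (hsize i)
  let K : SimpleGraph V :=
    { Adj := fun x y => ∃ i, (H' i).Adj x y
      symm := ⟨fun _ _ h => h.imp fun _ h => h.symm⟩
      loopless := ⟨fun _ ⟨_, h⟩ => h.ne rfl⟩ }
  have hKnbrs : ∀ i, ∀ x ∈ U i, K.nbrs x = (H' i).nbrs x := fun i x hx => by
    ext y
    rw [mem_nbrs, mem_nbrs]
    refine ⟨?_, fun h => ⟨i, h⟩⟩
    rintro ⟨j, hj⟩
    by_cases hij : i = j
    · rwa [hij]
    · exact absurd (hH'U j x y hj) (Finset.disjoint_left.mp (hUdisj i j hij) hx)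
  refine ⟨K, U, fun x => ?_, hUdisj, hUcover, ?_, fun i F hF hF2 => ?_, ?_⟩
  · obtain ⟨i, hi⟩ := hUcover x
    rw [hKnbrs i x hi, hH'reg i x hi]
  · rintro x y ⟨i, h⟩
    exact ⟨i, hH'U i x y h, hH'U i y x h.symm⟩
  · have hd0 : (0 : ℝ) < d := by exact_mod_cast (by omega : 0 < d)
    have h := card_le_mul_cut_of_rewiring (H := H.within (Q' i)) (H' := H' i) (U := U i) (W := T i)
      (d := d) (γ := γ / (2 * d)) (K := 2 ^ d) (by positivity) (by positivity)
      (fun F hF hF2 => by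
        rw [hUT] at hF hF2 ⊢
        rw [cut_within hF Finset.sdiff_subset]
        exact hQ'exp i F hF hF2)
      (fun F => by
        have h1 := hH'cut i F
        have h2 : (2 : ℕ) ^ min (2 * k' i) d ≤ 2 ^ d := Nat.pow_le_pow_right two_pos (min_le_right _ _)
        exact_mod_cast h1.trans (Nat.mul_le_mul_right _ h2))
      (fun x => by
        by_cases hx : x ∈ U i
        · exact (hH'reg i x hx).le
        · have : (H' i).nbrs x = ∅ := by
            rw [Finset.eq_empty_iff_forall_notMem]
            exact fun y hy => hx (hH'U i x y (mem_nbrs.mp hy))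
          rw [this, Finset.card_empty]
          exact Nat.zero_le d)
      (hH'W i) Finset.subset_union_right (by rw [hUT]; have := hT8 i; omega) hF hF2
    refine h.trans ?_
    gcongr
    exact cut_mono (fun x _ y _ h => ⟨i, h⟩) subset_rfl subset_rfl
  -- Edges at leftover vertices are lost outright; every other change happens in one of the
  -- rewirings, each costing three times its deficit.
  · have h1 : adjDiff H K ≤ (H.cut W Finset.univ + H.cut Finset.univ W) +
        ∑ i, adjDiff (H.within (Q' i)) (H' i) := by
      have h2 : ((Finset.univ : Finset (V × V)).filter
          fun p => ¬(H.Adj p.1 p.2 ↔ K.Adj p.1 p.2)) ⊆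
          (((W ×ˢ Finset.univ).filter fun p => H.Adj p.1 p.2) ∪
          ((Finset.univ ×ˢ W).filter fun p => H.Adj p.1 p.2)) ∪
          Finset.univ.biUnion fun i => (Finset.univ : Finset (V × V)).filter
            fun p => ¬((H.within (Q' i)).Adj p.1 p.2 ↔ (H' i).Adj p.1 p.2) := by
        rintro ⟨x, y⟩ hp
        simp only [Finset.mem_filter, Finset.mem_univ, true_and] at hp
        simp only [Finset.mem_union, Finset.mem_filter, Finset.mem_product, Finset.mem_univ,
          true_and, and_true, Finset.mem_biUnion]
        by_cases hxy : H.Adj x y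
        · by_cases hx : x ∈ W
          · exact Or.inl (Or.inl ⟨hx, hxy⟩)
          by_cases hy : y ∈ W
          · exact Or.inl (Or.inr ⟨hy, hxy⟩)
          right
          rw [hW, Finset.mem_compl, not_not, Finset.mem_biUnion] at hx hy
          obtain ⟨i, -, hi⟩ := hx
          obtain ⟨j, -, hj⟩ := hy
          have hyi : y ∈ Q' i := by
            by_cases hij : i = j
            · rwa [hij]
            · exact absurd (hQ'Q j hj) (Finset.disjoint_left.mp (hQ i j hij)
                (hclosed i x (hQ'Q i hi) y hxy))
          refine ⟨i, fun h => hp ⟨fun _ => ⟨i, h.mp ⟨hxy, hi, hyi⟩⟩, fun _ => hxy⟩⟩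
        · right
          have hK : K.Adj x y := by
            by_contra hK
            exact hp ⟨fun h => absurd h hxy, fun h => absurd h hK⟩
          obtain ⟨i, hi⟩ := hK
          exact ⟨i, fun h => hxy (h.mpr hi).1⟩
      unfold adjDiff cut
      refine (le_of_eq ?_).trans (((Finset.card_le_card h2).trans
        ((Finset.card_union_le _ _).trans (Nat.add_le_add (Finset.card_union_le _ _)
        Finset.card_biUnion_le))).trans (le_of_eq ?_)) <;> congr!
    have h2 : H.cut W Finset.univ ≤ W.card * d := cut_le_mul H W _ fun x _ => hd x
    have h3 : H.cut Finset.univ W ≤ W.card * d := by rw [cut_comm]; exact h2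
    have h4 : ∑ i, adjDiff (H.within (Q' i)) (H' i) ≤ 3 * (δ + d * ((M + 9) * δ) + d * W.card) := by
      have h5 : ∀ i, adjDiff (H.within (Q' i)) (H' i) ≤
          3 * (∑ x ∈ Q i, (d - (H.nbrs x).card) + d * (Q i \ Q' i).card + d * (T i).card) := by
        intro i
        have h6 := hH'diff i
        have h7 := hk' i
        rw [hdef] at h7
        have h8 := sum_deficit_within_le (hQ'Q i) hd (hclosed i)
        omega
      have hTsum : ∑ i, (T i).card = W.card := by
        rw [← hTW, Finset.card_biUnion fun i _ j _ h => hTd i j h]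
      refine (Finset.sum_le_sum fun i _ => h5 i).trans ?_
      rw [← Finset.mul_sum, Finset.sum_add_distrib, Finset.sum_add_distrib, ← Finset.mul_sum,
        ← Finset.mul_sum, hTsum]
      gcongr
    have h5 := Nat.mul_le_mul_left d hWcard
    have h6 : δ ≤ d * δ := Nat.le_mul_of_pos_left _ (by omega)
    nlinarith

end Assembly

end SimpleGraph

/-! ### From finite-set cuts to unions of expanders -/

namespace SimpleGraph

section Expanders

variable {V : Type u}

theorem IsDisjointUnionOfExpanders.mono [Finite V] {G : SimpleGraph V} {d : ℕ} {γ γ' : ℝ}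
    (h : G.IsDisjointUnionOfExpanders d γ) (hγ : γ' ≤ γ) : G.IsDisjointUnionOfExpanders d γ' := by
  obtain ⟨P, hP, hexp⟩ := h
  exact ⟨P, hP, fun x => ⟨(hexp x).1, fun S hS => le_trans (by gcongr) ((hexp x).2 S hS)⟩⟩

theorem isRegularGraph_induce [Finite V] {G : SimpleGraph V} {d : ℕ} (hG : G.IsRegularGraph d)
    {A : Set V} (hA : ∀ x ∈ A, ∀ y, G.Adj x y → y ∈ A) : (G.induce A).IsRegularGraph d := by
  intro x
  rw [← hG x, ← Set.ncard_image_of_injective _ Subtype.val_injective]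
  congr 1
  ext y
  simp only [Set.mem_image, mem_neighborSet, comap_adj, Function.Embedding.subtype_apply]
  exact ⟨fun ⟨z, hz, hzy⟩ => hzy ▸ hz, fun h => ⟨⟨y, hA x x.2 y h⟩, h, rfl⟩⟩

/-- A finite regular graph is the disjoint union of its connected components, which are expanders. -/
theorem exists_isDisjointUnionOfExpanders [Finite V] (d : ℕ) :
    ∃ γ : ℝ, 0 < γ ∧ ∀ G : SimpleGraph V, G.IsRegularGraph d →
      G.IsDisjointUnionOfExpanders d γ := by
  -- With this constant the required boundary is at most 1, and by connectedness a nonempty set of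
  -- at most half a component has a boundary edge.
  refine ⟨1 / ((d + 1) * (Nat.card V + 1)), by positivity, fun G hG =>
    ⟨G.reachableSetoid, fun x y h => h.reachable, fun x => ?_⟩⟩
  set A : Set V := {y | G.reachableSetoid x y} with hA
  have hmem : ∀ y, y ∈ A ↔ G.Reachable x y := fun y => Iff.rfl
  refine ⟨isRegularGraph_induce hG fun y hy z hyz =>
    (hmem z).mpr (((hmem y).mp hy).trans hyz.reachable), fun S hS => ?_⟩
  rcases S.eq_empty_or_nonempty with rfl | ⟨a, ha⟩
  · simp
  have hScard : 0 < S.ncard := (Set.ncard_pos).mpr ⟨a, ha⟩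
  obtain ⟨b, hb⟩ : ∃ b, b ∉ S := by
    by_contra! hcon
    rw [Set.eq_univ_of_forall hcon, Set.ncard_univ] at hS hScard
    omega
  have hreach : G.Reachable a b := ((hmem a).mp a.2).symm.trans ((hmem b).mp b.2)
  obtain ⟨p⟩ := hreach
  obtain ⟨e, -, he1, he2⟩ := p.exists_boundary_dart (Subtype.val '' S) ⟨a, ha, rfl⟩
    (fun ⟨c, hc, hcb⟩ => hb (Subtype.ext hcb ▸ hc))
  obtain ⟨c, hc, hce⟩ := he1
  have hsnd : e.snd ∈ A := (hmem _).mpr (((hmem c).mp c.2).trans (hce ▸ e.adj.reachable))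
  have hone : 1 ≤ (G.induce A).edgeBoundaryCard S := by
    unfold edgeBoundaryCard
    rw [Nat.one_le_iff_ne_zero, ← Nat.pos_iff_ne_zero, Set.ncard_pos]
    refine ⟨(c, ⟨e.snd, hsnd⟩), hc, fun h => he2 ⟨_, h, rfl⟩, ?_⟩
    simp only [comap_adj, Function.Embedding.subtype_apply]
    rw [hce]
    exact e.adj
  have hone' : (1 : ℝ) ≤ (G.induce A).edgeBoundaryCard S := by exact_mod_cast hone
  refine le_trans ?_ hone'
  have hSV : S.ncard ≤ Nat.card V := by
    rw [← Set.ncard_image_of_injective S Subtype.val_injective]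
    exact Set.ncard_le_card _
  have hSV' : (S.ncard : ℝ) ≤ Nat.card V + 1 := by
    have : (S.ncard : ℝ) ≤ Nat.card V := by exact_mod_cast hSV
    linarith
  rw [mul_assoc, div_mul_eq_mul_div, one_mul, div_le_one (by positivity)]
  gcongr
  linarith

variable [Fintype V]

theorem ncard_neighborSet (G : SimpleGraph V) (x : V) :
    (G.neighborSet x).ncard = (G.nbrs x).card := by
  rw [← Set.ncard_coe_finset]
  congr 1
  ext y
  simp [mem_nbrs]

/-- Since no edge leaves a part, the cut of a subset in the whole graph is its boundary inside the
part. The `d` in the constant cancels the normalization by degree. -/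
theorem isDisjointUnionOfExpanders_of_parts [DecidableEq V] {G : SimpleGraph V} {d m : ℕ}
    (hd : 0 < d) (hreg : G.IsRegularGraph d)
    (U : Fin m → Finset V) (hU : ∀ i j, i ≠ j → Disjoint (U i) (U j)) (hcover : ∀ x, ∃ i, x ∈ U i)
    (hadj : ∀ x y, G.Adj x y → ∃ i, x ∈ U i ∧ y ∈ U i) {C : ℝ} (hC : 0 < C)
    (hexp : ∀ i, ∀ F ⊆ U i, 2 * F.card ≤ (U i).card → (F.card : ℝ) ≤ C * G.cut F Fᶜ) :
    G.IsDisjointUnionOfExpanders d (1 / (C * d)) := by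
  classical
  choose c hc using hcover
  have huniq : ∀ x i, x ∈ U i → c x = i := fun x i hi => by
    by_contra hne
    exact Finset.disjoint_left.mp (hU _ _ hne) (hc x) hi
  have hcadj : ∀ x y, G.Adj x y → c x = c y := fun x y h => by
    obtain ⟨i, hx, hy⟩ := hadj x y h
    rw [huniq x i hx, huniq y i hy]
  refine ⟨Setoid.ker c, fun x y h => hcadj x y h, fun x => ?_⟩
  set A : Set V := {y | Setoid.ker c x y} with hA
  have hmem : ∀ y, y ∈ A ↔ c x = c y := fun y => Iff.rfl
  have hAU : A = (U (c x) : Set V) := by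
    ext y
    rw [hmem, Finset.mem_coe]
    exact ⟨fun h => h ▸ hc y, fun h => (huniq y _ h).symm⟩
  refine ⟨isRegularGraph_induce hreg fun y hy z hyz =>
    (hmem z).mpr (((hmem y).mp hy).trans (hcadj y z hyz)), fun S hS => ?_⟩
  set F : Finset V := (Subtype.val '' S).toFinset with hF
  have hFcard : F.card = S.ncard := by
    rw [← Set.ncard_image_of_injective S Subtype.val_injective, Set.ncard_eq_toFinset_card']
  have hFU : F ⊆ U (c x) := by
    intro y hy
    rw [hF, Set.mem_toFinset] at hy
    obtain ⟨z, -, rfl⟩ := hy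
    have : (z : V) ∈ A := z.2
    rw [hAU] at this
    exact this
  have hAcard : Nat.card A = (U (c x)).card := by
    rw [Nat.card_coe_set_eq, hAU, Set.ncard_coe_finset]
  have h := hexp (c x) F hFU (by rw [hFcard, ← hAcard]; exact hS)
  have hcut : G.cut F Fᶜ ≤ (G.induce A).edgeBoundaryCard S := by
    unfold edgeBoundaryCard cut
    rw [← Set.ncard_coe_finset, ← Set.ncard_image_of_injective _
      (Subtype.val_injective.prodMap Subtype.val_injective :
        Function.Injective (Prod.map (Subtype.val : A → V) (Subtype.val : A → V)))]
    refine Set.ncard_le_ncard ?_ (Set.toFinite _)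
    rintro ⟨y, z⟩ hp
    simp only [Finset.coe_filter, Finset.mem_product, Finset.mem_compl, Set.mem_ofPred_eq, hF,
      Set.mem_toFinset] at hp
    obtain ⟨⟨⟨y', hy', rfl⟩, hz⟩, hyz⟩ := hp
    have hzA : z ∈ A := (hmem z).mpr (((hmem y').mp y'.2).trans (hcadj _ z hyz))
    exact ⟨(y', ⟨z, hzA⟩), ⟨hy', fun h => hz ⟨_, h, rfl⟩, hyz⟩, rfl⟩
  have hcut' : (G.cut F Fᶜ : ℝ) ≤ (G.induce A).edgeBoundaryCard S := by exact_mod_cast hcut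
  have hdr : (0 : ℝ) < d := by exact_mod_cast hd
  rw [hFcard] at h
  have e : 1 / (C * d) * d * (S.ncard : ℝ) = S.ncard / C := by field_simp
  rw [e, div_le_iff₀ hC]
  nlinarith

theorem ncard_symmDiff_edgeSet_le (G H : SimpleGraph V) :
    (symmDiff G.edgeSet H.edgeSet).ncard ≤ adjDiff G H := by
  classical
  unfold adjDiff
  rw [← Set.ncard_coe_finset]
  refine le_trans (Set.ncard_le_ncard ?_ (Set.toFinite _))
    (Set.ncard_image_le (f := fun p : V × V => s(p.1, p.2)) (Set.toFinite _))
  intro e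
  induction e using Sym2.ind with
  | _ x y =>
    intro he
    refine ⟨(x, y), ?_, rfl⟩
    rw [Set.mem_symmDiff, mem_edgeSet, mem_edgeSet] at he
    simp only [Finset.coe_filter, Finset.mem_univ, true_and, Set.mem_ofPred_eq]
    tauto

end Expanders

/-! ### Asymptotic statement and conclusion -/

section Main

variable {Γ : Type v} [Group Γ] {X : SimpleGraph Γ} {A : Finset Γ}

/-- A small union of full components consists of vertices with an atypical neighborhood. -/
theorem subset_badVertices [Infinite Γ] {V : Type u} [Fintype V]
    (hX : ∀ u v, X.Adj u v ↔ u⁻¹ * v ∈ A) (hA : Subgroup.closure (A : Set Γ) = ⊤)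
    {G H : SimpleGraph V} (hHG : H ≤ G)
    (hHd : ∀ x, (H.nbrs x).Nonempty → (G.nbrs x).card = A.card) {M : ℕ} {B : Finset V}
    (hB : ∀ x ∈ B, (H.nbrs x).card = A.card ∧ H.nbrs x ⊆ B) (hM : B.card < M) :
    B ⊆ badVertices X G M := by
  classical
  intro x hx
  by_contra hbad
  obtain ⟨E, hE1, hE⟩ := notMem_badVertices.mp hbad
  have hA2 := two_le_card_of_infinite hX hA
  -- On `B` the subgraph has full degree, so it contains all edges of `G` there and `B` is closed in
  -- `G`. A typical vertex of `B` would bring its whole `M`-ball, with more than `M` vertices.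
  have hnbrs : ∀ y ∈ B, G.nbrs y ⊆ B := fun y hy => by
    have h1 := hB y hy
    have h2 : H.nbrs y = G.nbrs y := Finset.eq_of_subset_of_card_le
      (fun z hz => mem_nbrs.mpr (hHG (mem_nbrs.mp hz)))
      (by rw [h1.1, hHd y (Finset.card_pos.mp (by omega))])
    rw [← h2]
    exact h1.2
  have hball : ∀ k ≤ M, ∀ z ∈ X.rBall 1 k, E z ∈ B := by
    intro k
    induction k with
    | zero =>
      intro _ z hz
      rw [rBall_zero, Set.mem_singleton_iff] at hz
      rw [hz, hE1]
      exact hx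
    | succ k ih =>
      intro hk z hz
      rcases mem_rBall_succ.mp hz with h | ⟨w, hw, hwz⟩
      · exact ih (by omega) z h
      · refine hnbrs _ (ih (by omega) w hw) (mem_nbrs.mpr ?_)
        exact (hE.adj w (rBall_mono (by omega) hw) z (rBall_mono hk hz)).mpr hwz
  have h1 := succ_le_ncard_rBall hX hA M
  have h2 : (X.rBall 1 M).ncard ≤ B.card := by
    rw [← Set.ncard_coe_finset]
    exact Set.ncard_le_ncard_of_injOn E (fun z hz => hball M le_rfl z hz) hE.inj (Set.toFinite _)
  omega

variable {V : ℕ → Type u} [∀ n, Fintype (V n)]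

/-- For large `n`, the graph can be made a disjoint union of regular expanders by changing few
edges. -/
theorem exists_close_union_of_expanders [Countable Γ] [Infinite Γ] (hT : HasKazhdanPropertyT Γ)
    (hX : ∀ u v, X.Adj u v ↔ u⁻¹ * v ∈ A) (hA : Subgroup.closure (A : Set Γ) = ⊤)
    (G : ∀ n, SimpleGraph (V n)) {D : ℕ} (hD : ∀ n x, ((G n).nbrs x).card ≤ D)
    (hne : ∀ᶠ n in atTop, 0 < Fintype.card (V n))
    (hbad : ∀ R, Tendsto (fun n => ((badVertices X (G n) R).card : ℝ) / Fintype.card (V n))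
      atTop (𝓝 0)) :
    ∃ γ : ℝ, 0 < γ ∧ ∀ κ : ℝ, 0 < κ → ∀ᶠ n in atTop,
      (∃ H : SimpleGraph (V n), H.IsRegularGraph A.card) →
      ∃ H : SimpleGraph (V n), (H.IsRegularGraph A.card ∧ H.IsDisjointUnionOfExpanders A.card γ) ∧
        ((symmDiff (G n).edgeSet H.edgeSet).ncard : ℝ) ≤ κ * Fintype.card (V n) := by
  classical
  have hA2 := two_le_card_of_infinite hX hA
  generalize hd : A.card = d at *
  obtain ⟨γ, hγ, hpart⟩ := exists_expander_partition hT hX hA G (D := max D A.card)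
    (lt_of_lt_of_le (by omega) (le_max_right _ _)) (fun n x => (hD n x).trans (le_max_left _ _))
    (le_max_right _ _) hne hbad
  have hd0 : (0 : ℝ) < d := by exact_mod_cast (by omega : 0 < d)
  set C : ℝ := (d + 3) * (2 ^ d / (γ / (2 * d))) + 1 with hC
  have hC0 : 0 < C := by positivity
  refine ⟨1 / (C * d), by positivity, fun κ hκ => ?_⟩
  set a : ℕ := 33 * (20 * (d + 1) + 10) with ha
  set b : ℕ := 8 * d * (20 * (d + 1) + 10) with hb
  have ha0 : (0 : ℝ) < a := by positivity
  -- The first term keeps `a` times the deficit below half of `|V|`, the other half being left for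
  -- atypical vertices; the second bounds deleted edges plus `b` times the deficit by `κ |V|`.
  set κ' : ℝ := min (1 / (2 * a)) (κ / (1 + b)) with hκ'
  have hκ'0 : 0 < κ' := by positivity
  have hκa : a * κ' ≤ 1 / 2 := by
    calc a * κ' ≤ a * (1 / (2 * a)) := by gcongr; exact min_le_left _ _
      _ = 1 / 2 := by field_simp
  have hκb : κ' * (1 + b) ≤ κ := by
    rw [← le_div_iff₀ (by positivity)]; exact min_le_right _ _
  have hbadM := (hbad (20 * (d + 1))).eventually_lt_const (show (0 : ℝ) < 1 / 2 by norm_num)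
  filter_upwards [hpart κ' hκ'0, hbadM, hne] with n hn hB hV
  rintro ⟨R, hR⟩
  rw [hd] at hn
  obtain ⟨H, m, Q, hHG, hQ, hHQ, hHd, hHdeg, hexp, -, hdiff, hdef⟩ := hn
  have hVr : (0 : ℝ) < Fintype.card (V n) := by exact_mod_cast hV
  rw [div_lt_iff₀ hVr] at hB
  have hdef' : ((∑ x, (d - (H.nbrs x).card) : ℕ) : ℝ) ≤ κ' * Fintype.card (V n) := by
    push_cast; exact hdef
  -- The given regular graph enters only through the parity it forces.
  have hdV : Even (d * Fintype.card (V n)) := by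
    have h := even_sum_card_nbrs R
    have e : ∑ x, (R.nbrs x).card = d * Fintype.card (V n) := by
      rw [Finset.sum_congr rfl fun x _ => (ncard_neighborSet R x).symm.trans (hR x),
        Finset.sum_const, Finset.card_univ, smul_eq_mul, mul_comm]
    rwa [e] at h
  obtain ⟨H', U, hreg, hU, hcover, hHU, hexp', hdiff'⟩ := exists_regular_union hA2 hdV Q hQ hHQ hHd
    hγ hexp (badVertices X (G n) (20 * (d + 1)))
    (fun B hB hcard => subset_badVertices hX hA hHG (fun x hx => (hHdeg x hx).trans hd.symm)
      (by rw [hd]; exact hB) hcard) (by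
      rw [← ha]
      have h1 : (a : ℝ) * (∑ x, (d - (H.nbrs x).card) : ℕ) ≤ 1 / 2 * Fintype.card (V n) := by
        calc (a : ℝ) * (∑ x, (d - (H.nbrs x).card) : ℕ) ≤ a * (κ' * Fintype.card (V n)) := by gcongr
          _ = a * κ' * Fintype.card (V n) := by ring
          _ ≤ _ := by gcongr
      have h2 : (a : ℝ) * (∑ x, (d - (H.nbrs x).card) : ℕ) +
          (badVertices X (G n) (20 * (d + 1))).card ≤ Fintype.card (V n) := by linarith
      exact_mod_cast h2)
  have hreg' : H'.IsRegularGraph d := fun x => (ncard_neighborSet H' x).trans (hreg x)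
  refine ⟨H', ⟨hreg', isDisjointUnionOfExpanders_of_parts (by omega) hreg' U hU hcover hHU hC0
    hexp'⟩, ?_⟩
  have h1 := ncard_symmDiff_edgeSet_le (G n) H'
  have h2 := adjDiff_triangle (G n) H H'
  rw [adjDiff_of_le hHG] at h2
  rw [← hb] at hdiff'
  have h3 : ((symmDiff (G n).edgeSet H'.edgeSet).ncard : ℝ) ≤
      ∑ x, (((G n \ H).nbrs x).card : ℝ) + b * (∑ x, (d - (H.nbrs x).card) : ℕ) := by
    have : (symmDiff (G n).edgeSet H'.edgeSet).ncard ≤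
      ∑ x, ((G n \ H).nbrs x).card + b * ∑ x, (d - (H.nbrs x).card) := by omega
    exact_mod_cast this
  calc _ ≤ _ := h3
    _ ≤ κ' * Fintype.card (V n) + b * (κ' * Fintype.card (V n)) := by gcongr
    _ = κ' * (1 + b) * Fintype.card (V n) := by ring
    _ ≤ _ := by gcongr

theorem tendsto_badVertices {X : SimpleGraph Γ} (G : ∀ n, SimpleGraph (V n)) (R : ℕ)
    (h : Tendsto (fun n => (({x : V n | RootedBallIso (G n) x X 1 R}.ncard : ℕ) : ℝ) /
      Fintype.card (V n)) atTop (𝓝 1)) :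
    Tendsto (fun n => ((badVertices X (G n) R).card : ℝ) / Fintype.card (V n)) atTop (𝓝 0) := by
  have h1 := h.const_sub 1
  rw [sub_self] at h1
  refine squeeze_zero (fun n => by positivity) (fun n => ?_) h1
  rcases Nat.eq_zero_or_pos (Fintype.card (V n)) with h0 | hpos
  · simp [h0]
  have hposr : (0 : ℝ) < Fintype.card (V n) := by exact_mod_cast hpos
  have hle : (badVertices X (G n) R).card + {x : V n | RootedBallIso (G n) x X 1 R}.ncard ≤
      Fintype.card (V n) := by
    rw [← Set.ncard_coe_finset, ← Set.ncard_union_eq, ← Nat.card_eq_fintype_card]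
    · exact Set.ncard_le_card _
    · rw [Set.disjoint_left]
      intro x hx hx'
      exact notMem_badVertices.mpr (RootedBallIso.exists_isChart hx') hx
  have hle' : ((badVertices X (G n) R).card : ℝ) +
      ({x : V n | RootedBallIso (G n) x X 1 R}.ncard : ℕ) ≤ Fintype.card (V n) := by
    exact_mod_cast hle
  rw [le_sub_iff_add_le, ← add_div, div_le_one hposr]
  exact hle'

/-- The generators of a Cayley graph, made symmetric and without the identity. -/
theorem exists_symmetric_generators (S : Finset Γ) (hS : Subgroup.closure (S : Set Γ) = ⊤) :
    ∃ A : Finset Γ, (∀ u v, (mulCayley (S : Set Γ)).Adj u v ↔ u⁻¹ * v ∈ A) ∧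
      Subgroup.closure (A : Set Γ) = ⊤ ∧ cayleyDegree (S : Set Γ) = A.card := by
  classical
  let A : Finset Γ := (S ∪ S.image fun g => g⁻¹).erase 1
  have hX : ∀ u v, (mulCayley (S : Set Γ)).Adj u v ↔ u⁻¹ * v ∈ A := by
    intro u v
    rw [mulCayley_adj', Finset.mem_erase, Finset.mem_union, Finset.mem_image]
    refine and_congr ?_ ⟨?_, ?_⟩
    · rw [not_iff_not, inv_mul_eq_one]
    · rintro ⟨g, hg, rfl | rfl⟩
      · left; simpa using hg
      · right; exact ⟨g, hg, by simp⟩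
    · rintro (h | ⟨g, hg, h⟩)
      · exact ⟨_, h, Or.inl (by simp)⟩
      · refine ⟨g, hg, Or.inr ?_⟩
        rw [inv_eq_iff_eq_inv] at h
        rw [h]; simp
  refine ⟨A, hX, ?_, ?_⟩
  · rw [eq_top_iff, ← hS, Subgroup.closure_le]
    intro g hg
    by_cases h1 : g = 1
    · rw [h1]; exact one_mem _
    · refine Subgroup.subset_closure ?_
      rw [Finset.mem_coe, Finset.mem_erase, Finset.mem_union]
      exact ⟨h1, Or.inl hg⟩
  · rw [cayleyDegree, ← Set.ncard_coe_finset]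
    congr 1
    ext v
    rw [mem_neighborSet, hX]
    simp

end Main

end SimpleGraph

theorem theorem1 {Γ : Type v} [Group Γ] [Countable Γ] [Infinite Γ] (hT : HasKazhdanPropertyT Γ)
    (S : Finset Γ) (hS : Subgroup.closure (S : Set Γ) = ⊤)
    {V : ℕ → Type u} [∀ n, Finite (V n)] (G : ∀ n, SimpleGraph (V n))
    (hbdd : ∃ D : ℕ, ∀ (n : ℕ) (x : V n), ((G n).neighborSet x).ncard ≤ D)
    (hconv : SimpleGraph.LocallyConvergesToCayley (S : Set Γ) G) :
    ∃ γ : ℝ, 0 < γ ∧ ∃ G' : ∀ n, SimpleGraph (V n),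
      Tendsto
        (fun n => ((symmDiff (G n).edgeSet (G' n).edgeSet).ncard : ℝ) / (Nat.card (V n) : ℝ))
        atTop (𝓝 0) ∧
      ∀ n : ℕ,
        (∃ H : SimpleGraph (V n), H.IsRegularGraph (SimpleGraph.cayleyDegree (S : Set Γ))) →
          (G' n).IsRegularGraph (SimpleGraph.cayleyDegree (S : Set Γ)) ∧
          (G' n).IsDisjointUnionOfExpanders (SimpleGraph.cayleyDegree (S : Set Γ)) γ := by
  classical
  have hfin : ∀ n, Fintype (V n) := fun n => Fintype.ofFinite _
  obtain ⟨A, hX, hA, hdeg⟩ := SimpleGraph.exists_symmetric_generators S hS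
  rw [hdeg]
  obtain ⟨D, hD⟩ := hbdd
  have hbad : ∀ R, Tendsto (fun n => ((SimpleGraph.badVertices (SimpleGraph.mulCayley (S : Set Γ)) (G n) R).card : ℝ) /
      Fintype.card (V n)) atTop (𝓝 0) := fun R => SimpleGraph.tendsto_badVertices G R (by
    have := hconv R
    simp only [Nat.card_eq_fintype_card] at this
    exact this)
  -- On an empty vertex set the proportion is `0 / 0 = 0`, which cannot persist when the limit is 1.
  have hne : ∀ᶠ n in atTop, 0 < Fintype.card (V n) := by
    filter_upwards [(hconv 0).eventually_const_lt (show (0 : ℝ) < 1 by norm_num)] with n hn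
    rw [Nat.card_eq_fintype_card] at hn
    by_contra h0
    rw [Nat.le_zero.mp (not_lt.mp h0)] at hn
    simp at hn
  obtain ⟨γ₀, hγ₀, hclose⟩ := SimpleGraph.exists_close_union_of_expanders hT hX hA G (D := D)
    (fun n x => (SimpleGraph.ncard_neighborSet (G n) x).symm.trans_le (hD n x)) hne hbad
  obtain ⟨N, hN⟩ := eventually_atTop.mp (hclose 1 one_pos)
  -- The finitely many `n < N` are covered by crude constants, and `γ` is taken below all of them.
  choose δ hδ0 hδ using fun n => SimpleGraph.exists_isDisjointUnionOfExpanders (V := V n) A.card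
  obtain ⟨γ, hγ, hγ₀le, hγδ⟩ : ∃ γ : ℝ, 0 < γ ∧ γ ≤ γ₀ ∧ ∀ n < N, γ ≤ δ n := by
    have hinf : ∀ M, ∃ γ : ℝ, 0 < γ ∧ γ ≤ γ₀ ∧ ∀ n < M, γ ≤ δ n := by
      intro M
      induction M with
      | zero => exact ⟨γ₀, hγ₀, le_rfl, fun n hn => absurd hn (Nat.not_lt_zero n)⟩
      | succ M ih =>
        obtain ⟨γ, h1, h2, h3⟩ := ih
        refine ⟨min γ (δ M), lt_min h1 (hδ0 M), (min_le_left _ _).trans h2, fun n hn => ?_⟩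
        rcases Nat.lt_succ_iff_lt_or_eq.mp hn with h | rfl
        · exact (min_le_left _ _).trans (h3 n h)
        · exact min_le_right _ _
    exact hinf N
  have hex : ∀ n, (∃ H : SimpleGraph (V n), H.IsRegularGraph A.card) →
      ∃ H : SimpleGraph (V n), H.IsRegularGraph A.card ∧ H.IsDisjointUnionOfExpanders A.card γ := by
    intro n hn
    by_cases h : N ≤ n
    · obtain ⟨H, hH, -⟩ := hN n h hn
      exact ⟨H, hH.1, hH.2.mono hγ₀le⟩
    · obtain ⟨H, hH⟩ := hn
      exact ⟨H, hH, (hδ n H hH).mono (hγδ n (not_le.mp h))⟩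
  -- Taking an admissible graph with the fewest edited edges gives a single sequence that is good
  -- for every `κ`; where no regular graph exists, `G n` is kept.
  have hbest : ∀ n, ∃ G' : SimpleGraph (V n),
      ((∃ H : SimpleGraph (V n), H.IsRegularGraph A.card) →
        G'.IsRegularGraph A.card ∧ G'.IsDisjointUnionOfExpanders A.card γ ∧
        ∀ H : SimpleGraph (V n), H.IsRegularGraph A.card → H.IsDisjointUnionOfExpanders A.card γ →
          (symmDiff (G n).edgeSet G'.edgeSet).ncard ≤ (symmDiff (G n).edgeSet H.edgeSet).ncard) ∧
      ((¬ ∃ H : SimpleGraph (V n), H.IsRegularGraph A.card) → G' = G n) := by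
    intro n
    by_cases hn : ∃ H : SimpleGraph (V n), H.IsRegularGraph A.card
    · obtain ⟨G', hG', hmin⟩ := Set.exists_min_image
        {H : SimpleGraph (V n) | H.IsRegularGraph A.card ∧ H.IsDisjointUnionOfExpanders A.card γ}
        (fun H => (symmDiff (G n).edgeSet H.edgeSet).ncard) (Set.toFinite _) (hex n hn)
      exact ⟨G', fun _ => ⟨hG'.1, hG'.2, fun H h1 h2 => hmin H ⟨h1, h2⟩⟩, fun h => absurd hn h⟩
    · exact ⟨G n, fun h => absurd h hn, fun _ => rfl⟩
  choose G' hG' hG'none using hbest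
  refine ⟨γ, hγ, G', ?_, fun n hn => ⟨(hG' n hn).1, (hG' n hn).2.1⟩⟩
  rw [Metric.tendsto_atTop]
  intro κ hκ
  obtain ⟨N', hN'⟩ := eventually_atTop.mp (hclose (κ / 2) (by positivity))
  refine ⟨N', fun n hn => ?_⟩
  rw [Real.dist_0_eq_abs, abs_of_nonneg (by positivity), Nat.card_eq_fintype_card]
  refine lt_of_le_of_lt ?_ (half_lt_self hκ)
  refine div_le_of_le_mul₀ (by positivity) (by positivity) ?_
  by_cases h : ∃ H : SimpleGraph (V n), H.IsRegularGraph A.card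
  · obtain ⟨H, hH, hle⟩ := hN' n hn h
    refine le_trans ?_ hle
    exact_mod_cast (hG' n h).2.2 H hH.1 (hH.2.mono hγ₀le)
  · rw [hG'none n h, symmDiff_self, Set.bot_eq_empty, Set.ncard_empty, Nat.cast_zero]
    positivity
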